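/- **Definitions.** A *prop* is a symmetric strict monoidal category whose objects are the natural numbers and whose tensor product on objects is addition; a *morphism of props* is an identity-on-objects symmetric strict monoidal functor. A *corelation* $X\to Y$ between sets is a partition of the disjoint union $X+Y$; the composite of $\alpha\colon X\to Y$ and $\beta\colon Y\to Z$ is the restriction to $X+Z$ of the finest partition of $X+Y+Z$ whose restrictions to $X+Y$ and $Y+Z$ are coarser than $\alpha$ and $\beta$ respectively. Finite sets and corelations form a symmetric monoidal category under disjoint union. Let $\mathbf{Corel}$ be the prop whose morphisms $n\to m$ are the corelations from $\{0,\dots,n-1\}$ to $\{0,\dots,m-1\}$, with disjoint union transported along the bijections $\{0,\dots,n-1\}+\{0,\dots,m-1\}\cong\{0,\dots,n+m-1\}$. An *extraspecial commutative Frobenius monoid* in a symmetric monoidal category $(\mathcal C,\otimes,I)$ is an object $X$ with a commutative monoid structure $(\mu\colon X\otimes X\to X,\ \eta\colon I\to X)$ and a cocommutative comonoid structure $(\delta\colon X\to X\otimes X,\ \epsilon\colon X\to I)$ such that (suppressing associators) $(1\otimes\mu)(\delta\otimes 1)=\delta\mu=(\mu\otimes1)(1\otimes\delta)$ (Frobenius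 law), $\mu\delta=1_X$ (special law) and $\epsilon\eta=1_I$ (extra law); a morphism of these is a morphism of $\mathcal C$ commuting with $\mu,\eta,\delta,\epsilon$. Let $\mathbf{Th(ESCFM)}$ be the prop presented by generators $\mu\colon2\to1$, $\eta\colon0\to1$, $\delta\colon1\to2$, $\epsilon\colon1\to0$ and these equations: its morphisms are the terms built from the generators, identities and braidings by composition and tensor product, modulo the least congruence containing the laws of props and the equations. **Theorem.** 1. $\mathbf{Corel}$ is a skeleton of the category of finite sets and corelations, by a symmetric monoidal functor. 2. There is an isomorphism of props $\mathbf{Th(ESCFM)}\cong\mathbf{Corel}$, and it can be chosen to send each of $\mu,\eta,\delta,\epsilon$ to the corelation with exactly one block. 3. The category of finite sets and corelations is equivalent, as a symmetric monoidal category, to $\mathbf{Th(ESCFM)}$. 4. $\mathbf{Corel}$ is the prop for extraspecial commutative Frobenius monoids: for every symmetric monoidal category $\mathcal C$, the category of (strong) symmetric monoidal functors $\mathbf{Corel}\to\mathcal C$ and monoidal natural transformations is equivalent to the category of extraspecial commutative Frobenius monoids in $\mathcal C$, by an equivalence which, up to natural isomorphism, takes a functor to a monoid whose underlying object is its value at $1$.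 -/

import Mathlib

open CategoryTheory MonoidalCategory

universe w v u

/-! ### Corelations -/

/-- A corelation from `X` to `Y` is a partition of the disjoint union `X + Y`, encoded by the
corresponding equivalence relation. In the lattice of equivalence relations `r ≤ s` means that
`r` is finer than `s`. -/
abbrev Corelation (X Y : Type*) := Setoid (X ⊕ Y)

namespace Corelation

section

variable {X Y Z W X' Y' Z' : Type*}

/-- The inclusion of `X + Y` into `X + Y + Z`. -/
def inXY (X Y Z : Type*) : X ⊕ Y → X ⊕ Y ⊕ Z := Sum.map id Sum.inl

/-- The inclusion of `Y + Z` into `X + Y + Z`. -/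
def inYZ (X Y Z : Type*) : Y ⊕ Z → X ⊕ Y ⊕ Z := Sum.inr

/-- The inclusion of `X + Z` into `X + Y + Z`. -/
def inXZ (X Y Z : Type*) : X ⊕ Z → X ⊕ Y ⊕ Z := Sum.map id Sum.inr

/-- The finest partition of `X + Y + Z` whose restrictions to `X + Y` and to `Y + Z` are coarser
than `α` and `β` respectively. -/
def glue (α : Corelation X Y) (β : Corelation Y Z) : Setoid (X ⊕ Y ⊕ Z) :=
  sInf {s | α ≤ s.comap (inXY X Y Z) ∧ β ≤ s.comap (inYZ X Y Z)}

/-- Composition of corelations, in diagrammatic order. -/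
def comp (α : Corelation X Y) (β : Corelation Y Z) : Corelation X Z :=
  (glue α β).comap (inXZ X Y Z)

/-- The corelation of a bijection `e`, with blocks `{x, e x}`. -/
def ofEquiv (e : X ≃ Y) : Corelation X Y := Setoid.ker (Sum.elim e id)

/-- The identity corelation, whose blocks consist of the two copies of an element of `X`. -/
def id (X : Type*) : Corelation X X := Setoid.ker (Sum.elim _root_.id _root_.id)

/-- The disjoint union of corelations: its blocks are the blocks of `α` and the blocks of `β`. -/
def tensor (α : Corelation X Y) (β : Corelation X' Y') : Corelation (X ⊕ X') (Y ⊕ Y') where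
  r a b := Sum.LiftRel α β (Equiv.sumSumSumComm X X' Y Y' a) (Equiv.sumSumSumComm X X' Y Y' b)
  iseqv :=
    { refl := fun a => by
        cases Equiv.sumSumSumComm X X' Y Y' a
        · exact Sum.LiftRel.inl (α.refl _)
        · exact Sum.LiftRel.inr (β.refl _)
      symm := fun {a b} h => by
        revert h
        generalize Equiv.sumSumSumComm X X' Y Y' a = a'
        generalize Equiv.sumSumSumComm X X' Y Y' b = b'
        rintro (h | h)
        · exact Sum.LiftRel.inl (α.symm h)
        · exact Sum.LiftRel.inr (β.symm h)
      trans := fun {a b c} h h' => by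
        revert h h'
        generalize Equiv.sumSumSumComm X X' Y Y' a = a'
        generalize Equiv.sumSumSumComm X X' Y Y' b = b'
        generalize Equiv.sumSumSumComm X X' Y Y' c = c'
        rintro (h | h) h'
        · obtain ⟨h'⟩ := h'
          exact Sum.LiftRel.inl (α.trans h ‹_›)
        · obtain _ | ⟨h'⟩ := h'
          exact Sum.LiftRel.inr (β.trans h ‹_›) }

/-- Auxiliary: a two-colouring of `X + Y` is constant on the blocks of `α`. -/
def Colors (α : Corelation X Y) (u : X → Prop) (v : Y → Prop) : Prop :=
  ∀ a b, α a b → (Sum.elim u v a ↔ Sum.elim u v b)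

theorem ext_colors {α β : Corelation X Y} (h : ∀ u v, α.Colors u v ↔ β.Colors u v) : α = β := by
  have key : ∀ {α β : Corelation X Y}, (∀ u v, β.Colors u v → α.Colors u v) → α ≤ β := by
    intro α β h a b hab
    have hc := h (fun x => β a (Sum.inl x)) (fun y => β a (Sum.inr y)) (fun c d hcd => by
      have : ∀ c, Sum.elim (fun x => β a (Sum.inl x)) (fun y => β a (Sum.inr y)) c = β a c := by
        rintro (c | c) <;> rfl
      rw [this, this]
      exact ⟨fun h => β.trans h hcd, fun h => β.trans h (β.symm hcd)⟩) a b hab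
    have : ∀ c, Sum.elim (fun x => β a (Sum.inl x)) (fun y => β a (Sum.inr y)) c = β a c := by
      rintro (c | c) <;> rfl
    rw [this, this] at hc
    exact hc.1 (β.refl a)
  exact le_antisymm (key fun u v => (h u v).2) (key fun u v => (h u v).1)

theorem colors_comp (α : Corelation X Y) (β : Corelation Y Z) (u : X → Prop) (w : Z → Prop) :
    (comp α β).Colors u w ↔ ∃ v, α.Colors u v ∧ β.Colors v w := by
  constructor
  · intro h
    let c : X ⊕ Y ⊕ Z → Prop := fun q => ∃ p, glue α β q (inXZ X Y Z p) ∧ Sum.elim u w p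
    have hinv : ∀ q q', glue α β q q' → (c q ↔ c q') := fun q q' hq =>
      ⟨fun ⟨p, hp, hc⟩ => ⟨p, (glue α β).trans ((glue α β).symm hq) hp, hc⟩,
        fun ⟨p, hp, hc⟩ => ⟨p, (glue α β).trans hq hp, hc⟩⟩
    have hXZ : ∀ p, c (inXZ X Y Z p) ↔ Sum.elim u w p := fun p =>
      ⟨fun ⟨p', hp, hc⟩ => (h p p' hp).2 hc, fun hc => ⟨p, (glue α β).refl _, hc⟩⟩
    have hα : ∀ a b, α a b → glue α β (inXY X Y Z a) (inXY X Y Z b) :=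
      fun a b hab s hs => hs.1 hab
    have hβ : ∀ a b, β a b → glue α β (inYZ X Y Z a) (inYZ X Y Z b) :=
      fun a b hab s hs => hs.2 hab
    refine ⟨fun y => c (Sum.inr (Sum.inl y)), fun a b hab => ?_, fun a b hab => ?_⟩
    · have e : ∀ a, Sum.elim u (fun y => c (Sum.inr (Sum.inl y))) a ↔ c (inXY X Y Z a) := by
        rintro (x | y)
        · exact (hXZ (Sum.inl x)).symm
        · exact Iff.rfl
      rw [e, e]
      exact hinv _ _ (hα a b hab)
    · have e : ∀ a, Sum.elim (fun y => c (Sum.inr (Sum.inl y))) w a ↔ c (inYZ X Y Z a) := by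
        rintro (y | z)
        · exact Iff.rfl
        · exact (hXZ (Sum.inr z)).symm
      rw [e, e]
      exact hinv _ _ (hβ a b hab)
  · rintro ⟨v, hα, hβ⟩ a b hab
    have := hab (Setoid.ker (Sum.elim u (Sum.elim v w))) ⟨fun a b h => by
      have := hα a b h
      rcases a with a | a <;> rcases b with b | b <;> exact propext this, fun a b h => by
      have := hβ a b h
      rcases a with a | a <;> rcases b with b | b <;> exact propext this⟩
    rcases a with a | a <;> rcases b with b | b <;> exact iff_of_eq this

theorem colors_ofEquiv (e : X ≃ Y) (u : X → Prop) (v : Y → Prop) :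
    (ofEquiv e).Colors u v ↔ u = v ∘ e := by
  constructor
  · intro h
    funext x
    exact propext (h (Sum.inl x) (Sum.inr (e x)) rfl)
  · rintro rfl a b hab
    have e' : ∀ a, Sum.elim (v ∘ e) v a = v (Sum.elim e _root_.id a) := by
      rintro (a | a) <;> rfl
    have : Sum.elim e _root_.id a = Sum.elim e _root_.id b := hab
    rw [e', e', this]

theorem id_eq (X : Type*) : id X = ofEquiv (Equiv.refl X) := rfl

theorem colors_id (u v : X → Prop) : (id X).Colors u v ↔ u = v := colors_ofEquiv (Equiv.refl X) u v

theorem colors_tensor (α : Corelation X Y) (β : Corelation X' Y') (u : X ⊕ X' → Prop)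
    (v : Y ⊕ Y' → Prop) : (tensor α β).Colors u v ↔
      α.Colors (u ∘ Sum.inl) (v ∘ Sum.inl) ∧ β.Colors (u ∘ Sum.inr) (v ∘ Sum.inr) := by
  constructor
  · intro h
    refine ⟨fun a b hab => ?_, fun a b hab => ?_⟩
    · have := h (Sum.map Sum.inl Sum.inl a) (Sum.map Sum.inl Sum.inl b) (by
        rcases a with a | a <;> rcases b with b | b <;> exact Sum.LiftRel.inl hab)
      rcases a with a | a <;> rcases b with b | b <;> exact this
    · have := h (Sum.map Sum.inr Sum.inr a) (Sum.map Sum.inr Sum.inr b) (by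
        rcases a with a | a <;> rcases b with b | b <;> exact Sum.LiftRel.inr hab)
      rcases a with a | a <;> rcases b with b | b <;> exact this
  · rintro ⟨hα, hβ⟩ a b hab
    change Sum.LiftRel α β (Equiv.sumSumSumComm X X' Y Y' a) (Equiv.sumSumSumComm X X' Y Y' b)
      at hab
    rcases a with (a | a) | (a | a) <;> rcases b with (b | b) | (b | b) <;>
      simp at hab <;> first | exact hα _ _ hab | exact hβ _ _ hab

theorem id_comp (α : Corelation X Y) : comp (id X) α = α :=
  ext_colors fun u v => by simp [colors_comp, colors_id]

theorem comp_id (α : Corelation X Y) : comp α (id Y) = α :=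
  ext_colors fun u v => by simp [colors_comp, colors_id]

theorem comp_assoc (α : Corelation X Y) (β : Corelation Y Z) (γ : Corelation Z W) :
    comp (comp α β) γ = comp α (comp β γ) :=
  ext_colors fun u v => by
    simp only [colors_comp]
    exact ⟨fun ⟨b, ⟨a, h1, h2⟩, h3⟩ => ⟨a, h1, b, h2, h3⟩,
      fun ⟨a, h1, b, h2, h3⟩ => ⟨b, ⟨a, h1, h2⟩, h3⟩⟩

theorem tensor_comp (α : Corelation X Y) (β : Corelation Y Z) (α' : Corelation X' Y')
    (β' : Corelation Y' Z') :
    comp (tensor α α') (tensor β β') = tensor (comp α β) (comp α' β') :=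
  ext_colors fun u v => by
    simp only [colors_comp, colors_tensor]
    exact ⟨fun ⟨w, ⟨h1, h2⟩, h3, h4⟩ => ⟨⟨_, h1, h3⟩, _, h2, h4⟩,
      fun ⟨⟨w, h1, h3⟩, w', h2, h4⟩ => ⟨Sum.elim w w', ⟨h1, h2⟩, h3, h4⟩⟩

theorem ofEquiv_comp (e : X ≃ Y) (f : Y ≃ Z) : comp (ofEquiv e) (ofEquiv f) = ofEquiv (e.trans f) :=
  ext_colors fun u v => by
    simp only [colors_comp, colors_ofEquiv, exists_eq_right]
    rfl

theorem ofEquiv_tensor (e : X ≃ Y) (f : X' ≃ Y') :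
    tensor (ofEquiv e) (ofEquiv f) = ofEquiv (Equiv.sumCongr e f) :=
  ext_colors fun u v => by
    simp only [colors_tensor, colors_ofEquiv]
    constructor
    · rintro ⟨h1, h2⟩
      funext x
      rcases x with x | x
      · exact congrFun h1 x
      · exact congrFun h2 x
    · rintro rfl
      exact ⟨rfl, rfl⟩

theorem colors_ofEquiv_comp (e : X ≃ Y) (α : Corelation Y Z) (u : X → Prop) (v : Z → Prop) :
    (comp (ofEquiv e) α).Colors u v ↔ α.Colors (u ∘ e.symm) v := by
  rw [colors_comp]
  simp only [colors_ofEquiv]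
  constructor
  · rintro ⟨w, rfl, h⟩
    simpa [Function.comp_assoc] using h
  · intro h
    exact ⟨_, by simp [Function.comp_assoc], h⟩

theorem colors_comp_ofEquiv (e : Y ≃ Z) (α : Corelation X Y) (u : X → Prop) (v : Z → Prop) :
    (comp α (ofEquiv e)).Colors u v ↔ α.Colors u (v ∘ e) := by
  rw [colors_comp]
  simp only [colors_ofEquiv]
  exact ⟨fun ⟨w, h, hw⟩ => hw ▸ h, fun h => ⟨_, h, rfl⟩⟩

end

end Corelation

/-! ### The symmetric monoidal category of finite sets and corelations -/

/-- Objects of the category of corelations: finite sets. -/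
structure FinCorel : Type (w + 1) where
  /-- The underlying set. -/
  carrier : Type w
  [finite : Finite carrier]

namespace FinCorel

attribute [instance] FinCorel.finite

instance : Category FinCorel.{w} where
  Hom X Y := Corelation X.carrier Y.carrier
  id X := Corelation.id X.carrier
  comp α β := Corelation.comp α β
  id_comp := Corelation.id_comp
  comp_id := Corelation.comp_id
  assoc := Corelation.comp_assoc

/-- The isomorphism of corelations given by a bijection. -/
def isoOfEquiv {X Y : FinCorel.{w}} (e : X.carrier ≃ Y.carrier) : X ≅ Y where
  hom := Corelation.ofEquiv e
  inv := Corelation.ofEquiv e.symm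
  hom_inv_id := by
    refine (Corelation.ofEquiv_comp _ _).trans ?_
    rw [Equiv.self_trans_symm]; rfl
  inv_hom_id := by
    refine (Corelation.ofEquiv_comp _ _).trans ?_
    rw [Equiv.symm_trans_self]; rfl

instance : MonoidalCategoryStruct FinCorel.{w} where
  tensorObj X Y := ⟨X.carrier ⊕ Y.carrier⟩
  tensorUnit := ⟨PEmpty⟩
  tensorHom α β := Corelation.tensor α β
  whiskerLeft X _ _ α := Corelation.tensor (Corelation.id X.carrier) α
  whiskerRight α X := Corelation.tensor α (Corelation.id X.carrier)
  associator X Y Z := isoOfEquiv (Equiv.sumAssoc X.carrier Y.carrier Z.carrier)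
  leftUnitor X := isoOfEquiv (Equiv.emptySum PEmpty X.carrier)
  rightUnitor X := isoOfEquiv (Equiv.sumEmpty X.carrier PEmpty)

instance : MonoidalCategory FinCorel.{w} :=
  MonoidalCategory.ofTensorHom
    (id_tensorHom_id := fun X Y => by
      refine (Corelation.ofEquiv_tensor (Equiv.refl _) (Equiv.refl _)).trans ?_
      rw [Equiv.sumCongr_refl]; rfl)
    (id_tensorHom := fun _ _ _ _ => rfl)
    (tensorHom_id := fun _ _ => rfl)
    (tensorHom_comp_tensorHom := fun f g f' g' => Corelation.tensor_comp f f' g g')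
    (associator_naturality := fun f g h => Corelation.ext_colors fun u v => by
      refine (Corelation.colors_comp_ofEquiv _ _ _ _).trans
        (Iff.trans ?_ (Corelation.colors_ofEquiv_comp _ _ _ _).symm)
      refine (Corelation.colors_tensor _ _ _ _).trans
        (Iff.trans ?_ (Corelation.colors_tensor _ _ _ _).symm)
      refine (and_congr_left' (Corelation.colors_tensor _ _ _ _)).trans
        (Iff.trans ?_ (and_congr_right' (Corelation.colors_tensor _ _ _ _)).symm)
      exact and_assoc)
    (leftUnitor_naturality := fun f => Corelation.ext_colors fun u v => by
      refine (Corelation.colors_comp_ofEquiv _ _ _ _).trans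
        (Iff.trans ?_ (Corelation.colors_ofEquiv_comp _ _ _ _).symm)
      refine (Corelation.colors_tensor _ _ _ _).trans ?_
      refine (and_congr_left' (Corelation.colors_id _ _)).trans ?_
      exact and_iff_right (funext fun x => x.elim))
    (rightUnitor_naturality := fun f => Corelation.ext_colors fun u v => by
      refine (Corelation.colors_comp_ofEquiv _ _ _ _).trans
        (Iff.trans ?_ (Corelation.colors_ofEquiv_comp _ _ _ _).symm)
      refine (Corelation.colors_tensor _ _ _ _).trans ?_
      refine (and_congr_right' (Corelation.colors_id _ _)).trans ?_
      exact and_iff_left (funext fun x => x.elim))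
    (pentagon := fun W X Y Z => by
      change Corelation.comp (Corelation.tensor (Corelation.ofEquiv _)
        (Corelation.ofEquiv (Equiv.refl _))) (Corelation.comp (Corelation.ofEquiv _)
        (Corelation.tensor (Corelation.ofEquiv (Equiv.refl _)) (Corelation.ofEquiv _))) =
        Corelation.comp (Corelation.ofEquiv _) (Corelation.ofEquiv _)
      simp only [Corelation.ofEquiv_tensor, Corelation.ofEquiv_comp]
      congr 1
      ext x
      rcases x with ((x | x) | x) | x <;> rfl)
    (triangle := fun X Y => by
      change Corelation.comp (Corelation.ofEquiv _)
        (Corelation.tensor (Corelation.ofEquiv (Equiv.refl _)) (Corelation.ofEquiv _)) =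
        Corelation.tensor (Corelation.ofEquiv _) (Corelation.ofEquiv (Equiv.refl _))
      simp only [Corelation.ofEquiv_tensor, Corelation.ofEquiv_comp]
      congr 1
      ext x
      rcases x with (x | x) | x
      · rfl
      · exact x.elim
      · rfl)

theorem braiding_naturality {X Y X' Y' : FinCorel.{w}} (f : X ⟶ Y) (g : X' ⟶ Y') :
    Corelation.comp (Corelation.tensor f g)
        (Corelation.ofEquiv (Equiv.sumComm Y.carrier Y'.carrier)) =
      Corelation.comp (Corelation.ofEquiv (Equiv.sumComm X.carrier X'.carrier))
        (Corelation.tensor g f) :=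
  Corelation.ext_colors fun u v => by
    rw [Corelation.colors_comp_ofEquiv, Corelation.colors_ofEquiv_comp, Corelation.colors_tensor,
      Corelation.colors_tensor]
    exact and_comm

instance : SymmetricCategory FinCorel.{w} where
  braiding X Y := isoOfEquiv (Equiv.sumComm X.carrier Y.carrier)
  braiding_naturality_right X Y Z f := braiding_naturality (𝟙 X) f
  braiding_naturality_left f Z := braiding_naturality f (𝟙 Z)
  hexagon_forward X Y Z := by
    change Corelation.comp (Corelation.ofEquiv _) (Corelation.comp (Corelation.ofEquiv _)
      (Corelation.ofEquiv _)) = Corelation.comp (Corelation.tensor (Corelation.ofEquiv _)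
      (Corelation.ofEquiv (Equiv.refl _))) (Corelation.comp (Corelation.ofEquiv _)
      (Corelation.tensor (Corelation.ofEquiv (Equiv.refl _)) (Corelation.ofEquiv _)))
    simp only [Corelation.ofEquiv_tensor, Corelation.ofEquiv_comp]
    congr 1
    ext x
    rcases x with (x | x) | x <;> rfl
  hexagon_reverse X Y Z := by
    change Corelation.comp (Corelation.ofEquiv _) (Corelation.comp (Corelation.ofEquiv _)
      (Corelation.ofEquiv _)) = Corelation.comp (Corelation.tensor
      (Corelation.ofEquiv (Equiv.refl _)) (Corelation.ofEquiv _))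
      (Corelation.comp (Corelation.ofEquiv _)
      (Corelation.tensor (Corelation.ofEquiv _) (Corelation.ofEquiv (Equiv.refl _))))
    simp only [Corelation.ofEquiv_tensor, Corelation.ofEquiv_comp]
    congr 1
    ext x
    rcases x with x | (x | x) <;> rfl
  symmetry X Y := by
    change Corelation.comp (Corelation.ofEquiv _) (Corelation.ofEquiv _) =
      Corelation.ofEquiv (Equiv.refl _)
    rw [Corelation.ofEquiv_comp]
    congr 1
    ext x
    rcases x with x | x <;> rfl

end FinCorel

/-! ### Props -/

/-- The operations of a prop: a symmetric strict monoidal category with objects the natural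
numbers and tensor product of objects given by addition. Composition is in diagrammatic order. -/
structure PROPData : Type (w + 1) where
  /-- The morphisms `n → m`. -/
  Hom : ℕ → ℕ → Type w
  /-- Identities. -/
  id : ∀ n, Hom n n
  /-- Composition. -/
  comp : ∀ {n m p}, Hom n m → Hom m p → Hom n p
  /-- The monoidal product of morphisms. -/
  tensor : ∀ {n m p q}, Hom n m → Hom p q → Hom (n + p) (m + q)
  /-- The braiding. -/
  braid : ∀ n m, Hom (n + m) (m + n)

/-- The identity, regarded as a morphism between equal objects. -/
def PROPData.eqHom (P : PROPData.{w}) {n m : ℕ} (h : n = m) : P.Hom n m := h ▸ P.id n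

/-- A prop. Strictness says that the identities `eqHom` serve as associators and unitors. -/
structure PROP : Type (w + 1) extends PROPData.{w} where
  id_comp : ∀ {n m} (f : Hom n m), comp (id n) f = f
  comp_id : ∀ {n m} (f : Hom n m), comp f (id m) = f
  assoc : ∀ {n m p q} (f : Hom n m) (g : Hom m p) (h : Hom p q),
    comp (comp f g) h = comp f (comp g h)
  tensor_id : ∀ n m, tensor (id n) (id m) = id (n + m)
  tensor_comp : ∀ {n m p n' m' p'} (f : Hom n m) (g : Hom m p) (f' : Hom n' m') (g' : Hom m' p'),
    comp (tensor f f') (tensor g g') = tensor (comp f g) (comp f' g')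
  tensor_assoc : ∀ {n m n' m' n'' m''} (f : Hom n m) (g : Hom n' m') (h : Hom n'' m''),
    comp (tensor (tensor f g) h) (toPROPData.eqHom (Nat.add_assoc m m' m'')) =
      comp (toPROPData.eqHom (Nat.add_assoc n n' n'')) (tensor f (tensor g h))
  unit_tensor : ∀ {n m} (f : Hom n m),
    comp (tensor (id 0) f) (toPROPData.eqHom (Nat.zero_add m)) =
      comp (toPROPData.eqHom (Nat.zero_add n)) f
  tensor_unit : ∀ {n m} (f : Hom n m),
    comp (tensor f (id 0)) (toPROPData.eqHom (Nat.add_zero m)) =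
      comp (toPROPData.eqHom (Nat.add_zero n)) f
  braid_naturality : ∀ {n m n' m'} (f : Hom n m) (g : Hom n' m'),
    comp (tensor f g) (braid m m') = comp (braid n n') (tensor g f)
  braid_braid : ∀ n m, comp (braid n m) (braid m n) = id (n + m)
  hexagon : ∀ n m p,
    comp (toPROPData.eqHom (Nat.add_assoc n m p))
        (comp (braid n (m + p)) (toPROPData.eqHom (Nat.add_assoc m p n))) =
      comp (tensor (braid n m) (id p))
        (comp (toPROPData.eqHom (Nat.add_assoc m n p)) (tensor (id m) (braid n p)))

namespace PROP

/-- A morphism of props: an identity-on-objects symmetric strict monoidal functor. -/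
@[ext]
structure Morphism (P Q : PROP.{w}) where
  /-- The action on morphisms. -/
  map : ∀ {n m}, P.Hom n m → Q.Hom n m
  map_id : ∀ n, map (P.id n) = Q.id n
  map_comp : ∀ {n m p} (f : P.Hom n m) (g : P.Hom m p),
    map (P.comp f g) = Q.comp (map f) (map g)
  map_tensor : ∀ {n m p q} (f : P.Hom n m) (g : P.Hom p q),
    map (P.tensor f g) = Q.tensor (map f) (map g)
  map_braid : ∀ n m, map (P.braid n m) = Q.braid n m

/-- The category of props. -/
instance : Category PROP.{w} where
  Hom P Q := Morphism P Q
  id P := ⟨fun f => f, fun _ => rfl, fun _ _ => rfl, fun _ _ => rfl, fun _ _ => rfl⟩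
  comp F G :=
    { map := fun f => G.map (F.map f)
      map_id := fun n => by rw [F.map_id, G.map_id]
      map_comp := fun f g => by rw [F.map_comp, G.map_comp]
      map_tensor := fun f g => by rw [F.map_tensor, G.map_tensor]
      map_braid := fun n m => by rw [F.map_braid, G.map_braid] }

variable (P : PROP.{w})

/-- The objects of a prop, seen as a symmetric monoidal category: natural numbers. -/
@[ext]
structure Obj (P : PROP.{w}) : Type where
  /-- The underlying natural number. -/
  val : ℕ

instance : Category P.Obj where
  Hom n m := P.Hom n.val m.val
  id n := P.id n.val
  comp f g := P.comp f g
  id_comp := P.id_comp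
  comp_id := P.comp_id
  assoc := P.assoc

theorem eqHom_comp {n m p : ℕ} (h : n = m) (h' : m = p) :
    P.comp (P.eqHom h) (P.eqHom h') = P.eqHom (h.trans h') := by
  subst h h'; exact P.id_comp _

theorem eqHom_tensor {n m n' m' : ℕ} (h : n = m) (h' : n' = m') :
    P.tensor (P.eqHom h) (P.eqHom h') = P.eqHom (congrArg₂ (· + ·) h h') := by
  subst h h'; exact P.tensor_id _ _

/-- The identity between equal objects as an isomorphism. -/
def eqIso {n m : P.Obj} (h : n.val = m.val) : n ≅ m where
  hom := P.eqHom h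
  inv := P.eqHom h.symm
  hom_inv_id := P.eqHom_comp h h.symm
  inv_hom_id := P.eqHom_comp h.symm h

theorem pentagon (n m p q : ℕ) :
    P.comp (P.tensor (P.eqHom (Nat.add_assoc n m p)) (P.id q))
        (P.comp (P.eqHom (Nat.add_assoc n (m + p) q))
          (P.tensor (P.id n) (P.eqHom (Nat.add_assoc m p q)))) =
      P.comp (P.eqHom (Nat.add_assoc (n + m) p q)) (P.eqHom (Nat.add_assoc n m (p + q))) := by
  change P.comp (P.tensor _ (P.eqHom rfl)) (P.comp _ (P.tensor (P.eqHom rfl) _)) = _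
  simp only [eqHom_tensor, eqHom_comp]

theorem triangle (n m : ℕ) :
    P.comp (P.eqHom (Nat.add_assoc n 0 m)) (P.tensor (P.id n) (P.eqHom (Nat.zero_add m))) =
      P.tensor (P.eqHom (Nat.add_zero n)) (P.id m) := by
  change P.comp _ (P.tensor (P.eqHom rfl) _) = P.tensor _ (P.eqHom rfl)
  simp only [eqHom_tensor, eqHom_comp]

instance : MonoidalCategoryStruct P.Obj where
  tensorObj n m := ⟨n.val + m.val⟩
  tensorUnit := ⟨0⟩
  tensorHom f g := P.tensor f g
  whiskerLeft n _ _ f := P.tensor (P.id n.val) f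
  whiskerRight f n := P.tensor f (P.id n.val)
  associator n m p := P.eqIso (Nat.add_assoc n.val m.val p.val)
  leftUnitor n := P.eqIso (Nat.zero_add n.val)
  rightUnitor n := P.eqIso (Nat.add_zero n.val)

instance : MonoidalCategory P.Obj :=
  MonoidalCategory.ofTensorHom
    (id_tensorHom_id := fun n m => P.tensor_id n.val m.val)
    (id_tensorHom := fun _ _ _ _ => rfl)
    (tensorHom_id := fun _ _ => rfl)
    (tensorHom_comp_tensorHom := fun f g f' g' => P.tensor_comp f f' g g')
    (associator_naturality := fun f g h => P.tensor_assoc f g h)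
    (leftUnitor_naturality := fun f => P.unit_tensor f)
    (rightUnitor_naturality := fun f => P.tensor_unit f)
    (pentagon := fun n m p q => P.pentagon n.val m.val p.val q.val)
    (triangle := fun n m => P.triangle n.val m.val)

/-- The braiding as an isomorphism. -/
def braidIso (n m : P.Obj) : n ⊗ m ≅ m ⊗ n where
  hom := P.braid n.val m.val
  inv := P.braid m.val n.val
  hom_inv_id := P.braid_braid n.val m.val
  inv_hom_id := P.braid_braid m.val n.val

theorem hexagon_forward (n m p : P.Obj) :
    (α_ n m p).hom ≫ (P.braidIso n (m ⊗ p)).hom ≫ (α_ m p n).hom =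
      (P.braidIso n m).hom ▷ p ≫ (α_ m n p).hom ≫ m ◁ (P.braidIso n p).hom :=
  P.hexagon n.val m.val p.val

instance : SymmetricCategory P.Obj where
  braiding n m := P.braidIso n m
  braiding_naturality_right n _ _ f := P.braid_naturality (P.id n.val) f
  braiding_naturality_left f n := P.braid_naturality f (P.id n.val)
  hexagon_forward n m p := P.hexagon_forward n m p
  hexagon_reverse n m p := by
    have h' : (α_ p n m ≪≫ P.braidIso p (n ⊗ m) ≪≫ α_ n m p) =
        whiskerRightIso (P.braidIso p n) m ≪≫ α_ n p m ≪≫ whiskerLeftIso n (P.braidIso p m) :=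
      Iso.ext (P.hexagon_forward p n m)
    have h'' := congrArg Iso.inv h'
    simp only [Iso.trans_inv, whiskerRightIso_inv, whiskerLeftIso_inv, Category.assoc] at h''
    exact h''
  symmetry n m := P.braid_braid n.val m.val

end PROP

/-! ### The prop of corelations -/

namespace Corelation

/-- The disjoint union of corelations between the sets `{0, …, n - 1}`, transported along
`Fin n + Fin m ≃ Fin (n + m)`. -/
def finTensor {n m p q : ℕ} (α : Corelation (Fin n) (Fin m)) (β : Corelation (Fin p) (Fin q)) :
    Corelation (Fin (n + p)) (Fin (m + q)) :=
  (tensor α β).comap (Sum.map finSumFinEquiv.symm finSumFinEquiv.symm)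

/-- The swap of disjoint unions, transported along `Fin n + Fin m ≃ Fin (n + m)`. -/
def finBraid (n m : ℕ) : Corelation (Fin (n + m)) (Fin (m + n)) :=
  ofEquiv (finSumFinEquiv.symm.trans ((Equiv.sumComm (Fin n) (Fin m)).trans finSumFinEquiv))

theorem comap_eq {X Y X' Y' : Type*} (e : X ≃ X') (f : Y ≃ Y') (α : Corelation X Y) :
    α.comap (Sum.map e.symm f.symm) = comp (ofEquiv e.symm) (comp α (ofEquiv f)) :=
  ext_colors fun u v => by
    rw [colors_ofEquiv_comp, colors_comp_ofEquiv]
    have key : ∀ a, Sum.elim (u ∘ e.symm.symm) (v ∘ f) (Sum.map e.symm f.symm a) =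
        Sum.elim u v a := by
      rintro (a | a) <;> simp
    constructor
    · intro h a b hab
      obtain ⟨a, rfl⟩ := (Equiv.sumCongr e.symm f.symm).surjective a
      obtain ⟨b, rfl⟩ := (Equiv.sumCongr e.symm f.symm).surjective b
      have := h a b hab
      rw [← key, ← key] at this
      exact this
    · intro h a b hab
      have := h _ _ hab
      rwa [key, key] at this

theorem finTensor_eq {n m p q : ℕ} (α : Corelation (Fin n) (Fin m))
    (β : Corelation (Fin p) (Fin q)) :
    finTensor α β = comp (ofEquiv finSumFinEquiv.symm)
      (comp (tensor α β) (ofEquiv finSumFinEquiv)) := comap_eq _ _ _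

theorem colors_finTensor {n m p q : ℕ} (α : Corelation (Fin n) (Fin m))
    (β : Corelation (Fin p) (Fin q)) (u : Fin (n + p) → Prop) (v : Fin (m + q) → Prop) :
    Colors (finTensor α β) u v ↔
      α.Colors (fun i => u (Fin.castAdd p i)) (fun i => v (Fin.castAdd q i)) ∧
        β.Colors (fun i => u (Fin.natAdd n i)) (fun i => v (Fin.natAdd m i)) := by
  rw [finTensor_eq, colors_ofEquiv_comp, colors_comp_ofEquiv, colors_tensor]
  rfl

theorem ofEquiv_finTensor {n m p q : ℕ} (e : Fin n ≃ Fin m) (f : Fin p ≃ Fin q) :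
    finTensor (ofEquiv e) (ofEquiv f) = ofEquiv (finSumFinEquiv.symm.trans
      ((Equiv.sumCongr e f).trans finSumFinEquiv)) := by
  rw [finTensor_eq, ofEquiv_tensor, ofEquiv_comp, ofEquiv_comp]

theorem finTensor_id (n m : ℕ) : finTensor (id (Fin n)) (id (Fin m)) = id (Fin (n + m)) := by
  rw [id_eq, id_eq, id_eq, ofEquiv_finTensor]
  congr 1
  ext x
  simp

theorem finTensor_comp {n m p n' m' p' : ℕ} (f : Corelation (Fin n) (Fin m))
    (g : Corelation (Fin m) (Fin p)) (f' : Corelation (Fin n') (Fin m'))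
    (g' : Corelation (Fin m') (Fin p')) :
    comp (finTensor f f') (finTensor g g') = finTensor (comp f g) (comp f' g') :=
  ext_colors fun u v => by
    simp only [colors_comp, colors_finTensor]
    refine ⟨fun ⟨w, ⟨h1, h2⟩, h3, h4⟩ => ⟨⟨_, h1, h3⟩, _, h2, h4⟩,
      fun ⟨⟨w, h1, h3⟩, w', h2, h4⟩ => ⟨Fin.append w w', ⟨?_, ?_⟩, ?_, ?_⟩⟩
    all_goals
      simp only [Fin.append_left, Fin.append_right]
      assumption

theorem finTensor_assoc {n m n' m' n'' m'' : ℕ} (f : Corelation (Fin n) (Fin m))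
    (g : Corelation (Fin n') (Fin m')) (h : Corelation (Fin n'') (Fin m'')) :
    comp (finTensor (finTensor f g) h) (ofEquiv (finCongr (Nat.add_assoc m m' m''))) =
      comp (ofEquiv (finCongr (Nat.add_assoc n n' n''))) (finTensor f (finTensor g h)) :=
  ext_colors fun u v => by
    simp only [colors_comp_ofEquiv, colors_ofEquiv_comp, colors_finTensor, and_assoc]
    refine and_congr ?_ (and_congr ?_ ?_) <;> apply iff_of_eq <;> congr 1 <;> funext x <;>
      simp only [Function.comp_apply] <;> congr 1 <;> ext <;> simp [Nat.add_assoc]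

theorem unit_finTensor {n m : ℕ} (f : Corelation (Fin n) (Fin m)) :
    comp (finTensor (id (Fin 0)) f) (ofEquiv (finCongr (Nat.zero_add m))) =
      comp (ofEquiv (finCongr (Nat.zero_add n))) f :=
  ext_colors fun u v => by
    simp only [colors_comp_ofEquiv, colors_ofEquiv_comp, colors_finTensor, colors_id]
    rw [and_iff_right (funext fun x => x.elim0)]
    apply iff_of_eq
    congr 1 <;> funext x <;> simp only [Function.comp_apply] <;> congr 1 <;> ext <;> simp

theorem finTensor_unit {n m : ℕ} (f : Corelation (Fin n) (Fin m)) :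
    comp (finTensor f (id (Fin 0))) (ofEquiv (finCongr (Nat.add_zero m))) =
      comp (ofEquiv (finCongr (Nat.add_zero n))) f :=
  ext_colors fun u v => by
    simp only [colors_comp_ofEquiv, colors_ofEquiv_comp, colors_finTensor, colors_id]
    exact and_iff_left (funext fun x => x.elim0)

theorem finBraid_naturality {n m n' m' : ℕ} (f : Corelation (Fin n) (Fin m))
    (g : Corelation (Fin n') (Fin m')) :
    comp (finTensor f g) (finBraid m m') = comp (finBraid n n') (finTensor g f) :=
  ext_colors fun u v => by
    rw [finBraid, finBraid, colors_comp_ofEquiv, colors_ofEquiv_comp, colors_finTensor,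
      colors_finTensor, and_comm]
    refine and_congr ?_ ?_ <;> apply iff_of_eq <;> congr 1 <;> funext x <;> simp

theorem finBraid_finBraid (n m : ℕ) : comp (finBraid n m) (finBraid m n) = id (Fin (n + m)) := by
  rw [finBraid, finBraid, ofEquiv_comp, id_eq]
  congr 1
  ext x
  simp

theorem finBraid_hexagon (n m p : ℕ) :
    comp (ofEquiv (finCongr (Nat.add_assoc n m p)))
        (comp (finBraid n (m + p)) (ofEquiv (finCongr (Nat.add_assoc m p n)))) =
      comp (finTensor (finBraid n m) (id (Fin p)))
        (comp (ofEquiv (finCongr (Nat.add_assoc m n p)))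
          (finTensor (id (Fin m)) (finBraid n p))) := by
  simp only [finBraid, id_eq, ofEquiv_finTensor, ofEquiv_comp]
  congr 1
  apply Equiv.ext
  intro x
  have h1 : ∀ x : Fin p, finCongr (Nat.add_assoc n m p) (Fin.natAdd (n + m) x) =
      Fin.natAdd n (Fin.natAdd m x) := fun x => by ext; simp [Nat.add_assoc]
  have h2 : ∀ x : Fin m, finCongr (Nat.add_assoc n m p) (Fin.castAdd p (Fin.natAdd n x)) =
      Fin.natAdd n (Fin.castAdd p x) := fun x => by ext; simp
  have h3 : ∀ x : Fin n, finCongr (Nat.add_assoc n m p) (Fin.castAdd p (Fin.castAdd m x)) =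
      Fin.castAdd (m + p) x := fun x => by ext; simp
  have h4 : ∀ x : Fin p, finCongr (Nat.add_assoc m n p) (Fin.natAdd (m + n) x) =
      Fin.natAdd m (Fin.natAdd n x) := fun x => by ext; simp [Nat.add_assoc]
  have h5 : ∀ x : Fin n, finCongr (Nat.add_assoc m n p) (Fin.castAdd p (Fin.natAdd m x)) =
      Fin.natAdd m (Fin.castAdd p x) := fun x => by ext; simp
  have h6 : ∀ x : Fin m, finCongr (Nat.add_assoc m n p) (Fin.castAdd p (Fin.castAdd n x)) =
      Fin.castAdd (n + p) x := fun x => by ext; simp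
  induction x using Fin.addCases with
  | left x =>
    induction x using Fin.addCases with
    | left x => simp [Equiv.trans_apply, h3, h5, -finCongr_apply]; ext; simp [Nat.add_assoc]
    | right x => simp [Equiv.trans_apply, h2, h6, -finCongr_apply]; ext; simp
  | right x => simp [Equiv.trans_apply, h1, h4, -finCongr_apply]; ext; simp

end Corelation

/-- The operations of the prop of corelations: morphisms `n → m` are the corelations from
`{0, …, n - 1}` to `{0, …, m - 1}`. -/
def corelData : PROPData.{0} where
  Hom n m := Corelation (Fin n) (Fin m)
  id n := Corelation.id (Fin n)
  comp α β := Corelation.comp α β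
  tensor α β := Corelation.finTensor α β
  braid n m := Corelation.finBraid n m

theorem corelData_eqHom {n m : ℕ} (h : n = m) :
    corelData.eqHom h = Corelation.ofEquiv (finCongr h) := by
  subst h; rfl

/-- The prop of corelations. -/
def corelPROP : PROP.{0} where
  toPROPData := corelData
  id_comp := Corelation.id_comp
  comp_id := Corelation.comp_id
  assoc := Corelation.comp_assoc
  tensor_id := Corelation.finTensor_id
  tensor_comp f g f' g' := Corelation.finTensor_comp f g f' g'
  tensor_assoc f g h := by
    rw [corelData_eqHom, corelData_eqHom]
    exact Corelation.finTensor_assoc f g h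
  unit_tensor f := by
    rw [corelData_eqHom, corelData_eqHom]
    exact Corelation.unit_finTensor f
  tensor_unit f := by
    rw [corelData_eqHom, corelData_eqHom]
    exact Corelation.finTensor_unit f
  braid_naturality f g := Corelation.finBraid_naturality f g
  braid_braid := Corelation.finBraid_finBraid
  hexagon n m p := by
    rw [corelData_eqHom, corelData_eqHom, corelData_eqHom]
    exact Corelation.finBraid_hexagon n m p

/-! ### Symmetric monoidal theories and the props they present -/

/-- A signature: a set of generators `n → m` for all `n` and `m`. -/
abbrev Signature := ℕ → ℕ → Type w

/-- The terms over a signature, built from generators by composition and monoidal product. All the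
identities `n → n` and braidings `n + m → m + n` are taken as primitive terms; the laws of props
express them through the empty term `id 0`, the term `id 1` and the term `braid 1 1`. -/
inductive Term (S : Signature.{w}) : ℕ → ℕ → Type w
  | id (n : ℕ) : Term S n n
  | braid (n m : ℕ) : Term S (n + m) (m + n)
  | gen {n m : ℕ} (σ : S n m) : Term S n m
  | comp {n m p : ℕ} (s : Term S n m) (t : Term S m p) : Term S n p
  | tensor {n m p q : ℕ} (s : Term S n m) (t : Term S p q) : Term S (n + p) (m + q)

/-- The operations on terms; they do not yet satisfy the laws of a prop. -/
def Term.data (S : Signature.{w}) : PROPData.{w} where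
  Hom := Term S
  id := Term.id
  comp := Term.comp
  tensor := Term.tensor
  braid := Term.braid

/-- A symmetric monoidal theory: a signature and a set of equations between terms of the same
type. -/
structure SMTheory : Type (w + 1) where
  /-- The signature. -/
  sig : Signature.{w}
  /-- The equations. -/
  eqn : ∀ {n m : ℕ}, Term sig n m → Term sig n m → Prop

namespace SMTheory

/-- Provable equality of terms: the least congruence for composition and monoidal product that
contains the laws of props and the equations of the theory. -/
inductive Provable (T : SMTheory.{w}) : ∀ {n m : ℕ}, Term T.sig n m → Term T.sig n m → Prop
  | eqn {n m : ℕ} {s t : Term T.sig n m} (h : T.eqn s t) : Provable T s t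
  | refl {n m : ℕ} (s : Term T.sig n m) : Provable T s s
  | symm {n m : ℕ} {s t : Term T.sig n m} (h : Provable T s t) : Provable T t s
  | trans {n m : ℕ} {s t r : Term T.sig n m} (h : Provable T s t) (h' : Provable T t r) :
      Provable T s r
  | comp_congr {n m p : ℕ} {s s' : Term T.sig n m} {t t' : Term T.sig m p}
      (h : Provable T s s') (h' : Provable T t t') : Provable T (s.comp t) (s'.comp t')
  | tensor_congr {n m p q : ℕ} {s s' : Term T.sig n m} {t t' : Term T.sig p q}
      (h : Provable T s s') (h' : Provable T t t') : Provable T (s.tensor t) (s'.tensor t')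
  | id_comp {n m : ℕ} (f : Term T.sig n m) : Provable T ((Term.id n).comp f) f
  | comp_id {n m : ℕ} (f : Term T.sig n m) : Provable T (f.comp (Term.id m)) f
  | assoc {n m p q : ℕ} (f : Term T.sig n m) (g : Term T.sig m p) (h : Term T.sig p q) :
      Provable T ((f.comp g).comp h) (f.comp (g.comp h))
  | tensor_id (n m : ℕ) : Provable T ((Term.id n).tensor (Term.id m)) (Term.id (n + m))
  | tensor_comp {n m p n' m' p' : ℕ} (f : Term T.sig n m) (g : Term T.sig m p)
      (f' : Term T.sig n' m') (g' : Term T.sig m' p') :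
      Provable T ((f.tensor f').comp (g.tensor g')) ((f.comp g).tensor (f'.comp g'))
  | tensor_assoc {n m n' m' n'' m'' : ℕ} (f : Term T.sig n m) (g : Term T.sig n' m')
      (h : Term T.sig n'' m'') :
      Provable T
        (Term.comp ((f.tensor g).tensor h) ((Term.data T.sig).eqHom (Nat.add_assoc m m' m'')))
        (Term.comp ((Term.data T.sig).eqHom (Nat.add_assoc n n' n'')) (f.tensor (g.tensor h)))
  | unit_tensor {n m : ℕ} (f : Term T.sig n m) :
      Provable T
        (Term.comp ((Term.id 0).tensor f) ((Term.data T.sig).eqHom (Nat.zero_add m)))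
        (Term.comp ((Term.data T.sig).eqHom (Nat.zero_add n)) f)
  | tensor_unit {n m : ℕ} (f : Term T.sig n m) :
      Provable T
        (Term.comp (f.tensor (Term.id 0)) ((Term.data T.sig).eqHom (Nat.add_zero m)))
        (Term.comp ((Term.data T.sig).eqHom (Nat.add_zero n)) f)
  | braid_naturality {n m n' m' : ℕ} (f : Term T.sig n m) (g : Term T.sig n' m') :
      Provable T ((f.tensor g).comp (Term.braid m m')) ((Term.braid n n').comp (g.tensor f))
  | braid_braid (n m : ℕ) :
      Provable T ((Term.braid n m).comp (Term.braid m n)) (Term.id (n + m))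
  | hexagon (n m p : ℕ) :
      Provable T
        (Term.comp ((Term.data T.sig).eqHom (Nat.add_assoc n m p))
          (Term.comp (Term.braid n (m + p)) ((Term.data T.sig).eqHom (Nat.add_assoc m p n))))
        (Term.comp ((Term.braid n m).tensor (Term.id p))
          (Term.comp ((Term.data T.sig).eqHom (Nat.add_assoc m n p))
            ((Term.id m).tensor (Term.braid n p))))

/-- Provable equality as an equivalence relation. -/
def setoid (T : SMTheory.{w}) (n m : ℕ) : Setoid (Term T.sig n m) where
  r := T.Provable
  iseqv := ⟨Provable.refl, Provable.symm, Provable.trans⟩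

/-- The operations on terms modulo provable equality. -/
def propData (T : SMTheory.{w}) : PROPData.{w} where
  Hom n m := Quotient (T.setoid n m)
  id n := Quotient.mk _ (Term.id n)
  comp := Quotient.map₂ Term.comp fun _ _ h _ _ h' => Provable.comp_congr h h'
  tensor := Quotient.map₂ Term.tensor fun _ _ h _ _ h' => Provable.tensor_congr h h'
  braid n m := Quotient.mk _ (Term.braid n m)

theorem propData_eqHom (T : SMTheory.{w}) {n m : ℕ} (h : n = m) :
    T.propData.eqHom h = Quotient.mk (T.setoid n m) ((Term.data T.sig).eqHom h) := by
  subst h; rfl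

/-- The prop presented by a symmetric monoidal theory: terms modulo provable equality. -/
def prop (T : SMTheory.{w}) : PROP.{w} where
  toPROPData := T.propData
  id_comp := by
    rintro n m ⟨f⟩
    exact Quotient.sound (Provable.id_comp f)
  comp_id := by
    rintro n m ⟨f⟩
    exact Quotient.sound (Provable.comp_id f)
  assoc := by
    rintro n m p q ⟨f⟩ ⟨g⟩ ⟨h⟩
    exact Quotient.sound (Provable.assoc f g h)
  tensor_id n m := Quotient.sound (Provable.tensor_id n m)
  tensor_comp := by
    rintro n m p n' m' p' ⟨f⟩ ⟨g⟩ ⟨f'⟩ ⟨g'⟩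
    exact Quotient.sound (Provable.tensor_comp f g f' g')
  tensor_assoc := by
    rintro n m n' m' n'' m'' ⟨f⟩ ⟨g⟩ ⟨h⟩
    rw [propData_eqHom, propData_eqHom]
    exact Quotient.sound (Provable.tensor_assoc f g h)
  unit_tensor := by
    rintro n m ⟨f⟩
    rw [propData_eqHom, propData_eqHom]
    exact Quotient.sound (Provable.unit_tensor f)
  tensor_unit := by
    rintro n m ⟨f⟩
    rw [propData_eqHom, propData_eqHom]
    exact Quotient.sound (Provable.tensor_unit f)
  braid_naturality := by
    rintro n m n' m' ⟨f⟩ ⟨g⟩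
    exact Quotient.sound (Provable.braid_naturality f g)
  braid_braid n m := Quotient.sound (Provable.braid_braid n m)
  hexagon n m p := by
    rw [propData_eqHom, propData_eqHom, propData_eqHom]
    exact Quotient.sound (Provable.hexagon n m p)

/-- The morphism of the presented prop given by a generator. -/
def gen (T : SMTheory.{w}) {n m : ℕ} (σ : T.sig n m) : T.prop.Hom n m :=
  Quotient.mk (T.setoid n m) (Term.gen σ)

end SMTheory

/-! ### Extraspecial commutative Frobenius monoids -/

/-- The generators of the theory of extraspecial commutative Frobenius monoids. -/
inductive ESCFMGen : ℕ → ℕ → Type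
  | mul : ESCFMGen 2 1
  | unit : ESCFMGen 0 1
  | comul : ESCFMGen 1 2
  | counit : ESCFMGen 1 0

namespace ESCFMGen

/-- Multiplication, as a term. -/
abbrev μ : Term ESCFMGen 2 1 := Term.gen mul

/-- Unit, as a term. -/
abbrev η : Term ESCFMGen 0 1 := Term.gen unit

/-- Comultiplication, as a term. -/
abbrev δ : Term ESCFMGen 1 2 := Term.gen comul

/-- Counit, as a term. -/
abbrev ε : Term ESCFMGen 1 0 := Term.gen counit

/-- The identity term on the generating object. -/
abbrev ι : Term ESCFMGen 1 1 := Term.id 1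

/-- The equations of the theory of extraspecial commutative Frobenius monoids. -/
inductive Eqn : ∀ {n m : ℕ}, Term ESCFMGen n m → Term ESCFMGen n m → Prop
  | mul_assoc : Eqn (n := 3) (m := 1) (Term.comp (Term.tensor μ ι) μ) (Term.comp (Term.tensor ι μ) μ)
  | unit_mul : Eqn (n := 1) (m := 1) (Term.comp (Term.tensor η ι) μ) ι
  | mul_comm : Eqn (n := 2) (m := 1) (Term.comp (Term.braid 1 1) μ) μ
  | comul_assoc :
      Eqn (n := 1) (m := 3) (Term.comp δ (Term.tensor δ ι)) (Term.comp δ (Term.tensor ι δ))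
  | counit_comul : Eqn (n := 1) (m := 1) (Term.comp δ (Term.tensor ε ι)) ι
  | comul_comm : Eqn (n := 1) (m := 2) (Term.comp δ (Term.braid 1 1)) δ
  | frobenius_left :
      Eqn (n := 2) (m := 2) (Term.comp (Term.tensor δ ι) (Term.tensor ι μ)) (Term.comp μ δ)
  | frobenius_right :
      Eqn (n := 2) (m := 2) (Term.comp (Term.tensor ι δ) (Term.tensor μ ι)) (Term.comp μ δ)
  | special : Eqn (n := 1) (m := 1) (Term.comp δ μ) ι
  | extra : Eqn (n := 0) (m := 0) (Term.comp η ε) (Term.id 0)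

end ESCFMGen

/-- The symmetric monoidal theory of extraspecial commutative Frobenius monoids. -/
def theoryESCFM : SMTheory.{0} where
  sig := ESCFMGen
  eqn := ESCFMGen.Eqn

/-- The prop presented by the theory of extraspecial commutative Frobenius monoids. -/
def ThESCFM : PROP.{0} := theoryESCFM.prop

section

variable (C : Type u) [Category.{v} C] [MonoidalCategory C] [SymmetricCategory C]

open scoped MonObj ComonObj in
/-- An extraspecial commutative Frobenius monoid in a symmetric monoidal category. -/
structure ESCFM where
  /-- The underlying object. -/
  X : C
  [mon : MonObj X]
  [comon : ComonObj X]
  [comm : IsCommMonObj X]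
  [cocomm : IsCommComonObj X]
  frobenius_left : Δ[X] ▷ X ≫ (α_ X X X).hom ≫ X ◁ μ[X] = μ[X] ≫ Δ[X]
  frobenius_right : X ◁ Δ[X] ≫ (α_ X X X).inv ≫ μ[X] ▷ X = μ[X] ≫ Δ[X]
  special : Δ[X] ≫ μ[X] = 𝟙 X
  extra : η[X] ≫ ε[X] = 𝟙 (𝟙_ C)

attribute [instance] ESCFM.mon ESCFM.comon ESCFM.comm ESCFM.cocomm

variable {C} in
/-- A morphism of extraspecial commutative Frobenius monoids: a morphism that commutes with the
multiplications, units, comultiplications and counits. -/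
@[ext]
structure ESCFM.Hom (A B : ESCFM C) where
  /-- The underlying morphism. -/
  hom : A.X ⟶ B.X
  isMonHom : IsMonHom hom
  isComonHom : IsComonHom hom

/-- The category of extraspecial commutative Frobenius monoids in `C`. -/
instance : Category (ESCFM C) where
  Hom A B := ESCFM.Hom A B
  id A := ⟨𝟙 A.X, inferInstance, inferInstance⟩
  comp f g :=
    { hom := f.hom ≫ g.hom
      isMonHom := by have := f.isMonHom; have := g.isMonHom; infer_instance
      isComonHom := by have := f.isComonHom; have := g.isComonHom; infer_instance }
  id_comp f := ESCFM.Hom.ext (Category.id_comp f.hom)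
  comp_id f := ESCFM.Hom.ext (Category.comp_id f.hom)
  assoc f g h := ESCFM.Hom.ext (Category.assoc f.hom g.hom h.hom)

/-- The underlying object of an extraspecial commutative Frobenius monoid. -/
def ESCFM.forget : ESCFM C ⥤ C where
  obj A := A.X
  map f := f.hom

end

/-! ### Symmetric monoidal functors -/

section

variable (D : Type*) [Category* D] [MonoidalCategory D] [SymmetricCategory D]
  (C : Type*) [Category* C] [MonoidalCategory C] [SymmetricCategory C]

/-- A (strong) symmetric monoidal functor. -/
structure SymMonFunctor where
  /-- The underlying functor. -/
  functor : D ⥤ C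
  [braided : functor.Braided]

attribute [instance] SymMonFunctor.braided

variable {D C} in
/-- A monoidal natural transformation between symmetric monoidal functors. -/
@[ext]
structure SymMonFunctor.Hom (F G : SymMonFunctor D C) where
  /-- The underlying natural transformation. -/
  hom : F.functor ⟶ G.functor
  isMonoidal : NatTrans.IsMonoidal hom

/-- The category of symmetric monoidal functors and monoidal natural transformations. -/
instance : Category (SymMonFunctor D C) where
  Hom F G := SymMonFunctor.Hom F G
  id F := ⟨𝟙 F.functor, inferInstance⟩
  comp f g :=
    { hom := f.hom ≫ g.hom
      isMonoidal := by have := f.isMonoidal; have := g.isMonoidal; infer_instance }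
  id_comp f := SymMonFunctor.Hom.ext (Category.id_comp f.hom)
  comp_id f := SymMonFunctor.Hom.ext (Category.comp_id f.hom)
  assoc f g h := SymMonFunctor.Hom.ext (Category.assoc f.hom g.hom h.hom)

variable {D} in
/-- Evaluation of symmetric monoidal functors at an object. -/
def SymMonFunctor.eval (X : D) : SymMonFunctor D C ⥤ C where
  obj F := F.functor.obj X
  map f := f.hom.app X

end

/-!
Over an extraspecial commutative Frobenius monoid `A`, the morphisms `𝟙_ C ⟶ Z` into a commutative
monoid `Z` form a commutative monoid, and `n` wires from `A` into `Z` (monoid morphisms) give, for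
each pair of wires, a point of `Z` linking them. A partition of the wires is sent to the product of
the links of its related pairs. By the special and Frobenius laws a product of links absorbs every
link between wires that it already connects, so this point depends only on the partition; bending
the input wires of such a point back turns a corelation into a morphism, and the extra law makes
this compatible with composition, where blocks lying entirely in the middle are discarded. Thus
every `A` in `C` is the value at the one-element set of a symmetric monoidal functor from finite
sets and corelations to `C`.

Conversely, monoidal functors out of a presented prop are determined by the images of the
generators. Applied to the generic monoid, the composite `Th(ESCFM) ⥤ Corel ⥤ Th(ESCFM)` is
therefore isomorphic to the identity, so terms with the same corelation are provably equal. Every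
corelation is the value of a term: adjoin the outputs to the inputs, merge related points, and
discard the inputs.
-/

section

open scoped MonObj ComonObj

variable {C : Type u} [Category.{v} C] [MonoidalCategory C]

/-! ### Multiplication by points of a monoid -/

section Monoidal

variable {M N P Q : C}

/-- Multiplication by the point `t` of a monoid. -/
def mulPoint [MonObj M] (t : 𝟙_ C ⟶ M) : M ⟶ M := (λ_ M).inv ≫ t ▷ M ≫ μ[M]

theorem mulPoint_unit [MonObj M] : mulPoint η[M] = 𝟙 M := by
  simp [mulPoint]

theorem mulPoint_comp_mulPoint [MonObj M] (t u : 𝟙_ C ⟶ M) :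
    mulPoint t ≫ mulPoint u = mulPoint (t ≫ mulPoint u) := by
  have h : μ[M] ≫ (λ_ M).inv ≫ u ▷ M = (λ_ _).inv ≫ u ▷ (M ⊗ M) ≫ M ◁ μ[M] := by
    rw [leftUnitor_inv_naturality_assoc, whisker_exchange]
  rw [mulPoint, mulPoint, mulPoint]
  simp [reassoc_of% h]

theorem mulPoint_comp [MonObj M] [MonObj N] (t : 𝟙_ C ⟶ M) (f : M ⟶ N) [IsMonHom f] :
    mulPoint t ≫ f = f ≫ mulPoint (t ≫ f) := by
  simp [mulPoint, MonoidalCategory.tensorHom_def', ← whisker_exchange_assoc]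

variable (M N) in
/-- The inclusion of an object into its tensor product with a monoid on the right. -/
def tensorInl [MonObj N] : M ⟶ M ⊗ N := (ρ_ M).inv ≫ M ◁ η[N]

variable (M N) in
/-- The inclusion of an object into its tensor product with a monoid on the left. -/
def tensorInr [MonObj M] : N ⟶ M ⊗ N := (λ_ N).inv ≫ η[M] ▷ N

theorem tensorInl_tensorHom [MonObj N] [MonObj Q] (f : M ⟶ P) (g : N ⟶ Q) [IsMonHom g] :
    tensorInl M N ≫ (f ⊗ₘ g) = f ≫ tensorInl P Q := by
  simp only [tensorInl, Category.assoc, MonoidalCategory.tensorHom_def',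
    ← MonoidalCategory.whiskerLeft_comp_assoc, IsMonHom.one_hom]
  rw [whisker_exchange, rightUnitor_inv_naturality_assoc]

theorem tensorInr_tensorHom [MonObj M] [MonObj P] (f : M ⟶ P) (g : N ⟶ Q) [IsMonHom f] :
    tensorInr M N ≫ (f ⊗ₘ g) = g ≫ tensorInr P Q := by
  simp only [tensorInr, Category.assoc, MonoidalCategory.tensorHom_def, ← comp_whiskerRight_assoc,
    IsMonHom.one_hom]
  rw [← whisker_exchange, leftUnitor_inv_naturality_assoc]

theorem tensorInr_leftUnitor : tensorInr (𝟙_ C) M ≫ (λ_ M).hom = 𝟙 M := by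
  simp [tensorInr]

theorem tensorInl_rightUnitor : tensorInl M (𝟙_ C) ≫ (ρ_ M).hom = 𝟙 M := by
  simp [tensorInl]

theorem tensorInr_tensorInl_associator [MonObj M] [MonObj P] :
    tensorInr M N ≫ tensorInl (M ⊗ N) P ≫ (α_ M N P).hom =
      tensorInl N P ≫ tensorInr M (N ⊗ P) := by
  simp only [tensorInl, tensorInr, Category.assoc]
  rw [leftUnitor_inv_naturality_assoc (N ◁ η[P]), whisker_exchange]
  monoidal

/-- The morphism `M ⟶ N` obtained from a point of `M ⊗ N` by multiplying with its first component
and discarding the product along `e`. -/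
def unbend [MonObj M] (e : M ⟶ 𝟙_ C) (s : 𝟙_ C ⟶ M ⊗ N) : M ⟶ N :=
  (ρ_ M).inv ≫ M ◁ s ≫ (α_ M M N).inv ≫ (μ[M] ≫ e) ▷ N ≫ (λ_ N).hom

theorem unbend_comp [MonObj M] (e : M ⟶ 𝟙_ C) (s : 𝟙_ C ⟶ M ⊗ N) (f : N ⟶ P) :
    unbend e s ≫ f = unbend e (s ≫ M ◁ f) := by
  simp only [unbend, Category.assoc, MonoidalCategory.whiskerLeft_comp,
    associator_inv_naturality_right_assoc, whisker_exchange_assoc, leftUnitor_naturality]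

/-- Discarding the second factor of a tensor product along `e`. -/
def discardRight (M : C) (e : N ⟶ 𝟙_ C) : M ⊗ N ⟶ M := M ◁ e ≫ (ρ_ M).hom

/-- Discarding the first factor of a tensor product along `e`. -/
def discardLeft (e : M ⟶ 𝟙_ C) (N : C) : M ⊗ N ⟶ N := e ▷ N ≫ (λ_ N).hom

theorem tensorInl_discardRight [MonObj N] {e : N ⟶ 𝟙_ C} (he : η[N] ≫ e = 𝟙 (𝟙_ C)) :
    tensorInl M N ≫ discardRight M e = 𝟙 M := by
  simp [tensorInl, discardRight, ← MonoidalCategory.whiskerLeft_comp_assoc, he]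

end Monoidal

section Braided

variable [BraidedCategory C] {M N P Q : C}

instance (M : C) [MonObj M] : IsMonHom η[M] where
  one_hom := by simp
  mul_hom := by simp [MonoidalCategory.tensorHom_def, unitors_equal]

instance (M : C) [MonObj M] [IsCommMonObj M] : IsMonHom μ[M] where
  one_hom := by
    rw [MonObj.tensorObj.one_def, Category.assoc, MonoidalCategory.tensorHom_def, Category.assoc,
      MonObj.mul_one, rightUnitor_naturality, ← unitors_equal, Iso.inv_hom_id_assoc]
  mul_hom := by simp [MonObj.tensorObj.mul_def]

instance [MonObj M] [MonObj N] : IsMonHom (tensorInl M N) := by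
  unfold tensorInl
  infer_instance

instance [MonObj M] [MonObj N] : IsMonHom (tensorInr M N) := by
  unfold tensorInr
  infer_instance

theorem tensorInl_mul [MonObj M] [MonObj N] :
    tensorInl M N ▷ (M ⊗ N) ≫ μ[M ⊗ N] = (α_ M M N).inv ≫ μ[M] ▷ N := by
  have : tensorInl M N = (ρ_ M).inv ≫ (𝟙 M ⊗ₘ η[N]) := by simp [tensorInl]
  rw [this, comp_whiskerRight, MonObj.tensorObj.mul_def, Category.assoc, tensorμ_natural_left_assoc,
    tensorHom_comp_tensorHom]
  simp only [tensorμ, braiding_tensorUnit_left, MonoidalCategory.tensorHom_def, comp_whiskerRight,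
    MonoidalCategory.whiskerLeft_comp, Category.assoc, MonObj.one_mul, id_whiskerRight,
    Category.id_comp, whiskerRight_tensor]
  monoidal

theorem mul_tensorInr [MonObj M] [MonObj N] :
    (M ⊗ N) ◁ tensorInr M N ≫ μ[M ⊗ N] = (α_ M N N).hom ≫ M ◁ μ[N] := by
  have : tensorInr M N = (λ_ N).inv ≫ (η[M] ⊗ₘ 𝟙 N) := by simp [tensorInr]
  rw [this, MonoidalCategory.whiskerLeft_comp, MonObj.tensorObj.mul_def, Category.assoc,
    tensorμ_natural_right_assoc, tensorHom_comp_tensorHom]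
  simp only [tensorμ, braiding_tensorUnit_right, MonoidalCategory.tensorHom_def, comp_whiskerRight,
    MonoidalCategory.whiskerLeft_comp, Category.assoc, MonObj.mul_one,
    MonoidalCategory.whiskerLeft_id, Category.id_comp, tensor_whiskerLeft, whiskerRight_tensor]
  monoidal

theorem tensorInl_tensorInr_mul [MonObj M] [MonObj N] :
    (tensorInl M N ⊗ₘ tensorInr M N) ≫ μ[M ⊗ N] = 𝟙 (M ⊗ N) := by
  rw [MonoidalCategory.tensorHom_def', Category.assoc, tensorInl_mul, tensorInr,
    MonoidalCategory.whiskerLeft_comp, Category.assoc, associator_inv_naturality_middle_assoc,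
    ← comp_whiskerRight, MonObj.mul_one]
  simp

theorem mulPoint_tensorInl [MonObj M] [MonObj N] (t : 𝟙_ C ⟶ M) :
    mulPoint (t ≫ tensorInl M N) = mulPoint t ▷ N := by
  rw [mulPoint, comp_whiskerRight, Category.assoc, tensorInl_mul, mulPoint]
  simp

theorem tensorInl_braiding [MonObj N] : tensorInl M N ≫ (β_ M N).hom = tensorInr N M := by
  simp [tensorInl, tensorInr]

theorem tensorInr_braiding [MonObj M] : tensorInr M N ≫ (β_ M N).hom = tensorInl N M := by
  simp [tensorInl, tensorInr]

theorem tensorInl_tensorInl_associator [MonObj N] [MonObj P] :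
    tensorInl M N ≫ tensorInl (M ⊗ N) P ≫ (α_ M N P).hom = tensorInl M (N ⊗ P) := by
  rw [tensorInl, tensorInl, tensorInl, MonObj.tensorObj.one_def, MonoidalCategory.tensorHom_def]
  monoidal

theorem tensorInr_associator [MonObj M] [MonObj N] :
    tensorInr (M ⊗ N) P ≫ (α_ M N P).hom = tensorInr N P ≫ tensorInr M (N ⊗ P) := by
  rw [tensorInr, tensorInr, tensorInr, MonObj.tensorObj.one_def, MonoidalCategory.tensorHom_def',
    leftUnitor_inv_naturality_assoc]
  monoidal

theorem tensorInl_tensorμ [MonObj P] [MonObj Q] :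
    tensorInl (M ⊗ N) (P ⊗ Q) ≫ tensorμ M N P Q = (tensorInl M P ⊗ₘ tensorInl N Q) := by
  have h : (ρ_ (M ⊗ N)).inv ≫ (M ⊗ N) ◁ (λ_ (𝟙_ C)).inv ≫ tensorμ M N (𝟙_ C) (𝟙_ C) =
      ((ρ_ M).inv ⊗ₘ (ρ_ N).inv) := by
    rw [Iso.inv_comp_eq, tensor_right_unitality]
    simp [tensorHom_comp_tensorHom]
  rw [tensorInl, MonObj.tensorObj.one_def, MonoidalCategory.whiskerLeft_comp, Category.assoc,
    Category.assoc, tensorμ_natural_right, reassoc_of% h, tensorHom_comp_tensorHom, tensorInl,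
    tensorInl]

theorem tensorμ_discardLeft (e : M ⟶ 𝟙_ C) (e' : N ⟶ 𝟙_ C) :
    tensorμ M N P Q ≫ (discardLeft e P ⊗ₘ discardLeft e' Q) =
      discardLeft ((e ⊗ₘ e') ≫ (λ_ (𝟙_ C)).hom) (P ⊗ Q) := by
  rw [discardLeft, discardLeft, discardLeft, ← tensorHom_comp_tensorHom,
    ← tensorμ_natural_left_assoc, tensor_left_unitality, comp_whiskerRight, Category.assoc,
    hom_inv_whiskerRight_assoc]

end Braided

/-! ### Convolution -/

variable [SymmetricCategory C]

/-- The convolution product on morphisms from a cocommutative comonoid to a commutative monoid. -/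
@[reducible] def convCommMonoid (M N : C) [ComonObj M] [IsCommComonObj M] [MonObj N]
    [IsCommMonObj N] : CommMonoid (M ⟶ N) :=
  { (inferInstance : Monoid (Conv M N)) with
    mul_comm := fun f g => by
      change Δ[M] ≫ f ▷ M ≫ N ◁ g ≫ μ[N] = Δ[M] ≫ g ▷ M ≫ N ◁ f ≫ μ[N]
      rw [← MonoidalCategory.tensorHom_def_assoc, ← MonoidalCategory.tensorHom_def_assoc,
        ← IsCommMonObj.mul_comm N, BraidedCategory.braiding_naturality_assoc,
        IsCommComonObj.comul_comm_assoc, IsCommMonObj.mul_comm] }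

attribute [local instance] convCommMonoid ComonObj.instTensorUnit

instance (M : C) [ComonObj M] : IsComonHom ε[M] where
  hom_counit := by simp
  hom_comul := by simp [MonoidalCategory.tensorHom_def, unitors_inv_equal]

section

variable {D D' N N' : C} [ComonObj D] [IsCommComonObj D] [MonObj N] [IsCommMonObj N]
  [MonObj N'] [IsCommMonObj N']

theorem conv_one_eq : (1 : D ⟶ N) = ε[D] ≫ η[N] := rfl

theorem conv_mul_eq (f g : D ⟶ N) : f * g = Δ[D] ≫ (f ⊗ₘ g) ≫ μ[N] := by
  rw [MonoidalCategory.tensorHom_def_assoc]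
  rfl

theorem conv_one_comp (h : N ⟶ N') [IsMonHom h] : (1 : D ⟶ N) ≫ h = 1 := by
  simp [conv_one_eq]

theorem conv_mul_comp (f g : D ⟶ N) (h : N ⟶ N') [IsMonHom h] :
    (f * g) ≫ h = (f ≫ h) * (g ≫ h) := by
  rw [conv_mul_eq, conv_mul_eq, ← tensorHom_comp_tensorHom]
  simp only [Category.assoc, IsMonHom.mul_hom]

theorem comp_conv_mul [ComonObj D'] [IsCommComonObj D'] (h : D' ⟶ D) [IsComonHom h]
    (f g : D ⟶ N) : h ≫ (f * g) = (h ≫ f) * (h ≫ g) := by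
  rw [conv_mul_eq, conv_mul_eq, ← tensorHom_comp_tensorHom]
  simp only [Category.assoc, IsComonHom.hom_comul_assoc]

theorem tensorInl_conv_mul_tensorInr (f : D ⟶ N) (g : D ⟶ N') :
    (f ≫ tensorInl N N') * (g ≫ tensorInr N N') = Δ[D] ≫ (f ⊗ₘ g) := by
  rw [conv_mul_eq, ← tensorHom_comp_tensorHom, Category.assoc, tensorInl_tensorInr_mul,
    Category.comp_id]

end

section

variable {M N : C} [MonObj M] [IsCommMonObj M] [MonObj N] [IsCommMonObj N]

theorem point_one_eq : (1 : 𝟙_ C ⟶ M) = η[M] := by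
  simp [conv_one_eq]

theorem mulPoint_eq_mul_right (t : 𝟙_ C ⟶ M) : mulPoint t = (ρ_ M).inv ≫ M ◁ t ≫ μ[M] := by
  rw [mulPoint, ← IsCommMonObj.mul_comm M, BraidedCategory.braiding_naturality_left_assoc]
  simp

theorem point_mul_eq_comp_mulPoint (t u : 𝟙_ C ⟶ M) : t * u = t ≫ mulPoint u := by
  rw [conv_mul_eq, mulPoint_eq_mul_right, MonoidalCategory.tensorHom_def_assoc]
  simp [unitors_inv_equal]

theorem mulPoint_mul (t u : 𝟙_ C ⟶ M) : mulPoint (t * u) = mulPoint t ≫ mulPoint u := by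
  rw [point_mul_eq_comp_mulPoint, mulPoint_comp_mulPoint]

theorem mulPoint_tensorInr (t : 𝟙_ C ⟶ N) : mulPoint (t ≫ tensorInr M N) = M ◁ mulPoint t := by
  rw [mulPoint_eq_mul_right, MonoidalCategory.whiskerLeft_comp, Category.assoc, mul_tensorInr,
    mulPoint_eq_mul_right]
  simp

theorem mulPoint_tensor (t : 𝟙_ C ⟶ M) (s : 𝟙_ C ⟶ N) :
    mulPoint ((t ≫ tensorInl M N) * (s ≫ tensorInr M N)) = mulPoint t ⊗ₘ mulPoint s := by
  rw [mulPoint_mul, mulPoint_tensorInl, mulPoint_tensorInr, MonoidalCategory.tensorHom_def]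

theorem unbend_eq_mulPoint (e : M ⟶ 𝟙_ C) (s : 𝟙_ C ⟶ M ⊗ N) :
    unbend e s = tensorInl M N ≫ mulPoint s ≫ discardLeft e N := by
  have h : tensorInl M N ≫ mulPoint s =
      (ρ_ M).inv ≫ M ◁ s ≫ (α_ M M N).inv ≫ μ[M] ▷ N := by
    rw [mulPoint_eq_mul_right, ← tensorInl_mul, whisker_exchange_assoc,
      ← rightUnitor_inv_naturality_assoc]
  rw [reassoc_of% h, unbend, discardLeft, comp_whiskerRight, Category.assoc]

theorem unbend_one (e : M ⟶ 𝟙_ C) : unbend e (1 : 𝟙_ C ⟶ M ⊗ N) = e ≫ η[N] := by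
  rw [unbend_eq_mulPoint, point_one_eq, mulPoint_unit, Category.id_comp, discardLeft, tensorInl,
    Category.assoc, whisker_exchange_assoc, leftUnitor_naturality, unitors_equal,
    rightUnitor_naturality_assoc, Iso.inv_hom_id_assoc]

theorem unbend_mul_tensorInr (e : M ⟶ 𝟙_ C) (s : 𝟙_ C ⟶ M ⊗ N) (t : 𝟙_ C ⟶ N) :
    unbend e (s * (t ≫ tensorInr M N)) = unbend e s ≫ mulPoint t := by
  rw [unbend_eq_mulPoint, unbend_eq_mulPoint, mulPoint_mul, mulPoint_tensorInr]
  simp only [discardLeft, Category.assoc, whisker_exchange_assoc, leftUnitor_naturality]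

theorem tensorInl_mul_comp_discardRight (t : 𝟙_ C ⟶ M) (s : 𝟙_ C ⟶ M ⊗ N) (e : N ⟶ 𝟙_ C) :
    ((t ≫ tensorInl M N) * s) ≫ discardRight M e = t * (s ≫ discardRight M e) := by
  rw [mul_comm, point_mul_eq_comp_mulPoint, mul_comm, point_mul_eq_comp_mulPoint,
    mulPoint_tensorInl, Category.assoc, Category.assoc, discardRight, Category.assoc,
    ← whisker_exchange_assoc, rightUnitor_naturality]

theorem unit_comp_conv_mul {D : C} [MonObj D] [ComonObj D] [IsCommComonObj D] (t : 𝟙_ C ⟶ M)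
    (h : D ⟶ M) : η[D] ≫ ((ε[D] ≫ t) * h) = t * (η[D] ≫ h) := by
  have e : (ε[D] ≫ t) ⊗ₘ h = ε[D] ▷ D ≫ 𝟙_ C ◁ h ≫ t ▷ M := by
    rw [MonoidalCategory.tensorHom_def, comp_whiskerRight, Category.assoc, whisker_exchange]
  rw [conv_mul_eq, e, mul_comm, point_mul_eq_comp_mulPoint, mulPoint]
  simp

end

/-! ### Families of wires -/

theorem ESCFM.tensorInl_mul_unit_comul (A : ESCFM C) :
    tensorInl A.X A.X * (ε[A.X] ≫ η[A.X] ≫ Δ[A.X]) = Δ[A.X] := by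
  have e : tensorInl A.X A.X ⊗ₘ (ε[A.X] ≫ η[A.X] ≫ Δ[A.X]) =
      A.X ◁ ε[A.X] ≫ A.X ◁ (η[A.X] ≫ Δ[A.X]) ≫ tensorInl A.X A.X ▷ (A.X ⊗ A.X) := by
    rw [MonoidalCategory.tensorHom_def', MonoidalCategory.whiskerLeft_comp, Category.assoc]
  rw [conv_mul_eq, e]
  simp only [Category.assoc, tensorInl_mul, MonoidalCategory.whiskerLeft_comp, A.frobenius_right]
  simp

theorem ESCFM.unbend_unit_comul (A : ESCFM C) : unbend ε[A.X] (η[A.X] ≫ Δ[A.X]) = 𝟙 A.X := by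
  rw [unbend, MonoidalCategory.whiskerLeft_comp, Category.assoc, comp_whiskerRight,
    Category.assoc, reassoc_of% A.frobenius_right]
  simp

/-- A commutative monoid `obj` with a family of monoid homomorphisms to it, the wires, from an
extraspecial commutative Frobenius monoid `A`, and a morphism to the unit which is split by the unit
of the monoid. The motivating example is a tensor power of `A` with the inclusions of its
factors. -/
structure Wires (A : ESCFM C) (J : Type w) where
  /-- The underlying object. -/
  obj : C
  [mon : MonObj obj]
  [comm : IsCommMonObj obj]
  /-- The family of homomorphisms. -/
  wire : J → (A.X ⟶ obj)
  [isMonHom : ∀ j, IsMonHom (wire j)]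
  /-- The morphism to the unit. -/
  counit : obj ⟶ 𝟙_ C
  unit_counit : η[obj] ≫ counit = 𝟙 (𝟙_ C)

attribute [instance] Wires.mon Wires.comm Wires.isMonHom

namespace Wires

variable {A : ESCFM C} {J K L J' K' : Type w}

/-! ### The state of a partition -/

section State

variable (W : Wires A J)

theorem wire_mul_self (i : J) : W.wire i * W.wire i = W.wire i := by
  rw [← Category.id_comp (W.wire i), ← conv_mul_comp, conv_mul_eq]
  simp [A.special]

/-- The state that links two wires. -/
def link (i j : J) : 𝟙_ C ⟶ W.obj := η[A.X] ≫ (W.wire i * W.wire j)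

theorem link_comm (i j : J) : W.link i j = W.link j i := by
  rw [link, link, mul_comm]

theorem wire_mul_link (i j : J) :
    W.wire i * (ε[A.X] ≫ W.link i j) = W.wire i * W.wire j := by
  let m : A.X ⊗ A.X ⟶ W.obj := (W.wire i ⊗ₘ W.wire j) ≫ μ[W.obj]
  have hi : tensorInl A.X A.X ≫ m = W.wire i := by
    rw [← Category.assoc, tensorInl_tensorHom, tensorInl]
    simp
  have hm : W.wire i * W.wire j = Δ[A.X] ≫ m := conv_mul_eq _ _
  rw [link, hm]
  calc W.wire i * (ε[A.X] ≫ η[A.X] ≫ Δ[A.X] ≫ m)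
      = (tensorInl A.X A.X * (ε[A.X] ≫ η[A.X] ≫ Δ[A.X])) ≫ m := by rw [conv_mul_comp, hi]; simp
    _ = Δ[A.X] ≫ m := by rw [A.tensorInl_mul_unit_comul]

theorem link_mul_link (i j k : J) :
    W.link i j * W.link i k = η[A.X] ≫ (W.wire i * (W.wire j * W.wire k)) := by
  conv_lhs => rw [link.eq_1 W i k]
  rw [← unit_comp_conv_mul, ← mul_assoc, mul_comm _ (W.wire i), wire_mul_link, mul_assoc]

/-- Two wires are related by a state if multiplications by these wires agree on that state. -/
def rel (t : 𝟙_ C ⟶ W.obj) : Setoid J := Setoid.ker fun j => W.wire j * (ε[A.X] ≫ t)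

theorem rel_iff {t : 𝟙_ C ⟶ W.obj} {i j : J} :
    W.rel t i j ↔ W.wire i * (ε[A.X] ≫ t) = W.wire j * (ε[A.X] ≫ t) := Iff.rfl

theorem rel_le_rel_mul_right (t s : 𝟙_ C ⟶ W.obj) : W.rel t ≤ W.rel (t * s) := by
  intro i j h
  rw [rel_iff] at h ⊢
  rw [comp_conv_mul, ← mul_assoc, ← mul_assoc, h]

theorem rel_le_rel_mul_left (t s : 𝟙_ C ⟶ W.obj) : W.rel t ≤ W.rel (s * t) := by
  rw [mul_comm]
  exact W.rel_le_rel_mul_right t s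

theorem rel_link (i j : J) : W.rel (W.link i j) i j := by
  rw [rel_iff, wire_mul_link, link_comm, wire_mul_link, mul_comm]

theorem mul_link_of_rel {t : 𝟙_ C ⟶ W.obj} {i j : J} (h : W.rel t i j) :
    t * W.link i j = t := by
  rw [rel_iff] at h
  rw [link, ← unit_comp_conv_mul, ← mul_assoc, mul_comm (_ ≫ t), h, mul_assoc,
    mul_comm _ (W.wire j), ← mul_assoc, wire_mul_self, mul_comm, unit_comp_conv_mul,
    IsMonHom.one_hom, ← point_one_eq, mul_one]

/-- The submonoid of states generated by the links between wires in the same class. -/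
def links (r : Setoid J) : Submonoid (𝟙_ C ⟶ W.obj) :=
  Submonoid.closure {t | ∃ i j, r i j ∧ W.link i j = t}

variable {W} in
theorem link_mem_links {r : Setoid J} {i j : J} (h : r i j) : W.link i j ∈ W.links r :=
  Submonoid.subset_closure ⟨i, j, h, rfl⟩

theorem mul_eq_left_of_mem_links {r : Setoid J} {t s : 𝟙_ C ⟶ W.obj} (ht : r ≤ W.rel t)
    (hs : s ∈ W.links r) : t * s = t := by
  induction hs using Submonoid.closure_induction with
  | mem s h =>
    obtain ⟨i, j, h, rfl⟩ := h
    exact W.mul_link_of_rel (ht h)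
  | one => exact mul_one t
  | mul s s' _ _ h h' => rw [← mul_assoc, h, h']

theorem eq_of_mem_links {r : Setoid J} {t s : 𝟙_ C ⟶ W.obj} (ht : t ∈ W.links r)
    (ht' : r ≤ W.rel t) (hs : s ∈ W.links r) (hs' : r ≤ W.rel s) : t = s := by
  rw [← W.mul_eq_left_of_mem_links ht' hs, mul_comm, W.mul_eq_left_of_mem_links hs' ht]

variable [Finite J]

/-- The state that links all wires in the same class. -/
noncomputable def state (r : Setoid J) : 𝟙_ C ⟶ W.obj :=
  letI := Fintype.ofFinite {p : J × J // r p.1 p.2}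
  ∏ p : {p : J × J // r p.1 p.2}, W.link p.1.1 p.1.2

theorem state_mem_links (r : Setoid J) : W.state r ∈ W.links r :=
  Submonoid.prod_mem _ fun p _ => link_mem_links p.2

theorem le_rel_state (r : Setoid J) : r ≤ W.rel (W.state r) := by
  intro i j h
  let _ := Fintype.ofFinite {p : J × J // r p.1 p.2}
  obtain ⟨s, hs⟩ := Finset.dvd_prod_of_mem
    (fun p : {p : J × J // r p.1 p.2} => W.link p.1.1 p.1.2) (Finset.mem_univ ⟨(i, j), h⟩)
  rw [state, hs]
  exact W.rel_le_rel_mul_right (W.link i j) s (W.rel_link i j)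

theorem eq_state {r : Setoid J} {t : 𝟙_ C ⟶ W.obj} (ht : t ∈ W.links r) (ht' : r ≤ W.rel t) :
    t = W.state r :=
  W.eq_of_mem_links ht ht' (W.state_mem_links r) (W.le_rel_state r)

theorem state_eq_one {r : Setoid J} (h : ∀ i j, r i j → i = j) : W.state r = 1 :=
  (W.eq_state (one_mem _) fun i j hij => by rw [h i j hij]).symm

theorem state_top {i j k : J} (h : ∀ l, l = i ∨ l = j ∨ l = k) :
    W.state ⊤ = W.link i j * W.link i k := by
  refine (W.eq_state (mul_mem (link_mem_links trivial) (link_mem_links trivial)) ?_).symm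
  have rel_left (l : J) : W.rel (W.link i j * W.link i k) i l := by
    obtain rfl | rfl | rfl := h l
    · exact Setoid.refl' _ _
    · exact W.rel_le_rel_mul_right _ _ (W.rel_link _ _)
    · exact W.rel_le_rel_mul_left _ _ (W.rel_link _ _)
  exact fun l m _ => Setoid.trans' _ (Setoid.symm' _ (rel_left l)) (rel_left m)

end State

/-! ### Reindexing of wires -/

/-- A homomorphism of monoids that is compatible with a reindexing of wires. -/
structure IsMap (W : Wires A J) (V : Wires A K) (φ : J → K) (f : W.obj ⟶ V.obj) : Prop where
  isMonHom : IsMonHom f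
  wire_comp : ∀ j, W.wire j ≫ f = V.wire (φ j)

namespace IsMap

variable {W : Wires A J} {V : Wires A K} {U : Wires A L} {φ : J → K} {f : W.obj ⟶ V.obj}
  {ψ : K → L} {g : V.obj ⟶ U.obj} {χ : L → K} {k : U.obj ⟶ V.obj}

theorem id : IsMap W W _root_.id (𝟙 W.obj) where
  isMonHom := inferInstance
  wire_comp _ := Category.comp_id _

theorem comp (hf : IsMap W V φ f) (hg : IsMap V U ψ g) : IsMap W U (ψ ∘ φ) (f ≫ g) where
  isMonHom := by
    have := hf.isMonHom
    have := hg.isMonHom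
    infer_instance
  wire_comp j := by rw [← Category.assoc, hf.wire_comp, hg.wire_comp, Function.comp_apply]

theorem of_eq {φ' : J → K} (hf : IsMap W V φ f) (h : φ = φ') : IsMap W V φ' f := h ▸ hf

theorem inv {e : J ≃ K} {i : W.obj ≅ V.obj} (h : IsMap W V e i.hom) :
    IsMap V W e.symm i.inv where
  isMonHom := by
    have := h.isMonHom
    infer_instance
  wire_comp k := by rw [Iso.comp_inv_eq, h.wire_comp, e.apply_symm_apply]

theorem link_comp (hf : IsMap W V φ f) (i j : J) : W.link i j ≫ f = V.link (φ i) (φ j) := by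
  have := hf.isMonHom
  rw [link, Category.assoc, conv_mul_comp, hf.wire_comp, hf.wire_comp, link]

theorem rel_le_comap (hf : IsMap W V φ f) (t : 𝟙_ C ⟶ W.obj) :
    W.rel t ≤ (V.rel (t ≫ f)).comap φ := by
  have := hf.isMonHom
  intro i j h
  rw [rel_iff] at h
  rw [Setoid.comap_rel, rel_iff, ← hf.wire_comp, ← hf.wire_comp, ← Category.assoc,
    ← conv_mul_comp, h, conv_mul_comp]

theorem comp_mem_links (hf : IsMap W V φ f) {r : Setoid J} {r' : Setoid K} (h : r ≤ r'.comap φ)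
    {t : 𝟙_ C ⟶ W.obj} (ht : t ∈ W.links r) : t ≫ f ∈ V.links r' := by
  have := hf.isMonHom
  induction ht using Submonoid.closure_induction with
  | mem s h' =>
    obtain ⟨i, j, h', rfl⟩ := h'
    rw [hf.link_comp]
    exact link_mem_links (h h')
  | one => rw [conv_one_comp]; exact one_mem _
  | mul s s' _ _ h h' => rw [conv_mul_comp]; exact mul_mem h h'

theorem le_comap_rel_state_comp [Finite J] (hf : IsMap W V φ f) (r : Setoid J) :
    r ≤ (V.rel (W.state r ≫ f)).comap φ :=
  (W.le_rel_state r).trans (hf.rel_le_comap _)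

variable [Finite J] [Finite K] [Finite L]

theorem state_comp (hf : IsMap W V φ f) {r : Setoid J} {r' : Setoid K}
    (h : IsLeast {s | r ≤ s.comap φ} r') : W.state r ≫ f = V.state r' :=
  V.eq_state (hf.comp_mem_links h.1 (W.state_mem_links r)) (h.2 (hf.le_comap_rel_state_comp r))

theorem state_comap_comp (hf : IsMap W V φ f) (hφ : Function.Surjective φ) (r : Setoid K) :
    W.state (r.comap φ) ≫ f = V.state r :=
  hf.state_comp ⟨fun _ _ h => h, fun _ hs => hφ.forall₂.2 fun i j => @hs i j⟩

theorem state_comp_equiv {e : J ≃ K} (hf : IsMap W V e f) (r : Setoid J) :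
    W.state r ≫ f = V.state (r.comap e.symm) := by
  rw [← hf.state_comap_comp e.surjective]
  congr 2
  ext i j
  simp only [Setoid.comap_rel, e.symm_apply_apply]

theorem state_comp_mul (hf : IsMap W V φ f) (hk : IsMap U V χ k) {r : Setoid J} {q : Setoid L}
    {r' : Setoid K} (h : IsLeast {s | r ≤ s.comap φ ∧ q ≤ s.comap χ} r') :
    (W.state r ≫ f) * (U.state q ≫ k) = V.state r' :=
  V.eq_state (mul_mem (hf.comp_mem_links h.1.1 (W.state_mem_links r))
      (hk.comp_mem_links h.1.2 (U.state_mem_links q)))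
    (h.2 ⟨fun _ _ hij => V.rel_le_rel_mul_right _ _ (hf.le_comap_rel_state_comp r hij),
      fun _ _ hij => V.rel_le_rel_mul_left _ _ (hk.le_comap_rel_state_comp q hij)⟩)

end IsMap

/-! ### Tensor products of families of wires -/

variable (A) in
/-- The unit object with its empty family of wires. -/
@[simps, reducible] def empty (J : Type w) [IsEmpty J] : Wires A J where
  obj := 𝟙_ C
  wire := isEmptyElim
  isMonHom := isEmptyElim
  counit := 𝟙 _
  unit_counit := Category.comp_id _

variable (A) in
/-- The object `A.X` with a single wire. -/
@[simps, reducible] def single (J : Type w) [Unique J] : Wires A J where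
  obj := A.X
  wire _ := 𝟙 A.X
  counit := ε[A.X]
  unit_counit := A.extra

/-- The disjoint union of two families of wires, ending in a tensor product. -/
@[simps, reducible] def tensor (W : Wires A J) (V : Wires A K) : Wires A (J ⊕ K) where
  obj := W.obj ⊗ V.obj
  wire := Sum.elim (fun j => W.wire j ≫ tensorInl W.obj V.obj)
    fun k => V.wire k ≫ tensorInr W.obj V.obj
  isMonHom := by rintro (j | k) <;> dsimp only [Sum.elim_inl, Sum.elim_inr] <;> infer_instance
  counit := (W.counit ⊗ₘ V.counit) ≫ (λ_ _).hom
  unit_counit := by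
    rw [MonObj.tensorObj.one_def, Category.assoc, tensorHom_comp_tensorHom_assoc, W.unit_counit,
      V.unit_counit]
    simp

/-- The same family of wires, indexed by an equivalent type. -/
@[simps, reducible] def relabel (W : Wires A J) (e : J ≃ K) : Wires A K where
  obj := W.obj
  wire k := W.wire (e.symm k)
  counit := W.counit
  unit_counit := W.unit_counit

namespace IsMap

variable {W : Wires A J} {V : Wires A K} {U : Wires A L} {W' : Wires A J'} {V' : Wires A K'}
  {f : W.obj ⟶ V.obj} {g : W'.obj ⟶ V'.obj}

theorem relabel (e : J ≃ K) : IsMap W (W.relabel e) e (𝟙 W.obj) where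
  isMonHom := inferInstance
  wire_comp j := by simp

theorem tensorInl : IsMap W (W.tensor V) Sum.inl (tensorInl W.obj V.obj) where
  isMonHom := inferInstance
  wire_comp _ := rfl

theorem tensorInr : IsMap V (W.tensor V) Sum.inr (tensorInr W.obj V.obj) where
  isMonHom := inferInstance
  wire_comp _ := rfl

theorem tensor {φ : J → K} {ψ : J' → K'} (hf : IsMap W V φ f) (hg : IsMap W' V' ψ g) :
    IsMap (W.tensor W') (V.tensor V') (Sum.map φ ψ) (f ⊗ₘ g) where
  isMonHom := by
    have := hf.isMonHom
    have := hg.isMonHom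
    infer_instance
  wire_comp := by
    have := hf.isMonHom
    have := hg.isMonHom
    rintro (j | j)
    · simp [tensorInl_tensorHom, ← hf.wire_comp]
    · simp [tensorInr_tensorHom, ← hg.wire_comp]

theorem whiskerLeft {ψ : J' → K'} (hg : IsMap W' V' ψ g) :
    IsMap (W.tensor W') (W.tensor V') (Sum.map _root_.id ψ) (W.obj ◁ g) := by
  rw [← id_tensorHom]
  exact id.tensor hg

theorem whiskerRight {φ : J → K} (hf : IsMap W V φ f) :
    IsMap (W.tensor U) (V.tensor U) (Sum.map φ _root_.id) (f ▷ U.obj) := by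
  rw [← tensorHom_id]
  exact hf.tensor id

theorem associator : IsMap ((W.tensor V).tensor U) (W.tensor (V.tensor U))
    (Equiv.sumAssoc J K L) (α_ W.obj V.obj U.obj).hom where
  isMonHom := inferInstance
  wire_comp := by
    rintro ((j | k) | l)
    · simp [tensorInl_tensorInl_associator]
    · simp [tensorInr_tensorInl_associator]
    · simp [tensorInr_associator]

theorem braiding : IsMap (W.tensor V) (V.tensor W) (Equiv.sumComm J K)
    (β_ W.obj V.obj).hom where
  isMonHom := inferInstance
  wire_comp := by
    rintro (j | k)
    · simp [tensorInl_braiding]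
    · simp [tensorInr_braiding]

theorem leftUnitor [IsEmpty L] :
    IsMap ((empty A L).tensor W) W (Equiv.emptySum L J) (λ_ W.obj).hom where
  isMonHom := inferInstance
  wire_comp := by
    rintro (j | j)
    · exact isEmptyElim j
    · simp [tensorInr_leftUnitor]

theorem rightUnitor [IsEmpty L] :
    IsMap (W.tensor (empty A L)) W (Equiv.sumEmpty J L) (ρ_ W.obj).hom where
  isMonHom := inferInstance
  wire_comp := by
    rintro (j | j)
    · simp [tensorInl_rightUnitor]
    · exact isEmptyElim j

theorem tensorμ : IsMap ((W.tensor W').tensor (V.tensor V')) ((W.tensor V).tensor (W'.tensor V'))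
    (Equiv.sumSumSumComm J J' K K') (MonoidalCategory.tensorμ W.obj W'.obj V.obj V'.obj) := by
  have middle := (associator (W := W') (V := V) (U := V')).inv.comp
    (braiding.whiskerRight.comp associator)
  have h := associator.comp ((middle.whiskerLeft (W := W)).comp associator.inv)
  simpa only [MonoidalCategory.tensorμ, MonoidalCategory.whiskerLeft_comp, Category.assoc] using
    h.of_eq (φ' := Equiv.sumSumSumComm J J' K K') (by
      funext x
      rcases x with (x | x) | (x | x) <;> rfl)

theorem mul [Unique J] : IsMap ((single A J).tensor (single A J)) (single A J)
    (fun _ => default) μ[A.X] where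
  isMonHom := inferInstance
  wire_comp := by
    rintro (j | j)
    · simp [_root_.tensorInl]
    · simp [_root_.tensorInr]

theorem unit [IsEmpty J] [Unique K] :
    IsMap (empty A J) (single A K) isEmptyElim η[A.X] where
  isMonHom := inferInstance
  wire_comp := isEmptyElim

end IsMap

/-! ### Discarding wires -/

variable {W : Wires A J} {V : Wires A K} {U : Wires A L} {W' : Wires A J'} {V' : Wires A K'}

variable (V) in
/-- A family of wires is discardable if discarding it from a state restricts the corresponding
partition to the remaining wires. -/
def Discardable [Finite K] : Prop :=
  ∀ {J : Type w} [Finite J] (W : Wires A J) (r : Setoid (J ⊕ K)),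
    (W.tensor V).state r ≫ discardRight W.obj V.counit = W.state (r.comap Sum.inl)

theorem link_discardRight [Unique K] (j : J) :
    (W.tensor (single A K)).link (Sum.inl j) (Sum.inr default) ≫
      discardRight W.obj (single A K).counit = 1 := by
  have e : (W.tensor (single A K)).link (Sum.inl j) (Sum.inr default) =
      η[A.X] ≫ ((W.wire j ≫ tensorInl W.obj A.X) * (𝟙 A.X ≫ tensorInr W.obj A.X)) := rfl
  rw [e, tensorInl_conv_mul_tensorInr, discardRight, MonoidalCategory.tensorHom_def',
    point_one_eq]
  simp [← whisker_exchange_assoc]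

variable [Finite J] [Finite K] [Finite L] [Finite J'] [Finite K']

theorem state_tensor_single_of_rel [Unique K] {r : Setoid (J ⊕ K)} {j : J}
    (hj : r (Sum.inl j) (Sum.inr default)) :
    (W.tensor (single A K)).state r = (W.state (r.comap Sum.inl) ≫ tensorInl _ _) *
      (W.tensor (single A K)).link (Sum.inl j) (Sum.inr default) := by
  set V := W.tensor (single A K)
  refine (V.eq_state (mul_mem (IsMap.tensorInl.comp_mem_links le_rfl (W.state_mem_links _))
    (link_mem_links hj)) ?_).symm
  set t := (W.state (r.comap Sum.inl) ≫ tensorInl _ _) * V.link (Sum.inl j) (Sum.inr default)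
  have rel_inl {i k} (h : r (Sum.inl i) (Sum.inl k)) : V.rel t (Sum.inl i) (Sum.inl k) :=
    V.rel_le_rel_mul_right _ _ (IsMap.tensorInl.le_comap_rel_state_comp (r.comap Sum.inl) h)
  have rel_inr {i k} (h : r (Sum.inl i) (Sum.inr k)) : V.rel t (Sum.inl i) (Sum.inr k) := by
    obtain rfl := Unique.eq_default k
    exact Setoid.trans' _ (rel_inl (r.trans h (r.symm hj)))
      (V.rel_le_rel_mul_left _ _ (V.rel_link _ _))
  rintro (i | i) (k | k) h
  · exact rel_inl h
  · exact rel_inr h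
  · exact Setoid.symm' _ (rel_inr (r.symm h))
  · rw [Subsingleton.elim i k]

theorem state_tensor_single_of_not_rel [Unique K] {r : Setoid (J ⊕ K)}
    (h : ∀ j, ¬ r (Sum.inl j) (Sum.inr default)) :
    (W.tensor (single A K)).state r = W.state (r.comap Sum.inl) ≫ tensorInl _ _ := by
  refine (IsMap.tensorInl.state_comp ⟨fun _ _ h => h, fun s hs => ?_⟩).symm
  rintro (i | i) (k | k) hik
  · exact hs hik
  · exact (h i (Unique.eq_default k ▸ hik)).elim
  · exact (h k (Unique.eq_default i ▸ r.symm hik)).elim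
  · rw [Subsingleton.elim i k]

theorem discardable_empty [IsEmpty K] : (empty A K).Discardable := fun W r => by
  have e : discardRight W.obj (empty A K).counit = (ρ_ W.obj).hom := by simp [discardRight]
  rw [e]
  exact IsMap.rightUnitor.state_comp_equiv r

theorem discardable_single [Unique K] : (single A K).Discardable := fun W r => by
  by_cases h : ∃ j, r (Sum.inl j) (Sum.inr default)
  · obtain ⟨j, hj⟩ := h
    rw [state_tensor_single_of_rel hj, tensorInl_mul_comp_discardRight, link_discardRight, mul_one]
  · rw [state_tensor_single_of_not_rel (not_exists.1 h), Category.assoc,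
      tensorInl_discardRight (single A K).unit_counit, Category.comp_id]

theorem Discardable.tensor (hV : V.Discardable) (hV' : V'.Discardable) :
    (V.tensor V').Discardable := fun W r => by
  have e : discardRight W.obj (V.tensor V').counit = (α_ _ _ _).inv ≫
      discardRight (W.obj ⊗ V.obj) V'.counit ≫ discardRight W.obj V.counit := by
    simp [discardRight, MonoidalCategory.tensorHom_def', unitors_equal]
  have h := (IsMap.associator (W := W) (V := V) (U := V')).inv.state_comp_equiv r
  rw [e, reassoc_of% h, reassoc_of% (hV' (W.tensor V)), hV]
  rfl

theorem Discardable.relabel (hV : V.Discardable) (e : K ≃ L) : (V.relabel e).Discardable :=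
  fun W r => by
    have h := ((IsMap.relabel (W := V) e).whiskerLeft (W := W)).state_comap_comp
      (Function.surjective_id.sumMap e.surjective) r
    rw [MonoidalCategory.whiskerLeft_id, Category.comp_id] at h
    rw [← h]
    exact hV W _

theorem Discardable.state_middle (hV : V.Discardable) (r : Setoid (J ⊕ K ⊕ L)) :
    (W.tensor (V.tensor U)).state r ≫ W.obj ◁ discardLeft V.counit U.obj =
      (W.tensor U).state (r.comap (Corelation.inXZ J K L)) := by
  have swap : IsMap (W.tensor (V.tensor U)) ((W.tensor U).tensor V)
      (((Equiv.refl J).sumCongr (Equiv.sumComm K L)).trans (Equiv.sumAssoc J L K).symm)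
      (W.obj ◁ (β_ V.obj U.obj).hom ≫ (α_ _ _ _).inv) :=
    IsMap.braiding.whiskerLeft.comp IsMap.associator.inv
  have e : W.obj ◁ discardLeft V.counit U.obj = (W.obj ◁ (β_ V.obj U.obj).hom ≫ (α_ _ _ _).inv) ≫
      discardRight (W.obj ⊗ U.obj) V.counit := by
    rw [discardLeft, discardRight, rightUnitor_tensor_hom, Category.assoc,
      associator_naturality_right_assoc, Iso.inv_hom_id_assoc,
      ← MonoidalCategory.whiskerLeft_comp, ← MonoidalCategory.whiskerLeft_comp,
      ← BraidedCategory.braiding_naturality_left_assoc, braiding_rightUnitor]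
  rw [e, ← Category.assoc, swap.state_comp_equiv, hV (W.tensor U)]
  congr 1
  ext (i | i) (j | j) <;> rfl

/-! ### Corelations as morphisms between families of wires -/

variable (W V) in
/-- The morphism given by a corelation: its state, bent into a morphism. -/
noncomputable def map (α : Corelation J K) : W.obj ⟶ V.obj :=
  unbend W.counit ((W.tensor V).state α)

theorem state_glue (α : Corelation J K) (β : Corelation K L) :
    ((W.tensor V).state α ≫ W.obj ◁ tensorInl V.obj U.obj) *
      ((V.tensor U).state β ≫ tensorInr W.obj (V.obj ⊗ U.obj)) =
        (W.tensor (V.tensor U)).state (α.glue β) :=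
  (IsMap.tensorInl.whiskerLeft (W := W)).state_comp_mul (IsMap.tensorInr (V := V.tensor U))
    ⟨⟨fun _ _ h _ hs => hs.1 h, fun _ _ h _ hs => hs.2 h⟩, fun _ hs => sInf_le hs⟩

theorem map_comp (hV : V.Discardable) (α : Corelation J K) (β : Corelation K L) :
    W.map V α ≫ V.map U β = W.map U (α.comp β) := by
  rw [map, map, map, unbend_eq_mulPoint V.counit, ← Category.assoc, unbend_comp,
    ← Category.assoc, ← unbend_mul_tensorInr, state_glue, unbend_comp, hV.state_middle]
  rfl

theorem state_tensor (α : Corelation J K) (β : Corelation J' K') :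
    ((W.tensor V).state α ≫ tensorInl _ _) * ((W'.tensor V').state β ≫ tensorInr _ _) =
      ((W.tensor W').tensor (V.tensor V')).state (α.tensor β) ≫ tensorμ _ _ _ _ := by
  rw [IsMap.tensorμ.state_comp_equiv]
  have comap_iff (x y) : (α.tensor β).comap (Equiv.sumSumSumComm J J' K K').symm x y ↔
      Sum.LiftRel α β x y := by
    rw [← Equiv.apply_symm_apply (Equiv.sumSumSumComm J J' K K') x,
      ← Equiv.apply_symm_apply (Equiv.sumSumSumComm J J' K K') y, Setoid.comap_rel,
      Equiv.symm_apply_apply, Equiv.symm_apply_apply]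
    rfl
  refine IsMap.tensorInl.state_comp_mul IsMap.tensorInr
    ⟨⟨fun _ _ h => (comap_iff _ _).2 (.inl h), fun _ _ h => (comap_iff _ _).2 (.inr h)⟩,
      fun s hs x y hxy => ?_⟩
  obtain h | h := (comap_iff x y).1 hxy
  · exact hs.1 h
  · exact hs.2 h

theorem map_tensor (α : Corelation J K) (β : Corelation J' K') :
    (W.tensor W').map (V.tensor V') (α.tensor β) = W.map V α ⊗ₘ W'.map V' β := by
  have := (IsMap.tensorμ (W := W) (V := V) (W' := W') (V' := V')).isMonHom
  simp only [map, unbend_eq_mulPoint]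
  rw [← tensorHom_comp_tensorHom, ← tensorHom_comp_tensorHom, ← mulPoint_tensor, state_tensor,
    ← tensorμ_discardLeft, ← tensorInl_tensorμ, Category.assoc, reassoc_of% (mulPoint_comp _ _)]

variable (W) in
/-- A family of wires is faithful if it sends the identity corelation to the identity. -/
def Faithful : Prop := W.map W (Corelation.id J) = 𝟙 W.obj

theorem Faithful.map_ker_eq (hW : W.Faithful) {φ : J → K} {f : W.obj ⟶ V.obj}
    (hf : IsMap W V φ f) : W.map V (Setoid.ker (Sum.elim φ _root_.id)) = f := by
  rw [← Category.id_comp f, ← hW, map, map, unbend_comp, hf.whiskerLeft.state_comp]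
  refine ⟨?_, fun s hs => ?_⟩
  · have h (x : J ⊕ J) : Sum.elim φ _root_.id (Sum.map _root_.id φ x) =
        φ (Sum.elim _root_.id _root_.id x) := by rcases x with x | x <;> rfl
    intro x y hxy
    exact (h x).trans ((congrArg φ hxy).trans (h y).symm)
  · have rel_inr (x : J ⊕ K) : s x (Sum.inr (Sum.elim φ _root_.id x)) := by
      rcases x with j | k
      · exact @hs (Sum.inl j) (Sum.inr j) rfl
      · exact s.refl _
    intro x y hxy
    exact s.trans (rel_inr x) (hxy ▸ s.symm (rel_inr y))

theorem Faithful.map_top [Subsingleton K] (hW : W.Faithful) {φ : J → K} {f : W.obj ⟶ V.obj}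
    (hf : IsMap W V φ f) : W.map V ⊤ = f := by
  rw [← hW.map_ker_eq hf]
  congr 1
  exact (top_unique fun _ _ _ => Subsingleton.elim _ _).symm

theorem faithful_empty [IsEmpty J] : (empty A J).Faithful := by
  rw [Faithful, map, state_eq_one _ fun i => isEmptyElim i, unbend_one]
  exact Category.comp_id _

theorem state_single_single [Unique J] [Unique K] :
    ((single A J).tensor (single A K)).state ⊤ = η[A.X] ≫ Δ[A.X] := by
  let W := (single A J).tensor (single A K)
  have e : W.link (Sum.inl default) (Sum.inr default) =
      η[A.X] ≫ ((𝟙 A.X ≫ tensorInl A.X A.X) * (𝟙 A.X ≫ tensorInr A.X A.X)) := rfl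
  have h (x : J ⊕ K) : x = Sum.inl default ∨ x = Sum.inr default ∨ x = Sum.inr default := by
    rcases x with x | x <;> simp [Unique.eq_default x]
  rw [W.state_top h, W.mul_link_of_rel (W.rel_link _ _), e, tensorInl_conv_mul_tensorInr]
  simp

theorem faithful_single [Unique J] : (single A J).Faithful := by
  have e : Corelation.id J = ⊤ := top_unique fun _ _ _ => Subsingleton.elim _ _
  rw [Faithful, map, e, state_single_single]
  exact A.unbend_unit_comul

theorem Faithful.tensor (hV : V.Faithful) (hV' : V'.Faithful) : (V.tensor V').Faithful := by
  have e : (Corelation.id K).tensor (Corelation.id K') = Corelation.id (K ⊕ K') := by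
    rw [Corelation.id_eq, Corelation.id_eq, Corelation.ofEquiv_tensor, Equiv.sumCongr_refl]
    rfl
  rw [Faithful, ← e, map_tensor, hV, hV', id_tensorHom_id]

theorem Faithful.relabel (hV : V.Faithful) (e : K ≃ L) : (V.relabel e).Faithful := by
  have h := ((IsMap.relabel (W := V) e).tensor (IsMap.relabel (W := V) e)).state_comap_comp
    (e.surjective.sumMap e.surjective) (Corelation.id L)
  have hid : (Corelation.id L).comap (Sum.map e e) = Corelation.id K := by
    ext (x | x) (y | y) <;> exact e.injective.eq_iff
  rw [id_tensorHom_id, Category.comp_id, hid] at h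
  rw [Faithful, map, ← h]
  exact hV

/-! ### The generating corelations -/

theorem map_mul [Unique J] : ((single A J).tensor (single A J)).map (single A J) ⊤ = μ[A.X] :=
  (faithful_single.tensor faithful_single).map_top IsMap.mul

theorem map_unit [IsEmpty J] [Unique K] : (empty A J).map (single A K) ⊤ = η[A.X] :=
  faithful_empty.map_top IsMap.unit

theorem map_counit [Unique J] [IsEmpty K] : (single A J).map (empty A K) ⊤ = ε[A.X] := by
  rw [map, state_eq_one, unbend_one]
  · exact Category.comp_id _
  · rintro (i | i) (j | j) -
    · rw [Subsingleton.elim i j]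
    all_goals first | exact isEmptyElim i | exact isEmptyElim j

theorem map_comul [Unique J] :
    (single A J).map ((single A J).tensor (single A J)) ⊤ = Δ[A.X] := by
  let V := (single A J).tensor (single A J)
  let W := (single A J).tensor V
  let x : J ⊕ J ⊕ J := Sum.inl default
  let a : J ⊕ J ⊕ J := Sum.inr (Sum.inl default)
  let b : J ⊕ J ⊕ J := Sum.inr (Sum.inr default)
  have h (y : J ⊕ J ⊕ J) : y = x ∨ y = a ∨ y = b := by
    rcases y with y | y | y <;> simp [x, a, b, Unique.eq_default y]
  have hab : W.wire a * W.wire b = Δ[A.X] ≫ tensorInr A.X V.obj := by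
    have e : W.wire a * W.wire b = ((𝟙 A.X ≫ tensorInl A.X A.X) ≫ tensorInr A.X V.obj) *
      ((𝟙 A.X ≫ tensorInr A.X A.X) ≫ tensorInr A.X V.obj) := rfl
    rw [e, ← conv_mul_comp, tensorInl_conv_mul_tensorInr, id_tensorHom_id, Category.comp_id]
  have hx : W.wire x * (Δ[A.X] ≫ tensorInr A.X V.obj) = Δ[A.X] ≫ A.X ◁ Δ[A.X] := by
    rw [← id_tensorHom]
    exact tensorInl_conv_mul_tensorInr _ _
  rw [map, W.state_top h, link_mul_link, hab, hx, ← Category.assoc]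
  exact (unbend_comp _ _ _).symm.trans (by rw [A.unbend_unit_comul, Category.id_comp])

end Wires

/-! ### The functor from corelations to a symmetric monoidal category -/

/-- A family of wires indexed by a finite set that is discardable and faithful: these are the
properties by which corelations act functorially. -/
structure Wiring (A : ESCFM C) (X : FinCorel.{w}) extends Wires A X.carrier where
  discardable : toWires.Discardable
  faithful : toWires.Faithful

namespace Wiring

variable {A : ESCFM C} {X Y Z X' Y' : FinCorel.{w}}

/-- The unit object with its empty family of wires. -/
@[reducible] def empty (A : ESCFM C) (X : FinCorel.{w}) [IsEmpty X.carrier] : Wiring A X where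
  toWires := Wires.empty A X.carrier
  discardable := Wires.discardable_empty
  faithful := Wires.faithful_empty

/-- The object `A.X` with a single wire. -/
@[reducible] def single (A : ESCFM C) (X : FinCorel.{w}) [Unique X.carrier] : Wiring A X where
  toWires := Wires.single A X.carrier
  discardable := Wires.discardable_single
  faithful := Wires.faithful_single

/-- The disjoint union of two families of wires, ending in a tensor product. -/
@[reducible] def tensor (P : Wiring A X) (Q : Wiring A Y) : Wiring A (X ⊗ Y) where
  toWires := P.toWires.tensor Q.toWires
  discardable := Wires.Discardable.tensor P.discardable Q.discardable
  faithful := P.faithful.tensor Q.faithful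

/-- The same family of wires, indexed by an equivalent type. -/
def relabel (P : Wiring A X) (e : X.carrier ≃ Y.carrier) : Wiring A Y where
  toWires := P.toWires.relabel e
  discardable := Wires.Discardable.relabel P.discardable e
  faithful := P.faithful.relabel e

instance : IsEmpty (𝟙_ FinCorel.{w}).carrier := inferInstanceAs (IsEmpty PEmpty)

theorem nonempty (A : ESCFM C) (X : FinCorel.{w}) : Nonempty (Wiring A X) := by
  refine Finite.induction_empty_option (P := fun J => ∀ [Finite J], Nonempty (Wiring A ⟨J⟩))
    (fun {J K} e h => ?_) ?_ (fun {J} _ h => ?_) X.carrier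
  · intro _
    have := Finite.of_equiv _ e.symm
    obtain ⟨P⟩ := h
    exact ⟨P.relabel e⟩
  · intro _
    exact ⟨empty A ⟨PEmpty⟩⟩
  · intro _
    obtain ⟨P⟩ := h
    exact ⟨(P.tensor (single A ⟨PUnit⟩)).relabel (Equiv.optionEquivSumPUnit J).symm⟩

section

variable (P : Wiring A X) (Q : Wiring A Y) (R : Wiring A Z) (P' : Wiring A X') (Q' : Wiring A Y')

/-- The morphism given by a corelation. -/
noncomputable def map (f : X ⟶ Y) : P.obj ⟶ Q.obj := P.toWires.map Q.toWires f

variable {P Q} in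
theorem map_ofEquiv {e : X.carrier ≃ Y.carrier} {f : P.obj ⟶ Q.obj}
    (hf : Wires.IsMap P.toWires Q.toWires e f) : P.map Q (Corelation.ofEquiv e) = f :=
  P.faithful.map_ker_eq hf

theorem map_id : P.map P (𝟙 X) = 𝟙 P.obj := P.faithful

theorem map_comp (f : X ⟶ Y) (g : Y ⟶ Z) : P.map R (f ≫ g) = P.map Q f ≫ Q.map R g :=
  (Wires.map_comp Q.discardable f g).symm

theorem map_tensor (f : X ⟶ Y) (g : X' ⟶ Y') :
    (P.tensor P').map (Q.tensor Q') (f ⊗ₘ g) = P.map Q f ⊗ₘ P'.map Q' g :=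
  Wires.map_tensor f g

theorem map_whiskerRight (f : X ⟶ Y) :
    (P.tensor R).map (Q.tensor R) (f ▷ Z) = P.map Q f ▷ R.obj := by
  rw [← tensorHom_id, map_tensor, map_id, tensorHom_id]

theorem map_whiskerLeft (f : X ⟶ Y) :
    (R.tensor P).map (R.tensor Q) (Z ◁ f) = R.obj ◁ P.map Q f := by
  rw [← id_tensorHom, map_tensor, map_id, id_tensorHom]

theorem map_associator : ((P.tensor Q).tensor R).map (P.tensor (Q.tensor R)) (α_ X Y Z).hom =
    (α_ P.obj Q.obj R.obj).hom :=
  map_ofEquiv (P := (P.tensor Q).tensor R) (Q := P.tensor (Q.tensor R)) Wires.IsMap.associator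

theorem map_leftUnitor : ((empty A (𝟙_ _)).tensor P).map P (λ_ X).hom = (λ_ P.obj).hom :=
  map_ofEquiv (P := (empty A (𝟙_ _)).tensor P) Wires.IsMap.leftUnitor

theorem map_rightUnitor : (P.tensor (empty A (𝟙_ _))).map P (ρ_ X).hom = (ρ_ P.obj).hom :=
  map_ofEquiv (P := P.tensor (empty A (𝟙_ _))) Wires.IsMap.rightUnitor

theorem map_braiding : (P.tensor Q).map (Q.tensor P) (β_ X Y).hom = (β_ P.obj Q.obj).hom :=
  map_ofEquiv (P := P.tensor Q) (Q := Q.tensor P) Wires.IsMap.braiding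

/-- Two families of wires with the same index set have isomorphic objects. -/
noncomputable def iso (P' : Wiring A X) : P.obj ≅ P'.obj where
  hom := P.map P' (𝟙 X)
  inv := P'.map P (𝟙 X)
  hom_inv_id := by rw [← map_comp, Category.comp_id, map_id]
  inv_hom_id := by rw [← map_comp, Category.comp_id, map_id]

end

/-- A choice of a family of wires for each finite set. -/
noncomputable def choice (A : ESCFM C) (X : FinCorel.{w}) : Wiring A X :=
  (nonempty A X).some

end Wiring

namespace ESCFM

open Wiring

variable (A : ESCFM C)

/-- The functor from finite sets and corelations that sends a set to a tensor power of an
extraspecial commutative Frobenius monoid. -/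
noncomputable def corelFunctor : FinCorel.{w} ⥤ C where
  obj X := (choice A X).obj
  map f := (choice A _).map (choice A _) f
  map_id _ := map_id _
  map_comp _ _ := map_comp _ _ _ _ _

/-- The functor `corelFunctor` is strong monoidal. -/
noncomputable def corelFunctorCore : (corelFunctor.{w} A).CoreMonoidal where
  εIso := (empty A (𝟙_ _)).iso (choice A _)
  μIso X Y := ((choice A X).tensor (choice A Y)).iso (choice A (X ⊗ Y))
  μIso_hom_natural_left f X' := by
    simp only [corelFunctor, iso, ← map_whiskerRight, ← map_comp]
    simp
  μIso_hom_natural_right X' f := by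
    simp only [corelFunctor, iso, ← map_whiskerLeft, ← map_comp]
    simp
  associativity X Y Z := by
    simp only [corelFunctor, iso, ← map_whiskerLeft, ← map_whiskerRight, ← map_associator,
      ← map_comp]
    simp
  left_unitality X := by
    simp only [corelFunctor, iso, ← map_leftUnitor]
    rw [← map_whiskerRight, ← map_comp, ← map_comp]
    simp
  right_unitality X := by
    simp only [corelFunctor, iso, ← map_rightUnitor]
    rw [← map_whiskerLeft, ← map_comp, ← map_comp]
    simp

noncomputable instance : (corelFunctor.{w} A).Braided where
  toMonoidal := (corelFunctorCore A).toMonoidal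
  braided X Y := by
    refine (map_comp _ _ _ _ _).symm.trans ?_
    refine Eq.trans ?_ (congrArg (· ≫ _) (map_braiding _ _))
    refine Eq.trans ?_ (map_comp _ _ _ _ _)
    simp

end ESCFM

end

/-! ### The symmetric monoidal functor given by a morphism of props -/

namespace PROP

variable {P Q : PROP.{w}} (φ : P ⟶ Q)

theorem map_eqHom {n m : ℕ} (h : n = m) : Morphism.map φ (P.eqHom h) = Q.eqHom h := by
  subst h
  exact Morphism.map_id φ n

/-- The functor given by a morphism of props. -/
def functor : P.Obj ⥤ Q.Obj where
  obj n := ⟨n.val⟩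
  map f := Morphism.map φ f
  map_id n := Morphism.map_id φ n.val
  map_comp f g := Morphism.map_comp φ f g

/-- The functor given by a morphism of props is strict monoidal. -/
def functorCore : (functor φ).CoreMonoidal where
  εIso := Iso.refl _
  μIso _ _ := Iso.refl _
  μIso_hom_natural_left f n := by
    refine (Category.comp_id _).trans (Eq.trans ?_ (Category.id_comp _).symm)
    refine Eq.trans ?_ (Morphism.map_tensor φ _ _).symm
    exact congrArg _ (Morphism.map_id φ _).symm
  μIso_hom_natural_right n f := by
    refine (Category.comp_id _).trans (Eq.trans ?_ (Category.id_comp _).symm)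
    refine Eq.trans ?_ (Morphism.map_tensor φ _ _).symm
    exact congrArg (Q.tensor · _) (Morphism.map_id φ _).symm
  associativity n m p := by
    refine (congrArg (· ≫ _) (Q.tensor_id _ _)).trans ((Category.id_comp _).trans ?_)
    refine (Category.id_comp _).trans ((map_eqHom φ _).trans ?_)
    refine Eq.symm ((congrArg (CategoryStruct.comp _) ?_).trans (Category.comp_id _))
    exact (congrArg₂ CategoryStruct.comp (Q.tensor_id _ _) rfl).trans (Category.id_comp _)
  left_unitality n := by
    refine Eq.trans ?_ (congrArg (· ≫ _) (Q.tensor_id _ _)).symm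
    refine Eq.trans ?_ (Category.id_comp _).symm
    refine Eq.trans ?_ (Category.id_comp _).symm
    exact (map_eqHom φ _).symm
  right_unitality n := by
    refine Eq.trans ?_ (congrArg (· ≫ _) (Q.tensor_id _ _)).symm
    refine Eq.trans ?_ (Category.id_comp _).symm
    refine Eq.trans ?_ (Category.id_comp _).symm
    exact (map_eqHom φ (Nat.add_zero n.val)).symm

instance : (functor φ).Braided where
  toMonoidal := (functorCore φ).toMonoidal
  braided n m := by
    refine (Category.id_comp _).trans (Eq.trans ?_ (Category.comp_id _).symm)
    exact Morphism.map_braid φ _ _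

end PROP

/-! ### The prop of corelations is a skeleton -/

namespace Corelation

section

variable {X Y Z X' Y' Z' : Type*}

/-- A corelation between `X` and `Y`, read along bijections as one between `X'` and `Y'`. -/
@[reducible] def transport (e : X ≃ X') (f : Y ≃ Y') (α : Corelation X Y) : Corelation X' Y' :=
  α.comap (Sum.map e.symm f.symm)

theorem colors_transport (e : X ≃ X') (f : Y ≃ Y') (α : Corelation X Y) (u : X' → Prop)
    (v : Y' → Prop) : (α.transport e f).Colors u v ↔ α.Colors (u ∘ e) (v ∘ f) := by
  rw [transport, comap_eq, colors_ofEquiv_comp, colors_comp_ofEquiv]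
  rfl

theorem transport_symm_transport (e : X ≃ X') (f : Y ≃ Y') (α : Corelation X' Y') :
    (α.transport e.symm f.symm).transport e f = α :=
  ext_colors fun u v => by simp [colors_transport, Function.comp_assoc]

theorem transport_injective (e : X ≃ X') (f : Y ≃ Y') :
    Function.Injective (transport e f) :=
  Function.LeftInverse.injective (transport_symm_transport e.symm f.symm)

theorem transport_comp (e : X ≃ X') (f : Y ≃ Y') (g : Z ≃ Z') (α : Corelation X Y)
    (β : Corelation Y Z) :
    (α.comp β).transport e g = (α.transport e f).comp (β.transport f g) :=
  ext_colors fun u v => by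
    simp only [colors_transport, colors_comp]
    exact (f.arrowCongr (Equiv.refl Prop)).exists_congr_left

theorem transport_ofEquiv (e : X ≃ X') (f : Y ≃ Y') (g : X ≃ Y) :
    (ofEquiv g).transport e f = ofEquiv (e.symm.trans (g.trans f)) := by
  rw [transport, comap_eq, ofEquiv_comp, ofEquiv_comp]

theorem ofEquiv_comp_transport (e : X ≃ X') (f : Y ≃ Y') (α : Corelation X Y) :
    (ofEquiv e).comp (α.transport e f) = α.comp (ofEquiv f) :=
  ext_colors fun u v => by
    rw [colors_ofEquiv_comp, colors_transport, colors_comp_ofEquiv, Function.comp_assoc,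
      Equiv.symm_comp_self, Function.comp_id]

end

theorem eq_of_comp_eq_id {n m : ℕ} {α : Corelation (Fin n) (Fin m)}
    {β : Corelation (Fin m) (Fin n)} (h : α.comp β = id (Fin n)) (h' : β.comp α = id (Fin m)) :
    n = m := by
  have le_of_comp_eq_id : ∀ {n m : ℕ} {α : Corelation (Fin n) (Fin m)}
      {β : Corelation (Fin m) (Fin n)}, α.comp β = id (Fin n) → n ≤ m := by
    intro n m α β h
    have hαβ (u v) : (∃ w, α.Colors u w ∧ β.Colors w v) ↔ u = v := by
      rw [← colors_comp, h, colors_id]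
    choose f hα hβ using fun u => (hαβ u u).2 rfl
    have hf : Function.Injective f := fun u v huv => (hαβ u v).1 ⟨f u, hα u, huv ▸ hβ v⟩
    simpa [Nat.pow_le_pow_iff_right] using Fintype.card_le_of_injective f hf
  exact le_antisymm (le_of_comp_eq_id h) (le_of_comp_eq_id h')

end Corelation

namespace FinCorel

variable {X Y Z : FinCorel.{w}}

theorem isoOfEquiv_hom_comp (e : X.carrier ≃ Y.carrier) (f : Y.carrier ≃ Z.carrier) :
    (isoOfEquiv e).hom ≫ (isoOfEquiv f).hom = (isoOfEquiv (e.trans f)).hom :=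
  Corelation.ofEquiv_comp e f

theorem isoOfEquiv_hom_congr {e f : X.carrier ≃ Y.carrier} (h : ∀ x, e x = f x) :
    (isoOfEquiv e).hom = (isoOfEquiv f).hom :=
  congrArg Corelation.ofEquiv (Equiv.ext h)

theorem isoOfEquiv_hom_whiskerRight (e : X.carrier ≃ Y.carrier) (Z : FinCorel.{w}) :
    (isoOfEquiv e).hom ▷ Z =
      (isoOfEquiv (X := X ⊗ Z) (Y := Y ⊗ Z) (e.sumCongr (Equiv.refl Z.carrier))).hom :=
  Corelation.ofEquiv_tensor e (Equiv.refl Z.carrier)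

theorem whiskerLeft_isoOfEquiv_hom (e : X.carrier ≃ Y.carrier) (Z : FinCorel.{w}) :
    Z ◁ (isoOfEquiv e).hom =
      (isoOfEquiv (X := Z ⊗ X) (Y := Z ⊗ Y) ((Equiv.refl Z.carrier).sumCongr e)).hom :=
  Corelation.ofEquiv_tensor (Equiv.refl Z.carrier) e

theorem associator_hom_eq (X Y Z : FinCorel.{w}) : (α_ X Y Z).hom =
    (isoOfEquiv (X := (X ⊗ Y) ⊗ Z) (Y := X ⊗ Y ⊗ Z)
      (Equiv.sumAssoc X.carrier Y.carrier Z.carrier)).hom := rfl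

theorem leftUnitor_hom_eq (X : FinCorel.{w}) : (λ_ X).hom =
    (isoOfEquiv (X := 𝟙_ _ ⊗ X) (Equiv.emptySum PEmpty X.carrier)).hom := rfl

theorem rightUnitor_hom_eq (X : FinCorel.{w}) : (ρ_ X).hom =
    (isoOfEquiv (X := X ⊗ 𝟙_ _) (Equiv.sumEmpty X.carrier PEmpty)).hom := rfl

theorem braiding_hom_eq (X Y : FinCorel.{w}) : (β_ X Y).hom =
    (isoOfEquiv (X := X ⊗ Y) (Y := Y ⊗ X) (Equiv.sumComm X.carrier Y.carrier)).hom := rfl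

end FinCorel

/-- The inclusion of the prop of corelations into the category of finite sets and corelations. -/
def corelInclusion : corelPROP.Obj ⥤ FinCorel.{w} where
  obj n := ⟨ULift (Fin n.val)⟩
  map α := Corelation.transport Equiv.ulift.symm Equiv.ulift.symm α
  map_id n := by
    refine (Corelation.transport_ofEquiv _ _ (Equiv.refl (Fin n.val))).trans ?_
    exact congrArg Corelation.ofEquiv (Equiv.ext fun _ => rfl)
  map_comp := Corelation.transport_comp _ _ _

namespace corelInclusion

/-- The bijection between the two incarnations of the empty set. -/
def unitEquiv : (𝟙_ FinCorel.{w}).carrier ≃ (corelInclusion.{w}.obj (𝟙_ _)).carrier :=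
  Equiv.equivOfIsEmpty PEmpty (ULift (Fin 0))

/-- The bijection between the disjoint union of two standard sets and a standard set. -/
def sumEquiv (n m : corelPROP.Obj) :
    (corelInclusion.{w}.obj n ⊗ corelInclusion.{w}.obj m).carrier ≃
      (corelInclusion.{w}.obj (n ⊗ m)).carrier :=
  (Equiv.ulift.sumCongr Equiv.ulift).trans (finSumFinEquiv.trans Equiv.ulift.symm)

/-- A bijection between standard sets, lifted to the universe of the category of finite sets. -/
def liftEquiv {n m : corelPROP.Obj} (e : Fin n.val ≃ Fin m.val) :
    (corelInclusion.{w}.obj n).carrier ≃ (corelInclusion.{w}.obj m).carrier :=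
  Equiv.ulift.trans (e.trans Equiv.ulift.symm)

theorem map_ofEquiv {n m : corelPROP.Obj} (e : Fin n.val ≃ Fin m.val) :
    corelInclusion.{w}.map (X := n) (Y := m) (Corelation.ofEquiv e) =
      (FinCorel.isoOfEquiv (liftEquiv e)).hom :=
  Corelation.transport_ofEquiv _ _ e

theorem map_eqIso {n m : corelPROP.Obj} (h : n.val = m.val) :
    corelInclusion.{w}.map (corelPROP.eqIso h).hom =
      (FinCorel.isoOfEquiv (liftEquiv (finCongr h))).hom :=
  (congrArg _ (corelData_eqHom h)).trans (map_ofEquiv _)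

theorem map_associator (n m p : corelPROP.Obj) :
    corelInclusion.{w}.map (α_ n m p).hom = (FinCorel.isoOfEquiv
      (liftEquiv (n := (n ⊗ m) ⊗ p) (m := n ⊗ m ⊗ p) (finCongr (Nat.add_assoc _ _ _)))).hom :=
  map_eqIso _

theorem map_leftUnitor (n : corelPROP.Obj) :
    corelInclusion.{w}.map (λ_ n).hom = (FinCorel.isoOfEquiv
      (liftEquiv (n := 𝟙_ _ ⊗ n) (finCongr (Nat.zero_add _)))).hom :=
  map_eqIso _

theorem map_rightUnitor (n : corelPROP.Obj) :
    corelInclusion.{w}.map (ρ_ n).hom = (FinCorel.isoOfEquiv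
      (liftEquiv (n := n ⊗ 𝟙_ _) (finCongr (Nat.add_zero _)))).hom :=
  map_eqIso _

theorem map_braiding (n m : corelPROP.Obj) :
    corelInclusion.{w}.map (β_ n m).hom = (FinCorel.isoOfEquiv
      (liftEquiv (n := n ⊗ m) (m := m ⊗ n) (finSumFinEquiv.symm.trans
        ((Equiv.sumComm _ _).trans finSumFinEquiv)))).hom :=
  map_ofEquiv _

theorem transport_sumEquiv {n m p q : corelPROP.Obj} (f : n ⟶ m) (g : p ⟶ q) :
    Corelation.transport (sumEquiv n p) (sumEquiv m q)
      (corelInclusion.{w}.map f ⊗ₘ corelInclusion.map g) = corelInclusion.map (f ⊗ₘ g) :=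
  Corelation.ext_colors fun u v => by
    rw [Corelation.colors_transport]
    refine (Corelation.colors_tensor _ _ _ _).trans ?_
    refine Iff.trans ?_ (Corelation.colors_transport _ _ _ _ _).symm
    refine Iff.trans ?_ (Corelation.colors_finTensor _ _ _ _).symm
    exact and_congr (Corelation.colors_transport _ _ _ _ _)
      (Corelation.colors_transport _ _ _ _ _)

theorem tensor_comp_sumEquiv {n m p q : corelPROP.Obj} (f : n ⟶ m) (g : p ⟶ q) :
    (corelInclusion.{w}.map f ⊗ₘ corelInclusion.map g) ≫
        (FinCorel.isoOfEquiv (sumEquiv m q)).hom =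
      (FinCorel.isoOfEquiv (sumEquiv n p)).hom ≫ corelInclusion.map (f ⊗ₘ g) := by
  rw [← transport_sumEquiv]
  exact (Corelation.ofEquiv_comp_transport _ _ _).symm

/-- The inclusion is strong monoidal. -/
def core : corelInclusion.{w}.CoreMonoidal where
  εIso := FinCorel.isoOfEquiv unitEquiv
  μIso n m := FinCorel.isoOfEquiv (sumEquiv n m)
  μIso_hom_natural_left f p := by
    rw [← tensorHom_id, ← corelInclusion.map_id, tensor_comp_sumEquiv, tensorHom_id]
  μIso_hom_natural_right p f := by
    rw [← id_tensorHom, ← corelInclusion.map_id, tensor_comp_sumEquiv, id_tensorHom]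
  associativity n m p := by
    simp only [map_associator, FinCorel.associator_hom_eq, FinCorel.isoOfEquiv_hom_whiskerRight,
      FinCorel.whiskerLeft_isoOfEquiv_hom, FinCorel.isoOfEquiv_hom_comp]
    refine FinCorel.isoOfEquiv_hom_congr fun x => ?_
    rcases x with (x | x) | x
    · rfl
    · rfl
    · exact ULift.ext _ _ (Fin.ext (Nat.add_assoc n.val m.val x.down.val))
  left_unitality n := by
    simp only [map_leftUnitor, FinCorel.leftUnitor_hom_eq, FinCorel.isoOfEquiv_hom_whiskerRight,
      FinCorel.isoOfEquiv_hom_comp]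
    refine FinCorel.isoOfEquiv_hom_congr fun x => ?_
    rcases x with x | x
    · exact x.elim
    · exact ULift.ext _ _ (Fin.ext (Nat.zero_add _).symm)
  right_unitality n := by
    simp only [map_rightUnitor, FinCorel.rightUnitor_hom_eq, FinCorel.whiskerLeft_isoOfEquiv_hom,
      FinCorel.isoOfEquiv_hom_comp]
    refine FinCorel.isoOfEquiv_hom_congr fun x => ?_
    rcases x with x | x
    · rfl
    · exact x.elim

instance : corelInclusion.{w}.Braided where
  toMonoidal := core.toMonoidal
  braided n m := by
    change (FinCorel.isoOfEquiv (sumEquiv n m)).hom ≫ _ =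
      _ ≫ (FinCorel.isoOfEquiv (sumEquiv m n)).hom
    simp only [map_braiding, FinCorel.braiding_hom_eq, FinCorel.isoOfEquiv_hom_comp]
    refine FinCorel.isoOfEquiv_hom_congr fun x => ?_
    rcases x with x | x
    · exact congrArg (fun i => ULift.up (finSumFinEquiv (Sum.swap i)))
        (finSumFinEquiv.symm_apply_apply (Sum.inl x.down))
    · exact congrArg (fun i => ULift.up (finSumFinEquiv (Sum.swap i)))
        (finSumFinEquiv.symm_apply_apply (Sum.inr x.down))

instance : corelInclusion.{w}.IsEquivalence where
  faithful := ⟨fun h => Corelation.transport_injective _ _ h⟩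
  full := ⟨fun α => ⟨_, Corelation.transport_symm_transport _ _ α⟩⟩
  essSurj := ⟨fun X => by
    obtain ⟨n, ⟨e⟩⟩ := Finite.exists_equiv_fin X.carrier
    exact ⟨⟨n⟩, ⟨FinCorel.isoOfEquiv (Equiv.ulift.trans e.symm)⟩⟩⟩

theorem isSkeletonOf : IsSkeletonOf FinCorel.{w} corelPROP.Obj corelInclusion where
  skel := by
    rintro ⟨n⟩ ⟨m⟩ ⟨e⟩
    exact congrArg PROP.Obj.mk (Corelation.eq_of_comp_eq_id e.hom_inv_id e.inv_hom_id)

end corelInclusion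

/-! ### Interpretation of terms -/

/-- The interpretation of terms in a prop. -/
def Term.interp {S : Signature.{w}} {P : PROPData.{w}} (g : ∀ {n m}, S n m → P.Hom n m) :
    ∀ {n m}, Term S n m → P.Hom n m
  | _, _, .id n => P.id n
  | _, _, .braid n m => P.braid n m
  | _, _, .gen σ => g σ
  | _, _, .comp s t => P.comp (s.interp g) (t.interp g)
  | _, _, .tensor s t => P.tensor (s.interp g) (t.interp g)

theorem Term.interp_eqHom {S : Signature.{w}} {P : PROPData.{w}} (g : ∀ {n m}, S n m → P.Hom n m)
    {n m : ℕ} (h : n = m) : Term.interp g ((Term.data S).eqHom h) = P.eqHom h := by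
  subst h; rfl

theorem SMTheory.Provable.interp_eq {T : SMTheory.{w}} {P : PROP.{w}}
    (g : ∀ {n m}, T.sig n m → P.Hom n m)
    (hg : ∀ {n m} {s t : Term T.sig n m}, T.eqn s t → s.interp @g = t.interp @g)
    {n m : ℕ} {s t : Term T.sig n m} (h : T.Provable s t) : s.interp @g = t.interp @g := by
  induction h with
  | eqn h => exact hg h
  | refl s => rfl
  | symm _ h => exact h.symm
  | trans _ _ h h' => exact h.trans h'
  | comp_congr _ _ h h' => exact congrArg₂ P.comp h h'
  | tensor_congr _ _ h h' => exact congrArg₂ P.tensor h h'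
  | id_comp f => exact P.id_comp _
  | comp_id f => exact P.comp_id _
  | assoc f g h => exact P.assoc _ _ _
  | tensor_id n m => exact P.tensor_id _ _
  | tensor_comp f g f' g' => exact P.tensor_comp _ _ _ _
  | tensor_assoc f g h =>
    simp only [Term.interp, Term.interp_eqHom]
    exact P.tensor_assoc _ _ _
  | unit_tensor f =>
    simp only [Term.interp, Term.interp_eqHom]
    exact P.unit_tensor _
  | tensor_unit f =>
    simp only [Term.interp, Term.interp_eqHom]
    exact P.tensor_unit _
  | braid_naturality f g => exact P.braid_naturality _ _
  | braid_braid n m => exact P.braid_braid _ _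
  | hexagon n m p =>
    simp only [Term.interp, Term.interp_eqHom]
    exact P.hexagon _ _ _

/-- The morphism out of a presented prop given by a model. -/
def SMTheory.lift {T : SMTheory.{w}} {P : PROP.{w}} (g : ∀ {n m}, T.sig n m → P.Hom n m)
    (hg : ∀ {n m} {s t : Term T.sig n m}, T.eqn s t → s.interp @g = t.interp @g) :
    T.prop ⟶ P where
  map := Quotient.lift (Term.interp @g) fun _ _ h => h.interp_eq @g @hg
  map_id _ := rfl
  map_comp := by rintro _ _ _ ⟨f⟩ ⟨g⟩; rfl
  map_tensor := by rintro _ _ _ _ ⟨f⟩ ⟨g⟩; rfl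
  map_braid _ _ := rfl

/-! ### The morphism to the prop of corelations -/

namespace Corelation

theorem colors_top {X Y : Type*} (u : X → Prop) (v : Y → Prop) :
    (⊤ : Corelation X Y).Colors u v ↔ ∃ q, (∀ x, u x ↔ q) ∧ ∀ y, v y ↔ q := by
  constructor
  · intro h
    by_cases hq : ∃ a, Sum.elim u v a
    · obtain ⟨a, ha⟩ := hq
      exact ⟨True, fun x => iff_true_intro ((h a (Sum.inl x) trivial).1 ha),
        fun y => iff_true_intro ((h a (Sum.inr y) trivial).1 ha)⟩
    · exact ⟨False, fun x => iff_false_intro fun hx => hq ⟨Sum.inl x, hx⟩,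
        fun y => iff_false_intro fun hy => hq ⟨Sum.inr y, hy⟩⟩
  · rintro ⟨q, hu, hv⟩ (a | a) (b | b) - <;> simp [hu, hv]

end Corelation

namespace ESCFMGen

open Corelation

/-- The interpretation of terms as corelations: each generator is sent to the corelation with
exactly one block. -/
abbrev eval {n m : ℕ} (t : Term ESCFMGen n m) : Corelation (Fin n) (Fin m) :=
  Term.interp (P := corelData) (fun {_ _} _ => (⊤ : Corelation _ _)) t

theorem eval_eqHom {n m : ℕ} (h : n = m) :
    eval ((Term.data ESCFMGen).eqHom h) = ofEquiv (finCongr h) :=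
  (Term.interp_eqHom _ h).trans (corelData_eqHom h)

theorem colors_eval_comp {n m p : ℕ} (s : Term ESCFMGen n m) (t : Term ESCFMGen m p)
    (u : Fin n → Prop) (v : Fin p → Prop) :
    (eval (s.comp t)).Colors u v ↔ ∃ w, (eval s).Colors u w ∧ (eval t).Colors w v :=
  Corelation.colors_comp _ _ _ _

theorem colors_eval_tensor {n m p q : ℕ} (s : Term ESCFMGen n m) (t : Term ESCFMGen p q)
    (u : Fin (n + p) → Prop) (v : Fin (m + q) → Prop) :
    (eval (s.tensor t)).Colors u v ↔
      (eval s).Colors (fun i => u (Fin.castAdd p i)) (fun i => v (Fin.castAdd q i)) ∧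
        (eval t).Colors (fun i => u (Fin.natAdd n i)) (fun i => v (Fin.natAdd m i)) :=
  colors_finTensor _ _ _ _

theorem colors_eval_id (n : ℕ) (u v : Fin n → Prop) :
    (eval (Term.id n)).Colors u v ↔ u = v :=
  Corelation.colors_id _ _

theorem colors_eval_gen {n m : ℕ} (σ : ESCFMGen n m) (u : Fin n → Prop) (v : Fin m → Prop) :
    (eval (Term.gen σ)).Colors u v ↔ ∃ q, (∀ x, u x ↔ q) ∧ ∀ y, v y ↔ q :=
  colors_top _ _

theorem colors_eval_braid (u v : Fin 2 → Prop) :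
    (eval (Term.braid 1 1)).Colors u v ↔ v 1 = u 0 ∧ v 0 = u 1 := by
  refine (colors_ofEquiv _ _ _).trans (funext_iff.trans (Fin.forall_fin_two.trans ?_))
  rw [eq_comm, eq_comm (a := u 1)]
  rfl

theorem eval_eq_top_of_eqn {n m : ℕ} {s t : Term ESCFMGen n m} (h : Eqn s t) :
    eval s = ⊤ ∧ eval t = ⊤ := by
  have cons_two {a : Prop} {w : Fin 2 → Prop} : Fin.cons (α := fun _ => Prop) a w 2 = w 1 := rfl
  refine ⟨ext_colors fun u v => ?_, ext_colors fun u v => ?_⟩ <;> cases h <;>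
  simp only [colors_eval_comp, @colors_eval_tensor 2 1 1 1, @colors_eval_tensor 1 1 2 1,
    @colors_eval_tensor 0 1 1 1, @colors_eval_tensor 1 2 1 1, @colors_eval_tensor 1 1 1 2,
    @colors_eval_tensor 1 0 1 1, colors_eval_id, colors_eval_gen, colors_eval_braid, colors_top,
    funext_iff, eq_iff_iff, Fin.exists_fin_succ_pi, Fin.exists_fin_zero_pi, Fin.forall_fin_succ,
    IsEmpty.forall_iff, Prop.exists_iff, Nat.reduceAdd, Fin.isValue, Fin.reduceCastAdd,
    Fin.reduceNatAdd, Fin.natAdd_eq_addNat, Fin.addNat_one, Fin.natAdd_zero, Fin.cast_eq_self,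
    Fin.succ_zero_eq_one, Fin.succ_one_eq_two, Fin.cons_zero, Fin.cons_one, cons_two] <;>
  grind

theorem eval_eq_of_eqn {n m : ℕ} {s t : Term ESCFMGen n m} (h : Eqn s t) : eval s = eval t :=
  (eval_eq_top_of_eqn h).1.trans (eval_eq_top_of_eqn h).2.symm

/-! ### Every corelation is the interpretation of a term -/

theorem exists_eval_local (t : Term ESCFMGen 2 2) {n i : ℕ} (hi : i + 1 < n) :
    ∃ t' : Term ESCFMGen n n, ∀ u v, (eval t').Colors u v ↔
      (∀ k : Fin n, k.val ≠ i → k.val ≠ i + 1 → u k = v k) ∧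
        (eval t).Colors ![u ⟨i, by omega⟩, u ⟨i + 1, hi⟩] ![v ⟨i, by omega⟩, v ⟨i + 1, hi⟩] := by
  obtain ⟨c, rfl⟩ : ∃ c, n = i + 2 + c := ⟨n - (i + 2), by omega⟩
  refine ⟨((Term.id i).tensor t).tensor (Term.id c), fun u v => ?_⟩
  have middle_eq (w : Fin (i + 2 + c) → Prop) : (fun k => w (Fin.castAdd c (Fin.natAdd i k))) =
      ![w ⟨i, by omega⟩, w ⟨i + 1, hi⟩] := by
    funext k
    fin_cases k <;> rfl
  simp only [colors_eval_tensor, colors_eval_id, middle_eq, funext_iff]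
  constructor
  · rintro ⟨⟨hleft, hmiddle⟩, hright⟩
    refine ⟨fun k => ?_, hmiddle⟩
    induction k using Fin.addCases with
    | left k =>
      induction k using Fin.addCases with
      | left k => exact fun _ _ => hleft k
      | right k => intro h h'; fin_cases k <;> simp at h h'
    | right k => exact fun _ _ => hright k
  · rintro ⟨houter, hmiddle⟩
    exact ⟨⟨fun k => houter _ (by simp; omega) (by simp; omega), hmiddle⟩,
      fun k => houter _ (by simp; omega) (by simp; omega)⟩

theorem exists_eval_swap {n i : ℕ} (hi : i + 1 < n) :
    ∃ t : Term ESCFMGen n n, eval t = ofEquiv (Equiv.swap ⟨i, by omega⟩ ⟨i + 1, hi⟩) := by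
  obtain ⟨t, ht⟩ := exists_eval_local (Term.braid 1 1) hi
  refine ⟨t, ext_colors fun u v => ?_⟩
  rw [ht, colors_eval_braid, colors_ofEquiv, funext_iff]
  constructor
  · rintro ⟨houter, hfst, hsnd⟩ k
    rw [Function.comp_apply, Equiv.swap_apply_def]
    split_ifs with hk hk'
    · exact hk ▸ hfst.symm
    · exact hk' ▸ hsnd.symm
    · exact houter k (fun h => hk (Fin.ext h)) fun h => hk' (Fin.ext h)
  · intro h
    refine ⟨fun k hk hk' => ?_, ?_, ?_⟩
    · rw [h, Function.comp_apply, Equiv.swap_apply_of_ne_of_ne (fun e => hk (congrArg Fin.val e))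
        fun e => hk' (congrArg Fin.val e)]
    · simp [h]
    · simp [h]

theorem colors_eval_mul_comul (u v : Fin 2 → Prop) :
    (eval (μ.comp δ)).Colors u v ↔ u = v ∧ u 0 = u 1 := by
  simp only [colors_eval_comp, colors_eval_gen, funext_iff, eq_iff_iff, Fin.forall_fin_two]
  constructor
  · rintro ⟨w, ⟨q, hu, hw⟩, q', hw', hv⟩
    have hq : q ↔ q' := (hw 0).symm.trans (hw' 0)
    exact ⟨⟨(hu.1.trans hq).trans hv.1.symm, (hu.2.trans hq).trans hv.2.symm⟩,
      hu.1.trans hu.2.symm⟩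
  · rintro ⟨h, h'⟩
    exact ⟨fun _ => u 0, ⟨u 0, ⟨Iff.rfl, h'.symm⟩, fun _ => Iff.rfl⟩, u 0, fun _ => Iff.rfl,
      h.1.symm, h.2.symm.trans h'.symm⟩

theorem exists_eval_merge_of_lt {n i j : ℕ} (hij : i < j) (hj : j < n) :
    ∃ t : Term ESCFMGen n n, ∀ u v, (eval t).Colors u v ↔
      u = v ∧ u ⟨i, by omega⟩ = u ⟨j, hj⟩ := by
  induction j, hij using Nat.le_induction with
  | base =>
    obtain ⟨t, ht⟩ := exists_eval_local (μ.comp δ) hj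
    refine ⟨t, fun u v => ?_⟩
    rw [ht, colors_eval_mul_comul, ← and_assoc]
    refine and_congr_left' ⟨fun ⟨houter, hmiddle⟩ => funext fun k => ?_, fun h => by simp [h]⟩
    by_cases hk : k.val = i
    · exact (Fin.eq_mk_iff_val_eq.2 hk) ▸ congrFun hmiddle 0
    by_cases hk' : k.val = i + 1
    · exact (Fin.eq_mk_iff_val_eq.2 hk') ▸ congrFun hmiddle 1
    exact houter k hk hk'
  | succ j hij ih =>
    obtain ⟨t, ht⟩ := ih (by omega)
    obtain ⟨s, hs⟩ := exists_eval_swap hj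
    refine ⟨s.comp (t.comp s), fun u v => ?_⟩
    change (Corelation.comp (eval s) (Corelation.comp (eval t) (eval s))).Colors u v ↔ _
    rw [hs, colors_ofEquiv_comp, colors_comp_ofEquiv, ht, Equiv.symm_swap]
    refine and_congr ((Equiv.surjective _).injective_comp_right.eq_iff) ?_
    rw [Function.comp_apply, Function.comp_apply, Equiv.swap_apply_left,
      Equiv.swap_apply_of_ne_of_ne]
    · simp; omega
    · simp; omega

theorem exists_eval_merge {n : ℕ} (a b : Fin n) :
    ∃ t : Term ESCFMGen n n, ∀ u v, (eval t).Colors u v ↔ u = v ∧ u a = u b := by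
  rcases lt_trichotomy a b with h | rfl | h
  · exact exists_eval_merge_of_lt h b.2
  · exact ⟨Term.id n, fun u v => (colors_eval_id _ _ _).trans (and_iff_left rfl).symm⟩
  · obtain ⟨t, ht⟩ := exists_eval_merge_of_lt h a.2
    exact ⟨t, fun u v => (ht u v).trans (and_congr_right' eq_comm)⟩

theorem exists_eval_merge_set {n : ℕ} (s : Set (Fin n × Fin n)) :
    ∃ t : Term ESCFMGen n n, ∀ u v, (eval t).Colors u v ↔ u = v ∧ ∀ p ∈ s, u p.1 = u p.2 := by
  induction s, s.toFinite using Set.Finite.induction_on with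
  | empty => exact ⟨Term.id n, fun u v => (colors_eval_id _ _ _).trans (by simp)⟩
  | @insert p s _ _ ih =>
    obtain ⟨t, ht⟩ := ih
    obtain ⟨t', ht'⟩ := exists_eval_merge p.1 p.2
    refine ⟨t'.comp t, fun u v => ?_⟩
    simp only [colors_eval_comp, ht, ht', Set.forall_mem_insert]
    constructor
    · rintro ⟨_, ⟨rfl, h⟩, rfl, h'⟩
      exact ⟨rfl, h, h'⟩
    · rintro ⟨rfl, h, h'⟩
      exact ⟨_, ⟨rfl, h⟩, rfl, h'⟩

theorem exists_eval_discard (n : ℕ) :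
    ∃ t : Term ESCFMGen n 0, ∀ u v, (eval t).Colors u v := by
  induction n with
  | zero => exact ⟨Term.id 0, fun u v => (colors_eval_id 0 u v).2 (Subsingleton.elim u v)⟩
  | succ n ih =>
    obtain ⟨t, ht⟩ := ih
    refine ⟨t.tensor ε, fun u v => (colors_eval_tensor t ε u v).2 ⟨ht _ _, ?_⟩⟩
    exact (colors_eval_gen _ _ _).2 ⟨u (Fin.natAdd n 0), fun x => by rw [Subsingleton.elim x 0],
      fun y => y.elim0⟩

theorem exists_eval_create (n : ℕ) :
    ∃ t : Term ESCFMGen 0 n, ∀ u v, (eval t).Colors u v := by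
  induction n with
  | zero => exact ⟨Term.id 0, fun u v => (colors_eval_id 0 u v).2 (Subsingleton.elim u v)⟩
  | succ n ih =>
    obtain ⟨t, ht⟩ := ih
    refine ⟨t.tensor η, fun u v => (colors_eval_tensor t η u v).2 ⟨ht _ _, ?_⟩⟩
    exact (colors_eval_gen _ _ _).2 ⟨v (Fin.natAdd n 0), fun y => y.elim0,
      fun x => by rw [Subsingleton.elim x 0]⟩

theorem exists_eval_append (n m : ℕ) : ∃ t : Term ESCFMGen n (n + m),
    ∀ u w, (eval t).Colors u w ↔ u = fun i => w (Fin.castAdd m i) := by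
  obtain ⟨c, hc⟩ := exists_eval_create m
  exact ⟨(Term.id n).tensor c, fun u w => (colors_eval_tensor _ _ _ _).trans
    ((and_iff_left (hc _ _)).trans (colors_eval_id _ _ _))⟩

theorem exists_eval_dropLeft (n m : ℕ) : ∃ t : Term ESCFMGen (n + m) m,
    ∀ w v, (eval t).Colors w v ↔ (fun i => w (Fin.natAdd n i)) = v := by
  obtain ⟨d, hd⟩ := exists_eval_discard n
  refine ⟨(d.tensor (Term.id m)).comp ((Term.data ESCFMGen).eqHom (Nat.zero_add m)),
    fun w v => ?_⟩
  change (Corelation.comp (eval (d.tensor (Term.id m))) (eval _)).Colors w v ↔ _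
  have natAdd_zero (i : Fin m) : finCongr (Nat.zero_add m) (Fin.natAdd 0 i) = i := by ext; simp
  rw [eval_eqHom]
  refine (colors_comp_ofEquiv (finCongr (Nat.zero_add m)) _ w v).trans
    ((colors_eval_tensor _ _ _ _).trans ((and_iff_right (hd _ _)).trans ?_))
  simp only [colors_eval_id, Function.comp_apply, natAdd_zero]

theorem eval_surjective {n m : ℕ} :
    Function.Surjective (eval : Term ESCFMGen n m → Corelation (Fin n) (Fin m)) := by
  intro α
  obtain ⟨s, hs⟩ := exists_eval_append n m
  obtain ⟨t, ht⟩ := exists_eval_merge_set {p : Fin (n + m) × Fin (n + m) |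
    α (finSumFinEquiv.symm p.1) (finSumFinEquiv.symm p.2)}
  obtain ⟨r, hr⟩ := exists_eval_dropLeft n m
  have sumElim_restrict (w : Fin (n + m) → Prop) (x : Fin n ⊕ Fin m) :
      Sum.elim (fun i => w (Fin.castAdd m i)) (fun i => w (Fin.natAdd n i)) x =
        w (finSumFinEquiv x) := by
    cases x <;> rfl
  refine ⟨s.comp (t.comp r), ext_colors fun u v => ?_⟩
  simp only [colors_eval_comp, hs, ht, hr]
  constructor
  · rintro ⟨w, rfl, _, ⟨rfl, hw⟩, rfl⟩ a b hab
    rw [sumElim_restrict, sumElim_restrict]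
    exact iff_of_eq (hw (finSumFinEquiv a, finSumFinEquiv b) (by simpa using hab))
  · intro h
    obtain ⟨w, rfl, rfl⟩ : ∃ w : Fin (n + m) → Prop,
        u = (fun i => w (Fin.castAdd m i)) ∧ (fun i => w (Fin.natAdd n i)) = v :=
      ⟨Fin.append u v, by simp, by simp⟩
    refine ⟨w, rfl, w, ⟨rfl, fun p hp => propext ?_⟩, rfl⟩
    simpa only [sumElim_restrict, Equiv.apply_symm_apply] using h _ _ hp

end ESCFMGen

/-- The morphism of props that interprets terms as corelations. -/
def evalESCFM : ThESCFM ⟶ corelPROP :=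
  SMTheory.lift (T := theoryESCFM) (P := corelPROP) (fun {_ _} _ => (⊤ : Corelation _ _))
    ESCFMGen.eval_eq_of_eqn

theorem evalESCFM_surjective {n m : ℕ} :
    Function.Surjective (PROP.Morphism.map evalESCFM (n := n) (m := m)) := by
  intro α
  obtain ⟨t, ht⟩ := ESCFMGen.eval_surjective α
  exact ⟨Quotient.mk _ t, ht⟩

section

open scoped MonObj ComonObj

/-! ### Images of extraspecial commutative Frobenius monoids under symmetric monoidal functors -/

section

open Functor

variable {C : Type u} [Category.{v} C] [MonoidalCategory C]
variable {D : Type*} [Category* D] [MonoidalCategory D]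

theorem map_frobenius_left (F : D ⥤ C) [F.Monoidal] {X : D} (d : X ⟶ X ⊗ X) (m : X ⊗ X ⟶ X) :
    (F.map d ≫ OplaxMonoidal.δ F X X) ▷ F.obj X ≫ (α_ _ _ _).hom ≫
        F.obj X ◁ (LaxMonoidal.μ F X X ≫ F.map m) =
      LaxMonoidal.μ F X X ≫ F.map (d ▷ X ≫ (α_ _ _ _).hom ≫ X ◁ m) ≫ OplaxMonoidal.δ F X X := by
  simp only [Functor.map_comp, Monoidal.map_associator, Monoidal.map_whiskerLeft,
    Monoidal.map_whiskerRight, comp_whiskerRight, MonoidalCategory.whiskerLeft_comp,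
    Category.assoc, Monoidal.μ_δ_assoc, Monoidal.μ_δ, Category.comp_id]

theorem map_frobenius_right (F : D ⥤ C) [F.Monoidal] {X : D} (d : X ⟶ X ⊗ X) (m : X ⊗ X ⟶ X) :
    F.obj X ◁ (F.map d ≫ OplaxMonoidal.δ F X X) ≫ (α_ _ _ _).inv ≫
        (LaxMonoidal.μ F X X ≫ F.map m) ▷ F.obj X =
      LaxMonoidal.μ F X X ≫ F.map (X ◁ d ≫ (α_ _ _ _).inv ≫ m ▷ X) ≫ OplaxMonoidal.δ F X X := by
  simp only [Functor.map_comp, Monoidal.map_associator_inv, Monoidal.map_whiskerLeft,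
    Monoidal.map_whiskerRight, comp_whiskerRight, MonoidalCategory.whiskerLeft_comp,
    Category.assoc, Monoidal.μ_δ_assoc, Monoidal.μ_δ, Category.comp_id]

theorem app_tensor_comp_δ {F G : D ⥤ C} [F.Monoidal] [G.Monoidal] (θ : F ⟶ G)
    [NatTrans.IsMonoidal θ] (X Y : D) :
    θ.app (X ⊗ Y) ≫ OplaxMonoidal.δ G X Y = OplaxMonoidal.δ F X Y ≫ (θ.app X ⊗ₘ θ.app Y) := by
  rw [← cancel_epi (LaxMonoidal.μ F X Y), NatTrans.IsMonoidal.tensor_assoc]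
  simp

theorem app_unit_comp_η {F G : D ⥤ C} [F.Monoidal] [G.Monoidal] (θ : F ⟶ G)
    [NatTrans.IsMonoidal θ] : θ.app (𝟙_ D) ≫ OplaxMonoidal.η G = OplaxMonoidal.η F := by
  rw [← cancel_epi (LaxMonoidal.ε F), NatTrans.IsMonoidal.unit_assoc]
  simp

variable [SymmetricCategory C] [SymmetricCategory D]

namespace ESCFM

/-- The image of an extraspecial commutative Frobenius monoid under a symmetric monoidal
functor. -/
def mapFunctor (F : D ⥤ C) [F.Braided] (A : ESCFM D) : ESCFM C where
  X := F.obj A.X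
  mon := Functor.monObjObj (F := F) A.X
  comon := Functor.obj.instComonObj A.X F
  comm := by
    let := Functor.monObjObj (F := F) A.X
    exact Functor.isCommMonObj_obj
  cocomm := by
    let := Functor.obj.instComonObj A.X F
    refine ⟨?_⟩
    change (F.map Δ[A.X] ≫ OplaxMonoidal.δ F A.X A.X) ≫ (β_ _ _).hom =
      F.map Δ[A.X] ≫ OplaxMonoidal.δ F A.X A.X
    conv_rhs => rw [← IsCommComonObj.comul_comm A.X, Functor.map_comp, Functor.map_braiding]
    simp
  frobenius_left := by
    refine (map_frobenius_left F _ _).trans ?_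
    rw [A.frobenius_left, Functor.map_comp, Category.assoc, ← Category.assoc]
    rfl
  frobenius_right := by
    refine (map_frobenius_right F _ _).trans ?_
    rw [A.frobenius_right, Functor.map_comp, Category.assoc, ← Category.assoc]
    rfl
  special := by
    change (F.map Δ[A.X] ≫ OplaxMonoidal.δ F A.X A.X) ≫
      (LaxMonoidal.μ F A.X A.X ≫ F.map μ[A.X]) = _
    simp [← Functor.map_comp, A.special]
  extra := by
    change (LaxMonoidal.ε F ≫ F.map η[A.X]) ≫ (F.map ε[A.X] ≫ OplaxMonoidal.η F) = _
    simp [← Functor.map_comp_assoc, A.extra]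

/-- The component of a monoidal natural transformation at an extraspecial commutative Frobenius
monoid. -/
def mapNatTrans (A : ESCFM D) {F G : D ⥤ C} [F.Braided] [G.Braided] (θ : F ⟶ G)
    [NatTrans.IsMonoidal θ] : A.mapFunctor F ⟶ A.mapFunctor G where
  hom := θ.app A.X
  isMonHom :=
    { one_hom := by
        change (LaxMonoidal.ε F ≫ F.map η[A.X]) ≫ θ.app A.X = LaxMonoidal.ε G ≫ G.map η[A.X]
        rw [Category.assoc, θ.naturality, NatTrans.IsMonoidal.unit_assoc]
      mul_hom := by
        change (LaxMonoidal.μ F A.X A.X ≫ F.map μ[A.X]) ≫ θ.app A.X =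
          (θ.app A.X ⊗ₘ θ.app A.X) ≫ LaxMonoidal.μ G A.X A.X ≫ G.map μ[A.X]
        rw [Category.assoc, θ.naturality, NatTrans.IsMonoidal.tensor_assoc] }
  isComonHom :=
    { hom_counit := by
        change θ.app A.X ≫ G.map ε[A.X] ≫ OplaxMonoidal.η G = F.map ε[A.X] ≫ OplaxMonoidal.η F
        rw [← θ.naturality_assoc, app_unit_comp_η]
      hom_comul := by
        change θ.app A.X ≫ G.map Δ[A.X] ≫ OplaxMonoidal.δ G A.X A.X =
          (F.map Δ[A.X] ≫ OplaxMonoidal.δ F A.X A.X) ≫ (θ.app A.X ⊗ₘ θ.app A.X)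
        rw [← θ.naturality_assoc, app_tensor_comp_δ, Category.assoc] }

/-- Evaluation of symmetric monoidal functors at an extraspecial commutative Frobenius monoid. -/
def evaluation (A : ESCFM D) : SymMonFunctor D C ⥤ ESCFM C where
  obj F := A.mapFunctor F.functor
  map θ := by
    have := θ.isMonoidal
    exact A.mapNatTrans θ.hom

end ESCFM

end

/-! ### The generic extraspecial commutative Frobenius monoid -/

/-- An extraspecial commutative Frobenius monoid from operations on an object. -/
def ESCFM.ofOperations {C : Type u} [Category.{v} C] [MonoidalCategory C] [SymmetricCategory C]
    {X : C} (m : X ⊗ X ⟶ X) (e : 𝟙_ C ⟶ X) (d : X ⟶ X ⊗ X) (c : X ⟶ 𝟙_ C)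
    (mul_assoc : m ▷ X ≫ m = (α_ X X X).hom ≫ X ◁ m ≫ m)
    (unit_mul : e ▷ X ≫ m = (λ_ X).hom)
    (mul_comm : (β_ X X).hom ≫ m = m)
    (comul_assoc : d ≫ X ◁ d = d ≫ d ▷ X ≫ (α_ X X X).hom)
    (counit_comul : d ≫ c ▷ X = (λ_ X).inv)
    (comul_comm : d ≫ (β_ X X).hom = d)
    (frobenius_left : d ▷ X ≫ (α_ X X X).hom ≫ X ◁ m = m ≫ d)
    (frobenius_right : X ◁ d ≫ (α_ X X X).inv ≫ m ▷ X = m ≫ d)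
    (special : d ≫ m = 𝟙 X) (extra : e ≫ c = 𝟙 (𝟙_ C)) : ESCFM C where
  X := X
  mon :=
    { mul := m
      one := e
      one_mul := unit_mul
      mul_one := by
        rw [← mul_comm, BraidedCategory.braiding_naturality_right_assoc, unit_mul,
          braiding_leftUnitor]
      mul_assoc := mul_assoc }
  comon :=
    { comul := d
      counit := c
      counit_comul := counit_comul
      comul_counit := by
        rw [← comul_comm, Category.assoc, ← BraidedCategory.braiding_naturality_left,
          reassoc_of% counit_comul, leftUnitor_inv_braiding]
      comul_assoc := comul_assoc }
  comm := @IsCommMonObj.mk _ _ _ _ _ (_) mul_comm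
  cocomm := @IsCommComonObj.mk _ _ _ _ _ (_) comul_comm
  frobenius_left := frobenius_left
  frobenius_right := frobenius_right
  special := special
  extra := extra

/-- The morphism represented by a term. -/
abbrev SMTheory.ofTerm {T : SMTheory.{w}} {n m : ℕ} (t : Term T.sig n m) :
    (⟨n⟩ : T.prop.Obj) ⟶ ⟨m⟩ :=
  (Quotient.mk (T.setoid n m) t : T.prop.Hom n m)

theorem SMTheory.ofTerm_eq_of_eqn {T : SMTheory.{w}} {n m : ℕ} {s t : Term T.sig n m}
    (h : T.eqn s t) : ofTerm s = ofTerm t :=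
  Quotient.sound (Provable.eqn h)

namespace ThESCFM

open SMTheory in
/-- The generic extraspecial commutative Frobenius monoid. -/
def generic : ESCFM ThESCFM.Obj :=
  ESCFM.ofOperations (X := ⟨1⟩) (theoryESCFM.gen ESCFMGen.mul) (theoryESCFM.gen ESCFMGen.unit)
    (theoryESCFM.gen ESCFMGen.comul) (theoryESCFM.gen ESCFMGen.counit)
    ((ofTerm_eq_of_eqn ESCFMGen.Eqn.mul_assoc).trans (ThESCFM.id_comp _).symm)
    (ofTerm_eq_of_eqn ESCFMGen.Eqn.unit_mul)
    (ofTerm_eq_of_eqn ESCFMGen.Eqn.mul_comm)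
    ((ofTerm_eq_of_eqn ESCFMGen.Eqn.comul_assoc).symm.trans
      (congrArg (ThESCFM.comp (theoryESCFM.gen ESCFMGen.comul)) (ThESCFM.comp_id
        (ThESCFM.tensor (theoryESCFM.gen ESCFMGen.comul) (ThESCFM.id 1))).symm))
    (ofTerm_eq_of_eqn ESCFMGen.Eqn.counit_comul)
    (ofTerm_eq_of_eqn ESCFMGen.Eqn.comul_comm)
    ((congrArg (ThESCFM.comp _) (ThESCFM.id_comp _)).trans
      (ofTerm_eq_of_eqn ESCFMGen.Eqn.frobenius_left))
    ((congrArg (ThESCFM.comp _) (ThESCFM.id_comp _)).trans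
      (ofTerm_eq_of_eqn ESCFMGen.Eqn.frobenius_right))
    (ofTerm_eq_of_eqn ESCFMGen.Eqn.special)
    (ofTerm_eq_of_eqn ESCFMGen.Eqn.extra)

end ThESCFM

/-! ### Functors out of a prop are determined by the value at one -/

namespace PROP

section

open Functor

variable {C : Type u} [Category.{v} C] [MonoidalCategory C]
variable {P : PROP.{w}} {F G : P.Obj ⥤ C}

theorem whiskerLeft_ε_comp_μ (F : P.Obj ⥤ C) [F.LaxMonoidal] (n : ℕ) :
    F.obj ⟨n⟩ ◁ LaxMonoidal.ε F ≫ LaxMonoidal.μ F ⟨n⟩ ⟨0⟩ = (ρ_ (F.obj ⟨n⟩)).hom := by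
  have map_rightUnitor : F.map (ρ_ (⟨n⟩ : P.Obj)).hom = 𝟙 (F.obj ⟨n⟩) := F.map_id ⟨n⟩
  rw [LaxMonoidal.right_unitality F ⟨n⟩, map_rightUnitor]
  exact congrArg (CategoryStruct.comp _) (Category.comp_id _).symm

theorem ε_whiskerRight_comp_μ_one (F : P.Obj ⥤ C) [F.LaxMonoidal] :
    LaxMonoidal.ε F ▷ F.obj ⟨1⟩ ≫ LaxMonoidal.μ F ⟨0⟩ ⟨1⟩ = (λ_ (F.obj ⟨1⟩)).hom := by
  have map_leftUnitor : F.map (λ_ (⟨1⟩ : P.Obj)).hom = 𝟙 (F.obj ⟨1⟩) := F.map_id ⟨1⟩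
  rw [LaxMonoidal.left_unitality F ⟨1⟩, map_leftUnitor]
  exact congrArg (CategoryStruct.comp _) (Category.comp_id _).symm

theorem whiskerLeft_μ_comp_μ_one (F : P.Obj ⥤ C) [F.LaxMonoidal] (n m : ℕ) :
    F.obj ⟨n⟩ ◁ LaxMonoidal.μ F ⟨m⟩ ⟨1⟩ ≫ LaxMonoidal.μ F ⟨n⟩ ⟨m + 1⟩ =
      (α_ _ _ _).inv ≫ LaxMonoidal.μ F ⟨n⟩ ⟨m⟩ ▷ F.obj ⟨1⟩ ≫ LaxMonoidal.μ F ⟨n + m⟩ ⟨1⟩ := by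
  have map_associator_inv : F.map (α_ (⟨n⟩ : P.Obj) ⟨m⟩ ⟨1⟩).inv = 𝟙 (F.obj ⟨n + m + 1⟩) :=
    F.map_id _
  refine Eq.trans ?_ (LaxMonoidal.associativity_inv F ⟨n⟩ ⟨m⟩ ⟨1⟩)
  rw [map_associator_inv]
  exact congrArg (CategoryStruct.comp _) (Category.comp_id _).symm

variable [F.Monoidal] [G.Monoidal]

theorem natTrans_ext {θ θ' : F ⟶ G} [NatTrans.IsMonoidal θ] [NatTrans.IsMonoidal θ']
    (h : θ.app ⟨1⟩ = θ'.app ⟨1⟩) : θ = θ' := by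
  ext ⟨n⟩
  induction n with
  | zero =>
    have e := (NatTrans.IsMonoidal.unit (τ := θ)).trans (NatTrans.IsMonoidal.unit (τ := θ')).symm
    exact (cancel_epi _).1 e
  | succ n ih =>
    have e := NatTrans.IsMonoidal.tensor (τ := θ) ⟨n⟩ ⟨1⟩
    rw [ih, h, ← NatTrans.IsMonoidal.tensor (τ := θ') ⟨n⟩ ⟨1⟩] at e
    exact (cancel_epi _).1 e

/-- The component at `n` of the monoidal natural transformation extending a morphism `f` between
the values at `1`. -/
def extendApp (f : F.obj ⟨1⟩ ⟶ G.obj ⟨1⟩) : ∀ n : ℕ, F.obj ⟨n⟩ ⟶ G.obj ⟨n⟩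
  | 0 => OplaxMonoidal.η F ≫ LaxMonoidal.ε G
  | n + 1 => OplaxMonoidal.δ F ⟨n⟩ ⟨1⟩ ≫ (extendApp f n ⊗ₘ f) ≫ LaxMonoidal.μ G ⟨n⟩ ⟨1⟩

variable (f : F.obj ⟨1⟩ ⟶ G.obj ⟨1⟩)

theorem extendApp_zero : LaxMonoidal.ε F ≫ extendApp f 0 = LaxMonoidal.ε G :=
  Monoidal.ε_η_assoc F _

theorem extendApp_succ (n : ℕ) : LaxMonoidal.μ F ⟨n⟩ ⟨1⟩ ≫ extendApp f (n + 1) =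
    (extendApp f n ⊗ₘ f) ≫ LaxMonoidal.μ G ⟨n⟩ ⟨1⟩ :=
  Monoidal.μ_δ_assoc F _ _ _

theorem extendApp_tensor (n m : ℕ) : LaxMonoidal.μ F ⟨n⟩ ⟨m⟩ ≫ extendApp f (n + m) =
    (extendApp f n ⊗ₘ extendApp f m) ≫ LaxMonoidal.μ G ⟨n⟩ ⟨m⟩ := by
  induction m with
  | zero =>
    have key : F.obj ⟨n⟩ ◁ LaxMonoidal.ε F ≫ LaxMonoidal.μ F ⟨n⟩ ⟨0⟩ ≫ extendApp f n =
        F.obj ⟨n⟩ ◁ LaxMonoidal.ε F ≫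
          (extendApp f n ⊗ₘ extendApp f 0) ≫ LaxMonoidal.μ G ⟨n⟩ ⟨0⟩ := by
      rw [reassoc_of% whiskerLeft_ε_comp_μ F n, MonoidalCategory.tensorHom_def', Category.assoc,
        ← MonoidalCategory.whiskerLeft_comp_assoc, extendApp_zero, whisker_exchange_assoc,
        whiskerLeft_ε_comp_μ]
      exact (MonoidalCategory.rightUnitor_naturality _).symm
    exact (cancel_epi _).1 key
  | succ m ih =>
    have key : F.obj ⟨n⟩ ◁ LaxMonoidal.μ F ⟨m⟩ ⟨1⟩ ≫ LaxMonoidal.μ F ⟨n⟩ ⟨m + 1⟩ ≫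
        extendApp f (n + m + 1) = F.obj ⟨n⟩ ◁ LaxMonoidal.μ F ⟨m⟩ ⟨1⟩ ≫
          (extendApp f n ⊗ₘ extendApp f (m + 1)) ≫ LaxMonoidal.μ G ⟨n⟩ ⟨m + 1⟩ := by
      rw [reassoc_of% whiskerLeft_μ_comp_μ_one F n m]
      refine (congrArg (fun g => _ ≫ _ ≫ g) (extendApp_succ f (n + m))).trans ?_
      rw [← id_tensorHom, tensorHom_comp_tensorHom_assoc, extendApp_succ, Category.id_comp,
        ← tensorHom_id, tensorHom_comp_tensorHom_assoc, ih, Category.id_comp,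
        ← Category.comp_id (extendApp f n), ← tensorHom_comp_tensorHom_assoc, id_tensorHom,
        whiskerLeft_μ_comp_μ_one G n m, associator_inv_naturality_assoc, Category.comp_id]
      refine congrArg (CategoryStruct.comp _) ?_
      rw [← tensorHom_id, tensorHom_comp_tensorHom_assoc, Category.comp_id]
    exact (cancel_epi _).1 key

theorem extendApp_zero_comp_η : extendApp f 0 ≫ OplaxMonoidal.η G = OplaxMonoidal.η F := by
  rw [← cancel_epi (LaxMonoidal.ε F), reassoc_of% extendApp_zero f, Monoidal.ε_η, Monoidal.ε_η]

theorem extendApp_tensor_comp_δ (n m : ℕ) :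
    extendApp f (n + m) ≫ OplaxMonoidal.δ G ⟨n⟩ ⟨m⟩ =
      OplaxMonoidal.δ F ⟨n⟩ ⟨m⟩ ≫ (extendApp f n ⊗ₘ extendApp f m) := by
  refine (cancel_epi (LaxMonoidal.μ F ⟨n⟩ ⟨m⟩)).1 ?_
  rw [Monoidal.μ_δ_assoc, ← Category.assoc]
  refine (congrArg (· ≫ _) (extendApp_tensor f n m)).trans ?_
  rw [Category.assoc, Monoidal.μ_δ, Category.comp_id]

theorem extendApp_one : extendApp f 1 = f := by
  have key : LaxMonoidal.ε F ▷ F.obj ⟨1⟩ ≫ LaxMonoidal.μ F ⟨0⟩ ⟨1⟩ ≫ extendApp f (0 + 1) =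
      LaxMonoidal.ε F ▷ F.obj ⟨1⟩ ≫ LaxMonoidal.μ F ⟨0⟩ ⟨1⟩ ≫ f := by
    rw [extendApp_succ, reassoc_of% ε_whiskerRight_comp_μ_one F, MonoidalCategory.tensorHom_def,
      Category.assoc, ← MonoidalCategory.comp_whiskerRight_assoc, extendApp_zero,
      ← whisker_exchange_assoc, ε_whiskerRight_comp_μ_one G]
    exact MonoidalCategory.leftUnitor_naturality _
  exact (cancel_epi _).1 ((cancel_epi _).1 key)

theorem extendApp_naturality_mul {m : (⟨1⟩ ⊗ ⟨1⟩ : P.Obj) ⟶ ⟨1⟩}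
    (h : (LaxMonoidal.μ F ⟨1⟩ ⟨1⟩ ≫ F.map m) ≫ f =
      (f ⊗ₘ f) ≫ LaxMonoidal.μ G ⟨1⟩ ⟨1⟩ ≫ G.map m) :
    F.map m ≫ extendApp f 1 = extendApp f (1 + 1) ≫ G.map m := by
  refine (cancel_epi (LaxMonoidal.μ F ⟨1⟩ ⟨1⟩)).1 ?_
  rw [extendApp_one, ← Category.assoc, h, reassoc_of% extendApp_tensor f 1 1, extendApp_one]

theorem extendApp_naturality_one {e : 𝟙_ P.Obj ⟶ ⟨1⟩}
    (h : (LaxMonoidal.ε F ≫ F.map e) ≫ f = LaxMonoidal.ε G ≫ G.map e) :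
    F.map e ≫ extendApp f 1 = extendApp f 0 ≫ G.map e := by
  refine (cancel_epi (LaxMonoidal.ε F)).1 ?_
  rw [extendApp_one, ← Category.assoc, h, reassoc_of% extendApp_zero f]

theorem extendApp_naturality_comul {d : (⟨1⟩ : P.Obj) ⟶ ⟨1⟩ ⊗ ⟨1⟩}
    (h : f ≫ G.map d ≫ OplaxMonoidal.δ G ⟨1⟩ ⟨1⟩ =
      (F.map d ≫ OplaxMonoidal.δ F ⟨1⟩ ⟨1⟩) ≫ (f ⊗ₘ f)) :
    F.map d ≫ extendApp f (1 + 1) = extendApp f 1 ≫ G.map d := by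
  refine (cancel_mono (OplaxMonoidal.δ G ⟨1⟩ ⟨1⟩)).1 ?_
  rw [Category.assoc, Category.assoc, extendApp_tensor_comp_δ, extendApp_one, h, Category.assoc]

theorem extendApp_naturality_counit {c : (⟨1⟩ : P.Obj) ⟶ 𝟙_ P.Obj}
    (h : f ≫ G.map c ≫ OplaxMonoidal.η G = F.map c ≫ OplaxMonoidal.η F) :
    F.map c ≫ extendApp f 0 = extendApp f 1 ≫ G.map c := by
  refine (cancel_mono (OplaxMonoidal.η G)).1 ?_
  rw [Category.assoc, Category.assoc, extendApp_zero_comp_η, extendApp_one, h]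

end

end PROP

namespace SMTheory

open Functor PROP

variable {C : Type u} [Category.{v} C] [MonoidalCategory C] [SymmetricCategory C]
variable {T : SMTheory.{w}} {F G : T.prop.Obj ⥤ C} [F.Braided] [G.Braided]

theorem extendApp_naturality {f : F.obj ⟨1⟩ ⟶ G.obj ⟨1⟩}
    (hgen : ∀ {n m : ℕ} (σ : T.sig n m),
      F.map (ofTerm (Term.gen σ)) ≫ extendApp f m = extendApp f n ≫ G.map (ofTerm (Term.gen σ)))
    {n m : ℕ} (t : Term T.sig n m) :
    F.map (ofTerm t) ≫ extendApp f m = extendApp f n ≫ G.map (ofTerm t) := by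
  induction t with
  | id n =>
    have hF : F.map (ofTerm (Term.id n)) = 𝟙 _ := F.map_id ⟨n⟩
    have hG : G.map (ofTerm (Term.id n)) = 𝟙 _ := G.map_id ⟨n⟩
    rw [hF, hG, Category.id_comp, Category.comp_id]
  | braid n m =>
    have hF : LaxMonoidal.μ F ⟨n⟩ ⟨m⟩ ≫ F.map (ofTerm (Term.braid n m)) =
        (β_ _ _).hom ≫ LaxMonoidal.μ F ⟨m⟩ ⟨n⟩ :=
      LaxBraided.braided (F := F) (⟨n⟩ : T.prop.Obj) ⟨m⟩
    have hG : LaxMonoidal.μ G ⟨n⟩ ⟨m⟩ ≫ G.map (ofTerm (Term.braid n m)) =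
        (β_ _ _).hom ≫ LaxMonoidal.μ G ⟨m⟩ ⟨n⟩ :=
      LaxBraided.braided (F := G) (⟨n⟩ : T.prop.Obj) ⟨m⟩
    rw [← cancel_epi (LaxMonoidal.μ F ⟨n⟩ ⟨m⟩), reassoc_of% hF, extendApp_tensor,
      reassoc_of% extendApp_tensor f n m, hG, BraidedCategory.braiding_naturality_assoc]
  | gen σ => exact hgen σ
  | comp s t hs ht =>
    have hF : F.map (ofTerm (s.comp t)) = F.map (ofTerm s) ≫ F.map (ofTerm t) :=
      F.map_comp (ofTerm s) (ofTerm t)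
    have hG : G.map (ofTerm (s.comp t)) = G.map (ofTerm s) ≫ G.map (ofTerm t) :=
      G.map_comp (ofTerm s) (ofTerm t)
    rw [hF, hG, Category.assoc, ht, reassoc_of% hs]
  | @tensor n m p q s t hs ht =>
    have hF : LaxMonoidal.μ F ⟨n⟩ ⟨p⟩ ≫ F.map (ofTerm (s.tensor t)) =
        (F.map (ofTerm s) ⊗ₘ F.map (ofTerm t)) ≫ LaxMonoidal.μ F ⟨m⟩ ⟨q⟩ :=
      (LaxMonoidal.μ_natural F (ofTerm s) (ofTerm t)).symm
    have hG : LaxMonoidal.μ G ⟨n⟩ ⟨p⟩ ≫ G.map (ofTerm (s.tensor t)) =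
        (G.map (ofTerm s) ⊗ₘ G.map (ofTerm t)) ≫ LaxMonoidal.μ G ⟨m⟩ ⟨q⟩ :=
      (LaxMonoidal.μ_natural G (ofTerm s) (ofTerm t)).symm
    rw [← cancel_epi (LaxMonoidal.μ F ⟨n⟩ ⟨p⟩), reassoc_of% hF, extendApp_tensor,
      reassoc_of% extendApp_tensor f n p, hG, tensorHom_comp_tensorHom_assoc,
      tensorHom_comp_tensorHom_assoc, hs, ht]

end SMTheory

namespace ThESCFM

open Functor PROP SMTheory

variable {C : Type u} [Category.{v} C] [MonoidalCategory C] [SymmetricCategory C]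
variable {F G : ThESCFM.Obj ⥤ C} [hF : F.Braided] [hG : G.Braided]

theorem extendApp_naturality_gen (f : generic.mapFunctor F ⟶ generic.mapFunctor G) {n m : ℕ}
    (σ : ESCFMGen n m) :
    F.map (ofTerm (T := theoryESCFM) (Term.gen σ)) ≫ extendApp f.hom m =
      extendApp f.hom n ≫ G.map (ofTerm (T := theoryESCFM) (Term.gen σ)) := by
  cases σ with
  | mul => exact extendApp_naturality_mul f.hom f.isMonHom.mul_hom
  | unit => exact extendApp_naturality_one f.hom f.isMonHom.one_hom
  | comul => exact extendApp_naturality_comul f.hom f.isComonHom.hom_comul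
  | counit => exact extendApp_naturality_counit f.hom f.isComonHom.hom_counit

/-- The natural transformation extending a morphism between the images of the generic monoid. -/
def extend (f : generic.mapFunctor F ⟶ generic.mapFunctor G) : F ⟶ G where
  app n := extendApp f.hom n.val
  naturality := by
    rintro ⟨n⟩ ⟨m⟩ ⟨t⟩
    exact @SMTheory.extendApp_naturality _ _ _ _ theoryESCFM F G hF hG _
      (extendApp_naturality_gen f) _ _ t

theorem isMonoidal_extend (f : generic.mapFunctor F ⟶ generic.mapFunctor G) :
    NatTrans.IsMonoidal (extend f) where
  unit := extendApp_zero f.hom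
  tensor n m := extendApp_tensor f.hom n.val m.val

instance : (generic.evaluation (C := C)).Faithful where
  map_injective {F G} θ θ' h := by
    have := θ.isMonoidal
    have := θ'.isMonoidal
    exact SymMonFunctor.Hom.ext (natTrans_ext (congrArg ESCFM.Hom.hom h))

instance : (generic.evaluation (C := C)).Full where
  map_surjective {F G} f :=
    ⟨⟨extend (F := F.functor) (G := G.functor) f, isMonoidal_extend f⟩,
      ESCFM.Hom.ext (extendApp_one (F := F.functor) (G := G.functor) f.hom)⟩

end ThESCFM

/-! ### Every extraspecial commutative Frobenius monoid is the image of the generic one -/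

namespace ESCFM

section

variable {C : Type u} [Category.{v} C] [MonoidalCategory C] [SymmetricCategory C]

/-- An isomorphism of extraspecial commutative Frobenius monoids from an isomorphism that commutes
with the operations. -/
def isoMk {A B : ESCFM C} (e : A.X ≅ B.X) (hmul : μ[A.X] ≫ e.hom = (e.hom ⊗ₘ e.hom) ≫ μ[B.X])
    (hone : η[A.X] ≫ e.hom = η[B.X]) (hcomul : e.hom ≫ Δ[B.X] = Δ[A.X] ≫ (e.hom ⊗ₘ e.hom))
    (hcounit : e.hom ≫ ε[B.X] = ε[A.X]) : A ≅ B where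
  hom := ⟨e.hom, ⟨hone, hmul⟩, ⟨hcounit, hcomul⟩⟩
  inv := ⟨e.inv,
    ⟨by rw [← hone, Category.assoc, e.hom_inv_id, Category.comp_id],
      by rw [← cancel_mono e.hom, Category.assoc, e.inv_hom_id, Category.comp_id, Category.assoc,
        hmul, tensorHom_comp_tensorHom_assoc, e.inv_hom_id, id_tensorHom_id, Category.id_comp]⟩,
    ⟨by rw [← hcounit, e.inv_hom_id_assoc],
      by rw [← cancel_epi e.hom, e.hom_inv_id_assoc, reassoc_of% hcomul, tensorHom_comp_tensorHom,
        e.hom_inv_id, id_tensorHom_id, Category.comp_id]⟩⟩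
  hom_inv_id := ESCFM.Hom.ext e.hom_inv_id
  inv_hom_id := ESCFM.Hom.ext e.inv_hom_id

/-- The identity functor preserves extraspecial commutative Frobenius monoids. -/
def mapFunctorId (A : ESCFM C) : A.mapFunctor (𝟭 C) ≅ A :=
  isoMk (Iso.refl _)
    (show (𝟙 _ ≫ μ[A.X]) ≫ 𝟙 _ = (𝟙 _ ⊗ₘ 𝟙 _) ≫ μ[A.X] by simp)
    (show (𝟙 _ ≫ η[A.X]) ≫ 𝟙 _ = η[A.X] by simp)
    (show 𝟙 _ ≫ Δ[A.X] = (Δ[A.X] ≫ 𝟙 _) ≫ (𝟙 _ ⊗ₘ 𝟙 _) by simp)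
    (show 𝟙 _ ≫ ε[A.X] = ε[A.X] ≫ 𝟙 _ by simp)

end

variable {C : Type u} [Category.{v} C] [MonoidalCategory C] [SymmetricCategory C]
variable {D E : Type*} [Category* D] [MonoidalCategory D] [SymmetricCategory D]
  [Category* E] [MonoidalCategory E] [SymmetricCategory E]

open Functor in
/-- Images of extraspecial commutative Frobenius monoids under a composite functor. -/
def mapFunctorComp (A : ESCFM D) (F : D ⥤ E) (G : E ⥤ C) [F.Braided] [G.Braided] :
    A.mapFunctor (F ⋙ G) ≅ (A.mapFunctor F).mapFunctor G :=
  isoMk (Iso.refl _)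
    (show ((LaxMonoidal.μ G _ _ ≫ G.map (LaxMonoidal.μ F _ _)) ≫ G.map (F.map μ[A.X])) ≫ 𝟙 _ =
      (𝟙 _ ⊗ₘ 𝟙 _) ≫ LaxMonoidal.μ G _ _ ≫ G.map (LaxMonoidal.μ F _ _ ≫ F.map μ[A.X]) by simp)
    (show ((LaxMonoidal.ε G ≫ G.map (LaxMonoidal.ε F)) ≫ G.map (F.map η[A.X])) ≫ 𝟙 _ =
      LaxMonoidal.ε G ≫ G.map (LaxMonoidal.ε F ≫ F.map η[A.X]) by simp)
    (show 𝟙 _ ≫ G.map (F.map Δ[A.X] ≫ OplaxMonoidal.δ F _ _) ≫ OplaxMonoidal.δ G _ _ =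
      (G.map (F.map Δ[A.X]) ≫ G.map (OplaxMonoidal.δ F _ _) ≫ OplaxMonoidal.δ G _ _) ≫
        (𝟙 _ ⊗ₘ 𝟙 _) by simp)
    (show 𝟙 _ ≫ G.map (F.map ε[A.X] ≫ OplaxMonoidal.η F) ≫ OplaxMonoidal.η G =
      G.map (F.map ε[A.X]) ≫ G.map (OplaxMonoidal.η F) ≫ OplaxMonoidal.η G by simp)

end ESCFM

namespace Corelation

variable {X Y Z : Type*}

theorem ofEquiv_comp_top (e : X ≃ Y) : (ofEquiv e).comp (⊤ : Corelation Y Z) = ⊤ := by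
  refine ext_colors fun u v => ?_
  rw [colors_ofEquiv_comp, colors_top, colors_top]
  simp only [Function.comp_apply, e.symm.forall_congr_left, Equiv.symm_symm, Equiv.symm_apply_apply]

theorem top_comp_ofEquiv (e : Y ≃ Z) : (⊤ : Corelation X Y).comp (ofEquiv e) = ⊤ := by
  refine ext_colors fun u v => ?_
  rw [colors_comp_ofEquiv, colors_top, colors_top]
  simp only [Function.comp_apply, e.forall_congr_left, Equiv.apply_symm_apply]

end Corelation

/-- The one-element set with its corelations that have exactly one block. -/
def FinCorel.point : ESCFM FinCorel.{w} :=
  (ThESCFM.generic.mapFunctor (PROP.functor evalESCFM)).mapFunctor corelInclusion.{w}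

namespace FinCorel.point

instance : Unique point.{w}.X.carrier := inferInstanceAs (Unique (ULift (Fin 1)))

theorem mul_eq_top : μ[point.{w}.X] =
    (⊤ : Corelation (point.{w}.X.carrier ⊕ point.{w}.X.carrier) point.{w}.X.carrier) :=
  (congrArg (CategoryStruct.comp _) (congrArg corelInclusion.map (corelPROP.id_comp _))).trans
    (Corelation.ofEquiv_comp_top _)

theorem one_eq_top : η[point.{w}.X] = (⊤ : Corelation PEmpty point.{w}.X.carrier) :=
  (congrArg (CategoryStruct.comp _) (congrArg corelInclusion.map (corelPROP.id_comp _))).trans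
    (Corelation.ofEquiv_comp_top _)

theorem comul_eq_top : Δ[point.{w}.X] =
    (⊤ : Corelation point.{w}.X.carrier (point.{w}.X.carrier ⊕ point.{w}.X.carrier)) :=
  (congrArg (· ≫ _) (congrArg corelInclusion.map (corelPROP.comp_id _))).trans
    (Corelation.top_comp_ofEquiv _)

theorem counit_eq_top : ε[point.{w}.X] = (⊤ : Corelation point.{w}.X.carrier PEmpty) :=
  (congrArg (· ≫ _) (congrArg corelInclusion.map (corelPROP.comp_id _))).trans
    (Corelation.top_comp_ofEquiv _)

end FinCorel.point

namespace Wiring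

variable {C : Type u} [Category.{v} C] [MonoidalCategory C] [SymmetricCategory C]
variable {A : ESCFM C} {X Y : FinCorel.{w}} (P P' : Wiring A X) (Q Q' : Wiring A Y)

theorem map_comp_iso_hom (f : X ⟶ Y) :
    P.map Q f ≫ (Q.iso Q').hom = (P.iso P').hom ≫ P'.map Q' f := by
  rw [iso, iso, ← map_comp, ← map_comp, Category.comp_id, Category.id_comp]

theorem tensor_iso_hom :
    ((P.tensor Q).iso (P'.tensor Q')).hom = (P.iso P').hom ⊗ₘ (Q.iso Q').hom := by
  rw [iso, iso, iso, ← map_tensor, id_tensorHom_id]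

theorem map_top_comp_iso_single [Unique X.carrier] :
    (P.tensor P).map P (⊤ : Corelation (X.carrier ⊕ X.carrier) X.carrier) ≫
        (P.iso (single A X)).hom =
      ((P.iso (single A X)).hom ⊗ₘ (P.iso (single A X)).hom) ≫ μ[A.X] := by
  rw [map_comp_iso_hom _ ((single A X).tensor (single A X)), tensor_iso_hom]
  exact congrArg _ Wires.map_mul

theorem map_empty_top_comp_iso_single [IsEmpty X.carrier] [Unique Y.carrier] :
    (empty A X).map Q (⊤ : Corelation X.carrier Y.carrier) ≫ (Q.iso (single A Y)).hom =
      η[A.X] := by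
  rw [iso, ← map_comp, Category.comp_id]
  exact Wires.map_unit

theorem iso_single_comp_comul [Unique X.carrier] :
    (P.iso (single A X)).hom ≫ Δ[A.X] =
      P.map (P.tensor P) (⊤ : Corelation X.carrier (X.carrier ⊕ X.carrier)) ≫
        ((P.iso (single A X)).hom ⊗ₘ (P.iso (single A X)).hom) := by
  rw [← tensor_iso_hom, map_comp_iso_hom _ (single A X)]
  exact congrArg _ Wires.map_comul.symm

theorem iso_single_comp_counit [Unique X.carrier] [IsEmpty Y.carrier] :
    (P.iso (single A X)).hom ≫ ε[A.X] =
      P.map (empty A Y) (⊤ : Corelation X.carrier Y.carrier) := by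
  refine (congrArg _ (Wires.map_counit (K := Y.carrier)).symm).trans ?_
  refine (map_comp P _ (empty A Y) _ (⊤ : Corelation X.carrier Y.carrier)).symm.trans ?_
  exact congrArg _ (Category.id_comp _)

end Wiring

namespace ESCFM

open Functor Wiring FinCorel

section

variable {C : Type u} [Category.{v} C] [MonoidalCategory C] [SymmetricCategory C]
variable (A : ESCFM C) {X Y Z : FinCorel.{w}}

theorem μ_comp_corelFunctor_map (f : X ⊗ Y ⟶ Z) :
    LaxMonoidal.μ A.corelFunctor X Y ≫ A.corelFunctor.map f =
      ((choice A X).tensor (choice A Y)).map (choice A Z) f :=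
  (map_comp _ _ _ _ _).symm.trans (congrArg _ (Category.id_comp f))

theorem ε_comp_corelFunctor_map (f : 𝟙_ FinCorel.{w} ⟶ X) :
    LaxMonoidal.ε A.corelFunctor ≫ A.corelFunctor.map f = (empty A _).map (choice A X) f :=
  (map_comp _ _ _ _ _).symm.trans (congrArg _ (Category.id_comp f))

theorem corelFunctor_map_comp_δ (f : Z ⟶ X ⊗ Y) :
    A.corelFunctor.map f ≫ OplaxMonoidal.δ A.corelFunctor X Y =
      (choice A Z).map ((choice A X).tensor (choice A Y)) f :=
  (map_comp _ _ _ _ _).symm.trans (congrArg _ (Category.comp_id f))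

theorem corelFunctor_map_comp_η (f : X ⟶ 𝟙_ FinCorel.{w}) :
    A.corelFunctor.map f ≫ OplaxMonoidal.η A.corelFunctor = (choice A X).map (empty A _) f :=
  (map_comp _ _ _ _ _).symm.trans (congrArg _ (Category.comp_id f))

/-- The functor determined by an extraspecial commutative Frobenius monoid sends the one-element
set to this monoid. -/
noncomputable def mapPointIso : point.{w}.mapFunctor A.corelFunctor ≅ A :=
  isoMk ((choice A point.X).iso (single A point.X))
    ((congrArg (· ≫ _) ((μ_comp_corelFunctor_map A _).trans
      (congrArg _ point.mul_eq_top))).trans (map_top_comp_iso_single _))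
    ((congrArg (· ≫ _) ((ε_comp_corelFunctor_map A _).trans
      (congrArg _ point.one_eq_top))).trans (map_empty_top_comp_iso_single _))
    ((iso_single_comp_comul _).trans (congrArg (· ≫ _) ((corelFunctor_map_comp_δ A _).trans
      (congrArg _ point.comul_eq_top)).symm))
    ((iso_single_comp_counit _).trans ((corelFunctor_map_comp_η A _).trans
      (congrArg _ point.counit_eq_top)).symm)

/-- The symmetric monoidal functor out of the presented prop determined by an extraspecial
commutative Frobenius monoid. -/
noncomputable abbrev modelFunctor : ThESCFM.Obj ⥤ C :=
  PROP.functor evalESCFM ⋙ corelInclusion.{w} ⋙ corelFunctor.{w} A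

end

variable {C : Type u} [Category.{v} C] [MonoidalCategory C] [SymmetricCategory C]

/-- The model functor sends the generic monoid to the given monoid. -/
noncomputable def modelIso (A : ESCFM C) : ThESCFM.generic.mapFunctor (modelFunctor.{w} A) ≅ A :=
  mapFunctorComp _ (PROP.functor evalESCFM) (corelInclusion.{w} ⋙ A.corelFunctor) ≪≫
    mapFunctorComp _ corelInclusion.{w} A.corelFunctor ≪≫ A.mapPointIso

end ESCFM

/-! ### The presented prop is isomorphic to the prop of corelations -/

/-- The natural isomorphism underlying an isomorphism of symmetric monoidal functors. -/
def SymMonFunctor.natIso {D C : Type*} [Category* D] [MonoidalCategory D] [SymmetricCategory D]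
    [Category* C] [MonoidalCategory C] [SymmetricCategory C] {F G : SymMonFunctor D C} (e : F ≅ G) :
    F.functor ≅ G.functor where
  hom := e.hom.hom
  inv := e.inv.hom
  hom_inv_id := congrArg SymMonFunctor.Hom.hom e.hom_inv_id
  inv_hom_id := congrArg SymMonFunctor.Hom.hom e.inv_hom_id

/-- The model of the generic monoid in the presented prop is naturally isomorphic to the identity,
because both send the generic monoid to itself. -/
noncomputable def ThESCFM.modelFunctorIso : ThESCFM.generic.modelFunctor ≅ 𝟭 ThESCFM.Obj :=
  SymMonFunctor.natIso (F := ⟨ThESCFM.generic.modelFunctor.{w}⟩) (G := ⟨𝟭 ThESCFM.Obj⟩)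
    (ThESCFM.generic.evaluation.preimageIso
      (ThESCFM.generic.modelIso.{w} ≪≫ ThESCFM.generic.mapFunctorId.symm))

theorem evalESCFM_injective {n m : ℕ} :
    Function.Injective (PROP.Morphism.map evalESCFM (n := n) (m := m)) := by
  have : ThESCFM.generic.modelFunctor.{0}.Faithful :=
    Functor.Faithful.of_iso ThESCFM.modelFunctorIso.symm
  have : (PROP.functor evalESCFM).Faithful := Functor.Faithful.of_comp _
    (corelInclusion.{0} ⋙ ThESCFM.generic.corelFunctor)
  exact (PROP.functor evalESCFM).map_injective (X := ⟨n⟩) (Y := ⟨m⟩)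

theorem evalESCFM_bijective (n m : ℕ) :
    Function.Bijective (PROP.Morphism.map evalESCFM (n := n) (m := m)) :=
  ⟨evalESCFM_injective, evalESCFM_surjective⟩

namespace PROP

variable {P Q : PROP.{w}} (φ : P ⟶ Q)

section

variable {φ}

/-- A morphism of props that is bijective on morphisms is an isomorphism. -/
noncomputable def isoOfBijective
    (h : ∀ n m, Function.Bijective (Morphism.map φ (n := n) (m := m))) : P ≅ Q :=
  let e n m := Equiv.ofBijective _ (h n m)
  have he {n m} (f : Q.Hom n m) : Morphism.map φ ((e n m).symm f) = f := (e n m).apply_symm_apply f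
  { hom := φ
    inv :=
      { map := fun {n m} f => (e n m).symm f
        map_id := fun n => (h n n).1 (by rw [he, Morphism.map_id])
        map_comp := fun f g => (h _ _).1 (by rw [he, Morphism.map_comp, he, he])
        map_tensor := fun f g => (h _ _).1 (by rw [he, Morphism.map_tensor, he, he])
        map_braid := fun n m => (h _ _).1 (by rw [he, Morphism.map_braid]) }
    hom_inv_id := Morphism.ext (funext fun n => funext fun m => funext (e n m).symm_apply_apply)
    inv_hom_id := Morphism.ext (funext fun _ => funext fun _ => funext he) }

theorem isEquivalence_functor
    (h : ∀ n m, Function.Bijective (Morphism.map φ (n := n) (m := m))) :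
    (functor φ).IsEquivalence where
  faithful := ⟨fun {n m} _ _ e => (h n.val m.val).1 e⟩
  full := ⟨fun {n m} f => (h n.val m.val).2 f⟩
  essSurj := ⟨fun n => ⟨⟨n.val⟩, ⟨Iso.refl _⟩⟩⟩

end

variable {C : Type u} [Category.{v} C] [MonoidalCategory C] [SymmetricCategory C]

/-- Precomposition with a morphism of props. -/
def precomp : SymMonFunctor Q.Obj C ⥤ SymMonFunctor P.Obj C where
  obj F := ⟨functor φ ⋙ F.functor⟩
  map θ := ⟨Functor.whiskerLeft _ θ.hom, by
    have := θ.isMonoidal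
    infer_instance⟩

theorem ε_functor_comp (F : Q.Obj ⥤ C) [F.Braided] :
    Functor.LaxMonoidal.ε (functor φ ⋙ F) = Functor.LaxMonoidal.ε F :=
  (congrArg _ (F.map_id _)).trans (Category.comp_id _)

theorem μ_functor_comp (F : Q.Obj ⥤ C) [F.Braided] (n m : ℕ) :
    Functor.LaxMonoidal.μ (functor φ ⋙ F) ⟨n⟩ ⟨m⟩ = Functor.LaxMonoidal.μ F ⟨n⟩ ⟨m⟩ :=
  (congrArg _ (F.map_id _)).trans (Category.comp_id _)

theorem isMonoidal_of_whiskerLeft_functor {F G : Q.Obj ⥤ C} [F.Braided] [G.Braided] (θ : F ⟶ G)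
    [NatTrans.IsMonoidal (Functor.whiskerLeft (functor φ) θ)] : NatTrans.IsMonoidal θ where
  unit := by
    have h := NatTrans.IsMonoidal.unit (τ := Functor.whiskerLeft (functor φ) θ)
    rw [ε_functor_comp, ε_functor_comp] at h
    exact h
  tensor n m := by
    have h := NatTrans.IsMonoidal.tensor (τ := Functor.whiskerLeft (functor φ) θ) ⟨n.val⟩ ⟨m.val⟩
    rw [μ_functor_comp, μ_functor_comp] at h
    exact h

instance : (precomp (C := C) φ).Faithful where
  map_injective h := SymMonFunctor.Hom.ext (NatTrans.ext (funext fun n =>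
    congrArg (fun ψ => ψ.hom.app (⟨n.val⟩ : P.Obj)) h))

theorem full_precomp (h : ∀ n m, Function.Surjective (Morphism.map φ (n := n) (m := m))) :
    (precomp (C := C) φ).Full where
  map_surjective {F G} ψ := by
    let θ : F.functor ⟶ G.functor :=
      { app := fun n => ψ.hom.app ⟨n.val⟩
        naturality := fun n m f => by
          obtain ⟨g, rfl⟩ := h n.val m.val f
          exact ψ.hom.naturality (X := ⟨n.val⟩) (Y := ⟨m.val⟩) g }
    have : NatTrans.IsMonoidal (Functor.whiskerLeft (functor φ) θ) := ψ.isMonoidal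
    exact ⟨⟨θ, isMonoidal_of_whiskerLeft_functor φ θ⟩, rfl⟩

end PROP

instance : ThESCFM.generic.corelFunctor.{w}.IsEquivalence := by
  have := Functor.isEquivalence_of_iso ThESCFM.modelFunctorIso.{w}.symm
  have := PROP.isEquivalence_functor evalESCFM_bijective
  have := Functor.isEquivalence_of_comp_left (PROP.functor evalESCFM)
    (corelInclusion.{w} ⋙ ThESCFM.generic.corelFunctor)
  exact Functor.isEquivalence_of_comp_left corelInclusion.{w} _

/-! ### The prop of corelations classifies extraspecial commutative Frobenius monoids -/

section

variable {C : Type u} [Category.{v} C] [MonoidalCategory C] [SymmetricCategory C]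

/-- Evaluation of symmetric monoidal functors out of the prop of corelations at the image of the
generic monoid. -/
abbrev corelEvaluation : SymMonFunctor corelPROP.Obj C ⥤ ESCFM C :=
  PROP.precomp evalESCFM ⋙ ThESCFM.generic.evaluation

instance : (corelEvaluation (C := C)).IsEquivalence where
  faithful := inferInstance
  full :=
    have := PROP.full_precomp (C := C) evalESCFM fun _ _ => evalESCFM_surjective
    inferInstance
  essSurj := ⟨fun A => ⟨⟨corelInclusion.{0} ⋙ A.corelFunctor⟩, ⟨A.modelIso⟩⟩⟩

end

end

/-- The prop of corelations is the strict skeleton of the symmetric monoidal category of finite sets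
and corelations, it is isomorphic to the prop presented by the theory of extraspecial commutative
Frobenius monoids (so that the category of corelations is equivalent to the latter as a symmetric
monoidal category), and it is the prop for extraspecial commutative Frobenius monoids. -/
theorem mainTheorem1 :
    (∃ F : SymMonFunctor corelPROP.Obj FinCorel.{w},
      IsSkeletonOf FinCorel.{w} corelPROP.Obj F.functor) ∧
    (∃ e : ThESCFM ≅ corelPROP,
      e.hom.map (theoryESCFM.gen ESCFMGen.mul) = (⊤ : Corelation (Fin 2) (Fin 1)) ∧
      e.hom.map (theoryESCFM.gen ESCFMGen.unit) = (⊤ : Corelation (Fin 0) (Fin 1)) ∧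
      e.hom.map (theoryESCFM.gen ESCFMGen.comul) = (⊤ : Corelation (Fin 1) (Fin 2)) ∧
      e.hom.map (theoryESCFM.gen ESCFMGen.counit) = (⊤ : Corelation (Fin 1) (Fin 0))) ∧
    (∃ F : SymMonFunctor FinCorel.{w} ThESCFM.Obj, F.functor.IsEquivalence) ∧
    (∀ (C : Type u) [Category.{v} C] [MonoidalCategory C] [SymmetricCategory C],
      ∃ E : SymMonFunctor corelPROP.Obj C ≌ ESCFM C,
        Nonempty (E.functor ⋙ ESCFM.forget C ≅
          SymMonFunctor.eval C (⟨1⟩ : corelPROP.Obj))) := by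
  refine ⟨⟨⟨corelInclusion⟩, corelInclusion.isSkeletonOf⟩,
    ⟨PROP.isoOfBijective evalESCFM_bijective, rfl, rfl, rfl, rfl⟩,
    ⟨⟨ThESCFM.generic.corelFunctor⟩, inferInstance⟩, fun C _ _ _ => ?_⟩
  exact ⟨corelEvaluation.asEquivalence, ⟨NatIso.ofComponents (fun F => Iso.refl _) fun θ =>
    (Category.comp_id _).trans (Category.id_comp _).symm⟩⟩
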